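/- Let $a>0$ and $c_+,c_-\in\mathbb C$, let $L^2(-a,a)$ be the complex Hilbert space with norm $\|\cdot\|$ and inner product antilinear in the first argument, and let $H$ be the operator in $L^2(-a,a)$ given by $H\psi=-\psi''$ with domain $$\{\psi\in W^{2,2}(-a,a):\ \psi'(\pm a)+c_\pm\psi(\pm a)=0\}.$$ Assume that all eigenvalues of $H$ are simple (algebraic multiplicity one). Let $(\lambda_n)_{n\ge 0}$ be an enumeration without repetition of the eigenvalues of $H$ such that $|\lambda_n|\le|\lambda_{n+1}|$ for all sufficiently large $n$. For each $n$ let $\phi_n\neq 0$ be an eigenfunction of $H^*$ for the eigenvalue $\overline{\lambda_n}$, normalized so that, for all but finitely many $n$, $$\phi_n(x)=\frac1{\sqrt a}\Big(\cos\big(\overline{l_n}(x+a)\big)-\frac{\overline{c_-}}{\overline{l_n}}\sin\big(\overline{l_n}(x+a)\big)\Big),\qquad l_n^2=\lambda_n .$$ Let $\chi_0^N(x)=\frac1{\sqrt{2a}}$ and $\chi_n^N(x)=\frac1{\sqrt a}\cos\big(\frac{n\pi}{2a}(x+a)\big)$ for $n\ge1$ be the Neumann eigenfunctions. Then $$\Omega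 f=\sum_{n=0}^\infty\langle\phi_n,f\rangle\,\chi_n^N\qquad(f\in L^2(-a,a))$$ converges in $L^2(-a,a)$ for every $f$ and defines a bounded operator with bounded inverse, and the following hold. 1. $\Omega=I+L$ and $\Omega^{-1}=I+M$ with Hilbert–Schmidt operators $L$ and $M$ on $L^2(-a,a)$. 2. Each of $\Omega$, $\Omega^*$, $\Omega^{-1}$, $(\Omega^{-1})^*$ maps $W^{1,2}(-a,a)$ to itself and $W^{2,2}(-a,a)$ to itself, and is bounded there for the respective Sobolev norm. Here $*$ is the adjoint in $L^2(-a,a)$. 3. $L^*$ and $M$ map $W^{1,2}(-a,a)$ to itself, and there is a constant $C$ such that for all $\phi\in W^{1,2}(-a,a)$ and all $\delta\in(0,1]$, $$\|(L^*\phi)'\|^2\le C\big(\delta\|\phi'\|^2+\delta^{-2}\|\phi\|^2\big),\qquad \|(M\phi)'\|^2\le C\big(\delta\|\phi'\|^2+\delta^{-2}\|\phi\|^2\big).$$ -/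

import Mathlib

open MeasureTheory Set Filter Topology
open scoped ContDiff ComplexConjugate

noncomputable section

/-- The complex Hilbert space `L²(-a, a)`; its inner product `inner ℂ f g` is antilinear in `f`. -/
abbrev L2 (a : ℝ) : Type := Lp ℂ 2 (volume.restrict (Ioo (-a) a))

/-- `g` is the weak derivative of `f` on `(-a, a)`: integration by parts holds against every smooth
function with compact support in `(-a, a)`. As `f` and `g` range over `L²(-a, a)`, the space
`W^{1,2}(-a, a)` is the set of all `f` for which such a `g` exists. -/
def HasWeakDeriv (a : ℝ) (f g : L2 a) : Prop :=
  ∀ η : ℝ → ℝ, ContDiff ℝ ∞ η → HasCompactSupport η → tsupport η ⊆ Ioo (-a) a →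
    ∫ x in Ioo (-a) a, deriv η x • f x = - ∫ x in Ioo (-a) a, η x • g x

lemma integrable_test_smul {a : ℝ} (f : L2 a) {η : ℝ → ℝ} (hη : Continuous η)
    (hc : HasCompactSupport η) :
    Integrable (fun x => η x • f x) (volume.restrict (Ioo (-a) a)) := by
  have hf : MemLp (f : ℝ → ℂ) 1 (volume.restrict (Ioo (-a) a)) :=
    (Lp.memLp f).mono_exponent (by norm_num)
  obtain ⟨C, hC⟩ := hc.exists_bound_of_continuous hη
  exact (memLp_one_iff_integrable.1 hf).bdd_smul C hη.aestronglyMeasurable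
    (Eventually.of_forall hC)

lemma integrable_deriv_test_smul {a : ℝ} (f : L2 a) {η : ℝ → ℝ} (hη : ContDiff ℝ ∞ η)
    (hc : HasCompactSupport η) :
    Integrable (fun x => deriv η x • f x) (volume.restrict (Ioo (-a) a)) :=
  integrable_test_smul f (hη.continuous_deriv (by simp)) hc.deriv

lemma HasWeakDeriv.add {a : ℝ} {f g f' g' : L2 a} (hf : HasWeakDeriv a f f')
    (hg : HasWeakDeriv a g g') : HasWeakDeriv a (f + g) (f' + g') := by
  intro η h1 h2 h3
  have e1 : ∫ x in Ioo (-a) a, deriv η x • (f + g : L2 a) x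
      = ∫ x in Ioo (-a) a, (deriv η x • f x + deriv η x • g x) := by
    refine integral_congr_ae ?_
    filter_upwards [Lp.coeFn_add f g] with x hx
    rw [hx, Pi.add_apply, smul_add]
  have e2 : ∫ x in Ioo (-a) a, η x • (f' + g' : L2 a) x
      = ∫ x in Ioo (-a) a, (η x • f' x + η x • g' x) := by
    refine integral_congr_ae ?_
    filter_upwards [Lp.coeFn_add f' g'] with x hx
    rw [hx, Pi.add_apply, smul_add]
  rw [e1, e2, integral_add (integrable_deriv_test_smul f h1 h2)
    (integrable_deriv_test_smul g h1 h2), integral_add (integrable_test_smul f' h1.continuous h2)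
    (integrable_test_smul g' h1.continuous h2), hf η h1 h2 h3, hg η h1 h2 h3]
  ring

lemma HasWeakDeriv.smul {a : ℝ} {f f' : L2 a} (c : ℂ) (hf : HasWeakDeriv a f f') :
    HasWeakDeriv a (c • f) (c • f') := by
  intro η h1 h2 h3
  have e1 : ∫ x in Ioo (-a) a, deriv η x • (c • f : L2 a) x
      = ∫ x in Ioo (-a) a, c • (deriv η x • f x) := by
    refine integral_congr_ae ?_
    filter_upwards [Lp.coeFn_smul c f] with x hx
    rw [hx, Pi.smul_apply, smul_comm]
  have e2 : ∫ x in Ioo (-a) a, η x • (c • f' : L2 a) x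
      = ∫ x in Ioo (-a) a, c • (η x • f' x) := by
    refine integral_congr_ae ?_
    filter_upwards [Lp.coeFn_smul c f'] with x hx
    rw [hx, Pi.smul_apply, smul_comm]
  rw [e1, e2, integral_smul, integral_smul, hf η h1 h2 h3, smul_neg]

lemma HasWeakDeriv.zero (a : ℝ) : HasWeakDeriv a 0 0 := by
  intro η _ _ _
  have e (ξ : ℝ → ℝ) : ∫ x in Ioo (-a) a, ξ x • (0 : L2 a) x = 0 := by
    rw [← integral_zero ℝ ℂ (μ := volume.restrict (Ioo (-a) a))]
    refine integral_congr_ae ?_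
    filter_upwards [Lp.coeFn_zero ℂ 2 (volume.restrict (Ioo (-a) a))] with x hx
    rw [hx, Pi.zero_apply, smul_zero]
  rw [e, e, neg_zero]

/-- The weak derivative is unique. -/
lemma HasWeakDeriv.eq_zero {a : ℝ} {g : L2 a} (h : HasWeakDeriv a 0 g) : g = 0 := by
  have hg : MemLp (g : ℝ → ℂ) 1 (volume.restrict (Ioo (-a) a)) :=
    (Lp.memLp g).mono_exponent (by norm_num)
  have hI : IntegrableOn (g : ℝ → ℂ) (Ioo (-a) a) volume := memLp_one_iff_integrable.1 hg
  have key := isOpen_Ioo.ae_eq_zero_of_integral_contDiff_smul_eq_zero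
    (hI.locallyIntegrableOn) (fun η h1 h2 h3 => by
      have h0 := h η h1 h2 h3
      have h00 : ∫ x in Ioo (-a) a, deriv η x • (0 : L2 a) x = 0 := by
        rw [← integral_zero ℝ ℂ (μ := volume.restrict (Ioo (-a) a))]
        refine integral_congr_ae ?_
        filter_upwards [Lp.coeFn_zero ℂ 2 (volume.restrict (Ioo (-a) a))] with x hx
        rw [hx, Pi.zero_apply, smul_zero]
      rw [h00, zero_eq_neg] at h0
      rw [← h0]
      refine (setIntegral_eq_integral_of_forall_compl_eq_zero fun x hx => ?_).symm
      rw [image_eq_zero_of_notMem_tsupport (fun hx' => hx (h3 hx')), zero_smul])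
  refine Lp.ext ?_
  have h1 : (g : ℝ → ℂ) =ᵐ[volume.restrict (Ioo (-a) a)] fun _ => 0 :=
    (ae_restrict_iff' measurableSet_Ioo).2 key
  exact h1.trans (Lp.coeFn_zero ℂ 2 (volume.restrict (Ioo (-a) a))).symm

/-- The graph of the operator `ψ ↦ -ψ''` on the domain of all `ψ ∈ W^{2,2}(-a, a)` with
`ψ'(±a) + c± ψ(±a) = 0` (`cp` is `c₊`, `cm` is `c₋`). The functions `u` and `v` are the
representatives of `ψ` and `ψ'` that are continuous on `[-a, a]`. -/
def robinGraph (a : ℝ) (cp cm : ℂ) : Submodule ℂ (L2 a × L2 a) where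
  carrier := {p | ∃ ψ' : L2 a, HasWeakDeriv a p.1 ψ' ∧ HasWeakDeriv a ψ' (-p.2) ∧
    ∃ u v : ℝ → ℂ, ContinuousOn u (Icc (-a) a) ∧ ContinuousOn v (Icc (-a) a) ∧
      p.1 =ᵐ[volume.restrict (Ioo (-a) a)] u ∧ ψ' =ᵐ[volume.restrict (Ioo (-a) a)] v ∧
      v a + cp * u a = 0 ∧ v (-a) + cm * u (-a) = 0}
  add_mem' := by
    rintro ⟨f, F⟩ ⟨g, G⟩ ⟨f', h1, h2, u, v, hu, hv, h3, h4, h5, h6⟩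
      ⟨g', k1, k2, w, z, hw, hz, k3, k4, k5, k6⟩
    refine ⟨f' + g', h1.add k1, ?_, u + w, v + z, hu.add hw, hv.add hz,
      (Lp.coeFn_add f g).trans (h3.add k3), (Lp.coeFn_add f' g').trans (h4.add k4), ?_, ?_⟩
    · have := h2.add k2
      rw [Prod.mk_add_mk, neg_add]
      exact this
    · simp only [Pi.add_apply]
      linear_combination h5 + k5
    · simp only [Pi.add_apply]
      linear_combination h6 + k6
  zero_mem' := by
    refine ⟨0, HasWeakDeriv.zero a, by simpa using HasWeakDeriv.zero a, 0, 0, continuousOn_const,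
      continuousOn_const, Lp.coeFn_zero _ _ _, Lp.coeFn_zero _ _ _, by simp, by simp⟩
  smul_mem' := by
    rintro c ⟨f, F⟩ ⟨f', h1, h2, u, v, hu, hv, h3, h4, h5, h6⟩
    refine ⟨c • f', h1.smul c, ?_, c • u, c • v, hu.const_smul c, hv.const_smul c,
      (Lp.coeFn_smul c f).trans (h3.const_smul c), (Lp.coeFn_smul c f').trans (h4.const_smul c),
      ?_, ?_⟩
    · have := h2.smul c
      simpa using this
    · simp only [Pi.smul_apply, smul_eq_mul]
      linear_combination c * h5
    · simp only [Pi.smul_apply, smul_eq_mul]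
      linear_combination c * h6

/-- The operator `H` in `L²(-a, a)`: `H ψ = -ψ''` on the domain of all `ψ ∈ W^{2,2}(-a, a)` with
`ψ'(±a) + c± ψ(±a) = 0`. -/
def robinOp (a : ℝ) (cp cm : ℂ) : L2 a →ₗ.[ℂ] L2 a :=
  (robinGraph a cp cm).toLinearPMap

/-- The pairs `(ψ, H ψ)` are the elements of `robinGraph`. -/
lemma robinOp_graph (a : ℝ) (cp cm : ℂ) : (robinOp a cp cm).graph = robinGraph a cp cm := by
  refine Submodule.toLinearPMap_graph_eq _ ?_
  rintro ⟨f, F⟩ ⟨f', h1, h2, -⟩ hf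
  have hf0 : f = 0 := hf
  subst hf0
  have h3 : f' = 0 := h1.eq_zero
  subst h3
  exact neg_eq_zero.1 h2.eq_zero

/-- `f` lies in the domain of the unbounded operator `T` and is an eigenvector for `μ`. -/
def IsEigenvector {E : Type*} [AddCommGroup E] [Module ℂ E] (T : E →ₗ.[ℂ] E) (μ : ℂ) (f : E) :
    Prop :=
  f ≠ 0 ∧ (f, μ • f) ∈ T.graph

/-- The kernel of `(T - μ)ⁿ` for an unbounded operator `T`. -/
def kerPow {E : Type*} [AddCommGroup E] [Module ℂ E] (T : E →ₗ.[ℂ] E) (μ : ℂ) :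
    ℕ → Submodule ℂ E
  | 0 => ⊥
  | n + 1 => ((kerPow T μ n).comap (LinearMap.snd ℂ E E - μ • LinearMap.fst ℂ E E) ⊓
      T.graph).map (LinearMap.fst ℂ E E)

/-- `μ` is a simple eigenvalue of `T`: its algebraic multiplicity, the dimension of the union of
the kernels of all powers of `T - μ`, is one. -/
def IsSimpleEigenvalue {E : Type*} [AddCommGroup E] [Module ℂ E] (T : E →ₗ.[ℂ] E) (μ : ℂ) :
    Prop :=
  Module.finrank ℂ (⨆ n, kerPow T μ n : Submodule ℂ E) = 1

/-- `T` is a Hilbert–Schmidt operator: `∑ ‖T bᵢ‖² < ∞` for an orthonormal basis `b` (the sum does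
not depend on the basis). -/
def IsHilbertSchmidt {E : Type*} [NormedAddCommGroup E] [InnerProductSpace ℂ E]
    (T : E →L[ℂ] E) : Prop :=
  ∃ (s : Set E) (b : HilbertBasis s ℂ E), Summable fun i => ‖T (b i)‖ ^ 2

/-- `T` maps `W^{1,2}(-a, a)` to itself and is bounded there for the norm
`(‖f‖² + ‖f'‖²)^{1/2}`. -/
def BoundedOnW12 (a : ℝ) (T : L2 a →L[ℂ] L2 a) : Prop :=
  ∃ C : ℝ, ∀ f f' : L2 a, HasWeakDeriv a f f' →
    ∃ g' : L2 a, HasWeakDeriv a (T f) g' ∧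
      ‖T f‖ ^ 2 + ‖g'‖ ^ 2 ≤ C * (‖f‖ ^ 2 + ‖f'‖ ^ 2)

/-- `T` maps `W^{2,2}(-a, a)` to itself and is bounded there for the norm
`(‖f‖² + ‖f'‖² + ‖f''‖²)^{1/2}`. -/
def BoundedOnW22 (a : ℝ) (T : L2 a →L[ℂ] L2 a) : Prop :=
  ∃ C : ℝ, ∀ f f' f'' : L2 a, HasWeakDeriv a f f' → HasWeakDeriv a f' f'' →
    ∃ g' g'' : L2 a, HasWeakDeriv a (T f) g' ∧ HasWeakDeriv a g' g'' ∧
      ‖T f‖ ^ 2 + ‖g'‖ ^ 2 + ‖g''‖ ^ 2 ≤ C * (‖f‖ ^ 2 + ‖f'‖ ^ 2 + ‖f''‖ ^ 2)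

lemma memLp_of_continuous (a : ℝ) (u : C(ℝ, ℂ)) :
    MemLp u 2 (volume.restrict (Ioo (-a) a)) := by
  obtain ⟨C, hC⟩ := isCompact_Icc.exists_bound_of_continuousOn
    (u.continuous.continuousOn (s := Icc (-a) a))
  refine MemLp.of_bound u.continuous.aestronglyMeasurable C ?_
  filter_upwards [ae_restrict_mem measurableSet_Ioo] with x hx
  exact hC x (Ioo_subset_Icc_self hx)

/-- The element of `L²(-a, a)` given by a continuous function on `ℝ`. -/
def toL2 (a : ℝ) (u : C(ℝ, ℂ)) : L2 a :=
  MemLp.toLp u (memLp_of_continuous a u)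

/-- The Neumann eigenfunctions on `(-a, a)`: `χ₀ = 1 / √(2a)` and, for `n ≥ 1`,
`χₙ(x) = cos (kₙ (x + a)) / √a` with `kₙ = nπ / (2a)`. -/
def neumannFun (a : ℝ) (n : ℕ) (x : ℝ) : ℝ :=
  if n = 0 then 1 / √(2 * a) else 1 / √a * Real.cos (n * Real.pi / (2 * a) * (x + a))

lemma continuous_neumannFun (a : ℝ) (n : ℕ) : Continuous (neumannFun a n) := by
  unfold neumannFun
  split_ifs <;> fun_prop

/-- The Neumann eigenfunctions as elements of `L²(-a, a)`. -/
def neumannMode (a : ℝ) (n : ℕ) : L2 a :=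
  toL2 a ⟨fun x => (neumannFun a n x : ℂ), Complex.continuous_ofReal.comp
    (continuous_neumannFun a n)⟩

/-- The eigenfunction of the adjoint of `H` for the eigenvalue `conj (l ^ 2)`, `l ≠ 0`, normalized
to take the value `1 / √a` at `-a`:
`x ↦ (cos (conj l (x + a)) - conj c₋ / conj l * sin (conj l (x + a))) / √a`. -/
def adjointFun (a : ℝ) (cm l : ℂ) (x : ℝ) : ℂ :=
  1 / (√a : ℂ) * (Complex.cos (conj l * (x + a)) -
    conj cm / conj l * Complex.sin (conj l * (x + a)))

end

/-! Write `χₙ` for the Neumann modes, `kₙ = nπ/(2a)` for their wave numbers, `sₙ` for the sines with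
the same wave numbers, `ψₙ` for the eigenfunctions of `H`, and let `K` be the operator with `K χₙ =
φₙ - χₙ`. Then `Ω = I + K*`, so `L = K*`, and the theorem reduces to three facts about `K`.

`K` is Hilbert–Schmidt. The eigenvalues are the zeros of the entire function `robinCharFun`, and
these zeros are simple because the eigenvalues are (`deriv_robinCharFun_ne_zero`). Rouché's theorem,
applied on circles separating the Neumann eigenvalues, counts them; the ordering by modulus turns
the count into a location of each `λₙ`, and the characteristic equation sharpens this to `lₙ = kₙ +
O(1/n)` for a suitable root (`exists_sqrt_near_waveNumber`). Hence `φₙ - χₙ = O(1/n)` uniformly in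
`x`, which is square summable.

`I + K` is injective. Every `φₙ` is a multiple of the complex conjugate of `ψₙ`
(`IsEigenvector.exists_eq_smul`), and `⟨φₙ, ψₘ⟩ = 0` for `n ≠ m`. If `⟨φₙ, ψₙ⟩` vanished, `(H - λₙ)
w = ψₙ` would be solvable, against simplicity. Pairing `∑ ⟨χₙ, f⟩ φₙ = 0` with `ψₘ` therefore kills
each coefficient of `f`. The Fredholm alternative makes `I + K`, and then `I + K*`, invertible.

`K` and `K*` gain one derivative (`IsSmoothing`, obtained in `isSmoothing_of_near`). The families
`kₙ (φₙ - χₙ)` and `φₙ' + kₙ sₙ` are not square summable, but up to `O(1/n)` they are bounded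
multiples of `sₙ` or `χₙ`, possibly multiplied by `x + a`; such families are images of the
orthonormal basis under bounded operators. This gives termwise differentiation for `K`. For `K*` on
`W^{1,2}` an integration by parts leaves boundary terms whose coefficients are not square summable;
their leading parts are the Neumann coefficients of two explicit quadratic polynomials, which are
split off.

The inverse inherits the Sobolev bounds from `Ω⁻¹ = I - K* Ω⁻¹`. The derivatives of `L* f` and `M f`
are even bounded by `‖f‖` alone, so the inequality with `δ` only needs `δ ≤ 1`. -/

section Bessel

/-! ### Bessel families, and Hilbert–Schmidt perturbations of the identity. -/

variable {E : Type*} [NormedAddCommGroup E] [InnerProductSpace ℂ E]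

theorem HilbertBasis.summable_sq_norm_inner (χ : HilbertBasis ℕ ℂ E) (f : E) :
    Summable fun n => ‖inner ℂ (χ n) f‖ ^ 2 :=
  χ.orthonormal.inner_products_summable f

theorem HilbertBasis.hasSum_smul (χ : HilbertBasis ℕ ℂ E) (f : E) :
    HasSum (fun n => inner ℂ (χ n) f • χ n) f := by
  simpa [HilbertBasis.repr_apply_apply] using χ.hasSum_repr f

theorem HilbertBasis.hasSum_apply (χ : HilbertBasis ℕ ℂ E) {F : Type*} [NormedAddCommGroup F]
    [NormedSpace ℂ F] (T : E →L[ℂ] F) (f : E) :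
    HasSum (fun n => inner ℂ (χ n) f • T (χ n)) (T f) := by
  simpa using (χ.hasSum_smul f).mapL T

theorem HilbertBasis.hasSum_sq_norm_inner (χ : HilbertBasis ℕ ℂ E) (f : E) :
    HasSum (fun n => ‖inner ℂ (χ n) f‖ ^ 2) (‖f‖ ^ 2) := by
  have h := χ.hasSum_inner_mul_inner f f
  have h2 := Complex.hasSum_re h
  rw [← RCLike.re_eq_complex_re, inner_self_eq_norm_sq] at h2
  refine h2.congr_fun ?_
  intro n
  rw [← inner_conj_symm f (χ n), RCLike.conj_mul]
  norm_cast

theorem HilbertBasis.clm_ext (χ : HilbertBasis ℕ ℂ E) {F : Type*} [NormedAddCommGroup F]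
    [NormedSpace ℂ F] {S T : E →L[ℂ] F} (h : ∀ n, S (χ n) = T (χ n)) : S = T := by
  ext f
  have h1 := χ.hasSum_apply S f
  simp only [h] at h1
  exact h1.unique (χ.hasSum_apply T f)

/-- A family with an upper frame bound is the image of the orthonormal basis under a bounded
operator. -/
theorem HilbertBasis.exists_clm_of_bound [CompleteSpace E] (χ : HilbertBasis ℕ ℂ E) (v : ℕ → E)
    {C : ℝ} (hC : 0 ≤ C)
    (h : ∀ (s : Finset ℕ) (c : ℕ → ℂ), ‖∑ i ∈ s, c i • v i‖ ^ 2 ≤ C ^ 2 * ∑ i ∈ s, ‖c i‖ ^ 2) :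
    ∃ T : E →L[ℂ] E, ‖T‖ ≤ C ∧ ∀ n, T (χ n) = v n := by
  have hs (f : E) : Summable fun n => inner ℂ (χ n) f • v n := by
    rw [summable_iff_vanishing_norm]
    intro ε hε
    -- The hypothesis turns small tails of `∑ |⟨χₙ, f⟩|²` into small tails of the vector series; `C²
    -- + 1` instead of `C²` covers `C = 0`.
    obtain ⟨s, hs⟩ := summable_iff_vanishing_norm.1 (χ.summable_sq_norm_inner f)
      (ε ^ 2 / (C ^ 2 + 1)) (by positivity)
    refine ⟨s, fun t ht => ?_⟩
    have h1 := h t fun n => inner ℂ (χ n) f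
    have h2 := hs t ht
    rw [Real.norm_of_nonneg (by positivity), lt_div_iff₀ (by positivity)] at h2
    have h3 : 0 ≤ ∑ i ∈ t, ‖inner ℂ (χ i) f‖ ^ 2 := by positivity
    refine lt_of_pow_lt_pow_left₀ 2 hε.le ?_
    nlinarith
  have hb (f : E) : ‖∑' n, inner ℂ (χ n) f • v n‖ ≤ C * ‖f‖ := by
    have h1 := ((hs f).hasSum.norm.pow 2 :)
    have h2 : Tendsto (fun s : Finset ℕ => C ^ 2 * ∑ i ∈ s, ‖inner ℂ (χ i) f‖ ^ 2) atTop
      (𝓝 (C ^ 2 * ‖f‖ ^ 2)) := (χ.hasSum_sq_norm_inner f).const_mul _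
    have h3 := le_of_tendsto_of_tendsto' h1 h2 fun s => h s _
    rw [← mul_pow] at h3
    exact le_of_sq_le_sq h3 (by positivity)
  let T : E →ₗ[ℂ] E :=
    { toFun := fun f => ∑' n, inner ℂ (χ n) f • v n
      map_add' := fun f g => by
        rw [← (hs f).tsum_add (hs g)]
        simp only [inner_add_right, add_smul]
      map_smul' := fun c f => by
        simp only [inner_smul_right, mul_smul, RingHom.id_apply]
        exact (hs f).tsum_const_smul c }
  refine ⟨T.mkContinuous C hb, T.mkContinuous_norm_le hC hb, fun n => ?_⟩
  change ∑' m, inner ℂ (χ m) (χ n) • v m = v n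
  rw [tsum_eq_single n, inner_self_eq_norm_sq_to_K, χ.orthonormal.1]
  · simp
  · intro m hm
    rw [χ.orthonormal.2 hm, zero_smul]

/-- The image of the orthonormal basis under some bounded operator. -/
def IsBessel (χ : HilbertBasis ℕ ℂ E) (v : ℕ → E) : Prop :=
  ∃ T : E →L[ℂ] E, ∀ n, T (χ n) = v n

variable {χ : HilbertBasis ℕ ℂ E} {v w : ℕ → E}

theorem IsBessel.add (hv : IsBessel χ v) (hw : IsBessel χ w) : IsBessel χ fun n => v n + w n := by
  obtain ⟨S, hS⟩ := hv
  obtain ⟨T, hT⟩ := hw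
  exact ⟨S + T, fun n => by simp [hS, hT]⟩

theorem IsBessel.sub (hv : IsBessel χ v) (hw : IsBessel χ w) : IsBessel χ fun n => v n - w n := by
  obtain ⟨S, hS⟩ := hv
  obtain ⟨T, hT⟩ := hw
  exact ⟨S - T, fun n => by simp [hS, hT]⟩

theorem IsBessel.map (hv : IsBessel χ v) (A : E →L[ℂ] E) : IsBessel χ fun n => A (v n) := by
  obtain ⟨S, hS⟩ := hv
  exact ⟨A ∘L S, fun n => by simp [hS]⟩

theorem sum_smul_sq_of_orthogonal (hv : Pairwise fun m n => (inner ℂ (v m) (v n) : ℂ) = 0)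
    (s : Finset ℕ) (c : ℕ → ℂ) :
    ‖∑ i ∈ s, c i • v i‖ ^ 2 = ∑ i ∈ s, ‖c i‖ ^ 2 * ‖v i‖ ^ 2 := by
  induction s using Finset.induction_on with
  | empty => simp
  | insert i s hi ih =>
    rw [Finset.sum_insert hi, Finset.sum_insert hi, sq, norm_add_sq_eq_norm_sq_add_norm_sq_of_inner_eq_zero (𝕜 := ℂ),
      ← sq, ← sq, ih, norm_smul, mul_pow]
    rw [inner_sum]
    refine Finset.sum_eq_zero fun j hj => ?_
    rw [inner_smul_left, inner_smul_right, hv (by rintro rfl; exact hi hj), mul_zero, mul_zero]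

variable [CompleteSpace E]

theorem IsBessel.of_orthogonal (hv : Pairwise fun m n => inner ℂ (v m) (v n) = 0)
    {C : ℝ} (hC : ∀ n, ‖v n‖ ≤ C) : IsBessel χ v := by
  have hC0 : 0 ≤ C := (norm_nonneg _).trans (hC 0)
  obtain ⟨T, -, hT⟩ := χ.exists_clm_of_bound v hC0 fun s c => by
    rw [sum_smul_sq_of_orthogonal hv, Finset.mul_sum]
    refine Finset.sum_le_sum fun i _ => ?_
    rw [mul_comm]
    gcongr
    exact hC i
  exact ⟨T, hT⟩

/-- The factors can be moved to the basis: the diagonal operator `χₙ ↦ bₙ χₙ` is bounded, and the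
operator of `v` is applied after it. -/
theorem IsBessel.smul (hv : IsBessel χ v) {b : ℕ → ℂ} {C : ℝ} (hb : ∀ n, ‖b n‖ ≤ C) :
    IsBessel χ fun n => b n • v n := by
  obtain ⟨S, hS⟩ := hv
  have h : IsBessel χ fun n => b n • χ n := by
    refine IsBessel.of_orthogonal (C := C) (fun m n hmn => ?_) fun n => ?_
    · change inner ℂ (b m • χ m) (b n • χ n) = 0
      rw [inner_smul_left, inner_smul_right, χ.orthonormal.2 hmn, mul_zero, mul_zero]
    · simpa [norm_smul, χ.orthonormal.1] using hb n
  simpa [hS] using h.map S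

/-- Cauchy–Schwarz. The explicit norm bound serves the tail estimate in
`HilbertBasis.isCompactOperator`. -/
theorem HilbertBasis.exists_clm_of_summable (χ : HilbertBasis ℕ ℂ E)
    (hv : Summable fun n => ‖v n‖ ^ 2) :
    ∃ T : E →L[ℂ] E, ‖T‖ ≤ √(∑' n, ‖v n‖ ^ 2) ∧ ∀ n, T (χ n) = v n := by
  refine χ.exists_clm_of_bound v (Real.sqrt_nonneg _) fun s c => ?_
  have h1 : ‖∑ i ∈ s, c i • v i‖ ≤ √(∑ i ∈ s, ‖c i‖ ^ 2) * √(∑ i ∈ s, ‖v i‖ ^ 2) := by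
    refine (norm_sum_le _ _).trans ?_
    simp only [norm_smul]
    exact Real.sum_mul_le_sqrt_mul_sqrt _ _ _
  have h2 : ∑ i ∈ s, ‖v i‖ ^ 2 ≤ ∑' n, ‖v n‖ ^ 2 := hv.sum_le_tsum s fun _ _ => by positivity
  calc ‖∑ i ∈ s, c i • v i‖ ^ 2
      ≤ (√(∑ i ∈ s, ‖c i‖ ^ 2) * √(∑ i ∈ s, ‖v i‖ ^ 2)) ^ 2 := by gcongr
    _ = (∑ i ∈ s, ‖v i‖ ^ 2) * ∑ i ∈ s, ‖c i‖ ^ 2 := by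
        rw [mul_pow, Real.sq_sqrt (by positivity), Real.sq_sqrt (by positivity), mul_comm]
    _ ≤ √(∑' n, ‖v n‖ ^ 2) ^ 2 * ∑ i ∈ s, ‖c i‖ ^ 2 := by
        rw [Real.sq_sqrt (tsum_nonneg fun _ => by positivity)]
        gcongr

theorem IsBessel.of_summable (hv : Summable fun n => ‖v n‖ ^ 2) : IsBessel χ v := by
  obtain ⟨T, -, hT⟩ := χ.exists_clm_of_summable hv
  exact ⟨T, hT⟩

/-- The difference of the families has finite support, hence is square summable. Asymptotic
information for large `n` is thus enough. -/
theorem IsBessel.congr_eventually (hv : IsBessel χ v) (h : ∀ᶠ n in atTop, w n = v n) :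
    IsBessel χ w := by
  have h1 : IsBessel χ fun n => w n - v n := by
    refine IsBessel.of_summable ?_
    obtain ⟨N, hN⟩ := eventually_atTop.1 h
    refine summable_of_hasFiniteSupport ((Set.finite_lt_nat N).subset fun n hn => ?_)
    by_contra h2
    simp [hN n (not_lt.1 h2)] at hn
  simpa using h1.add hv

theorem summable_sq_of_le_div {x : ℕ → ℝ} {C : ℝ} (hx : ∀ᶠ n in atTop, |x n| ≤ C / n) :
    Summable fun n => x n ^ 2 := by
  have h1 : Summable fun n : ℕ => C ^ 2 * (1 / (n : ℝ) ^ 2) :=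
    (Real.summable_one_div_nat_pow.2 one_lt_two).mul_left _
  refine h1.of_norm_bounded_eventually_nat ?_
  filter_upwards [hx] with n hn
  rw [Real.norm_of_nonneg (sq_nonneg _), ← sq_abs, mul_one_div, ← div_pow]
  gcongr

theorem IsBessel.of_le_div {C : ℝ} (hv : ∀ᶠ n in atTop, ‖v n‖ ≤ C / n) : IsBessel χ v :=
  IsBessel.of_summable (summable_sq_of_le_div (C := C) (by simpa using hv))

/-- An operator whose values on an orthonormal basis are square summable is compact. -/
theorem HilbertBasis.isCompactOperator (χ : HilbertBasis ℕ ℂ E) {T : E →L[ℂ] E}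
    (hT : Summable fun n => ‖T (χ n)‖ ^ 2) : IsCompactOperator T := by
  -- Finite rank truncations. The difference `T - P N` is the operator of the tail of `T χₙ`, so its
  -- norm is at most the root of the tail sum.
  let P (N : ℕ) : E →L[ℂ] E :=
    ∑ n ∈ Finset.range N, (ContinuousLinearMap.toSpanSingleton ℂ (T (χ n))) ∘L innerSL ℂ (χ n)
  have hP (N : ℕ) : IsCompactOperator (P N) := by
    change P N ∈ compactOperator (RingHom.id ℂ) E E
    refine Submodule.sum_mem _ fun n _ => ?_
    have h : IsCompactOperator (innerSL ℂ (χ n) : E →L[ℂ] ℂ) :=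
      isCompactOperator_of_locallyCompactSpace_dom (innerSL ℂ (χ n) : E →L[ℂ] ℂ)
    exact h.clm_comp
      (ContinuousLinearMap.toSpanSingleton ℂ (T (χ n)))
  have hPχ (N m : ℕ) : P N (χ m) = if m < N then T (χ m) else 0 := by
    simp only [P, sum_apply, ContinuousLinearMap.comp_apply, innerSL_apply_apply,
      orthonormal_iff_ite.1 χ.orthonormal, ContinuousLinearMap.toSpanSingleton_apply, ite_smul,
      one_smul, zero_smul, Finset.sum_ite_eq', Finset.mem_range]
  have hb (N : ℕ) : ‖T - P N‖ ≤ √(∑' n, ‖T (χ (n + N))‖ ^ 2) := by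
    let v : ℕ → E := fun m => if m < N then 0 else T (χ m)
    have hv : Summable fun m => ‖v m‖ ^ 2 := by
      refine hT.of_nonneg_of_le (fun _ => by positivity) fun m => ?_
      simp only [v]
      split_ifs <;> simp
    obtain ⟨S, hS1, hS2⟩ := χ.exists_clm_of_summable hv
    have : T - P N = S := χ.clm_ext fun m => by
      simp only [sub_apply, hPχ, hS2, v]
      split_ifs <;> simp
    rw [this]
    refine hS1.trans (le_of_eq ?_)
    rw [← hv.sum_add_tsum_nat_add N, Finset.sum_eq_zero]
    · simp [v]
    · intro m hm
      simp [v, Finset.mem_range.1 hm]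
  refine isCompactOperator_of_tendsto (l := atTop) (F := P) ?_ (Eventually.of_forall hP)
  rw [tendsto_iff_norm_sub_tendsto_zero]
  have h0 : Tendsto (fun N => √(∑' n, ‖T (χ (n + N))‖ ^ 2)) atTop (𝓝 0) := by
    have h1 := (Real.continuous_sqrt.tendsto 0).comp (tendsto_sum_nat_add fun n => ‖T (χ n)‖ ^ 2)
    rwa [Real.sqrt_zero] at h1
  refine squeeze_zero (fun _ => norm_nonneg _) (fun N => ?_) h0
  rw [norm_sub_rev]
  exact hb N

/-- Fredholm alternative for the identity plus a Hilbert–Schmidt operator. -/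
theorem HilbertBasis.bijective_id_add (χ : HilbertBasis ℕ ℂ E) {T : E →L[ℂ] E}
    (hT : Summable fun n => ‖T (χ n)‖ ^ 2) (hinj : ∀ f, f + T f = 0 → f = 0) :
    ∃ Ω : E ≃L[ℂ] E, (Ω : E →L[ℂ] E) = ContinuousLinearMap.id ℂ E + T := by
  -- For compact `T` the number `-1` is an eigenvalue, which injectivity excludes, or a regular
  -- point; then `I + T` is the negative of a unit.
  rcases (χ.isCompactOperator hT).hasEigenvalue_or_mem_resolventSet (μ := (-1 : ℂ)) (by simp)
    with h | h
  · obtain ⟨f, hf⟩ := h.exists_hasEigenvector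
    refine absurd (hinj f ?_) hf.2
    have h1 : T f = (-1 : ℂ) • f := hf.apply_eq_smul
    rw [h1]
    simp
  · rw [spectrum.mem_resolventSet_iff] at h
    have h2 : IsUnit (ContinuousLinearMap.id ℂ E + T) := by
      convert h.neg using 1
      ext f
      simp [Algebra.algebraMap_eq_smul_one, add_comm]
    obtain ⟨u, hu⟩ := h2
    exact ⟨ContinuousLinearEquiv.unitsEquiv ℂ E u, by rw [← hu]; rfl⟩

/-- Both sums are the double sum of the squared moduli of the matrix entries of `T`, summed by rows
or by columns. -/
theorem HilbertBasis.summable_adjoint (χ : HilbertBasis ℕ ℂ E) {T : E →L[ℂ] E}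
    (hT : Summable fun n => ‖T (χ n)‖ ^ 2) :
    Summable fun n => ‖ContinuousLinearMap.adjoint T (χ n)‖ ^ 2 := by
  have h1 : Summable fun p : ℕ × ℕ => ‖inner ℂ (χ p.2) (T (χ p.1))‖ ^ 2 := by
    rw [summable_prod_of_nonneg fun _ => sq_nonneg _]
    refine ⟨fun n => χ.summable_sq_norm_inner (T (χ n)), hT.congr fun n => ?_⟩
    exact (χ.hasSum_sq_norm_inner (T (χ n))).tsum_eq.symm
  have h2 : Summable fun p : ℕ × ℕ => ‖inner ℂ (χ p.1) (T (χ p.2))‖ ^ 2 :=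
    (Equiv.prodComm ℕ ℕ).summable_iff.2 h1
  have h3 := ((summable_prod_of_nonneg fun _ => sq_nonneg _).1 h2).2
  refine h3.congr fun n => ?_
  rw [← (χ.hasSum_sq_norm_inner _).tsum_eq]
  refine tsum_congr fun m => ?_
  rw [ContinuousLinearMap.adjoint_inner_right, ← inner_conj_symm, RCLike.norm_conj]

/-- `IsHilbertSchmidt` asks for a basis indexed by a subset of the space, hence the passage to the
range of `χ`. -/
theorem HilbertBasis.isHilbertSchmidt (χ : HilbertBasis ℕ ℂ E) {T : E →L[ℂ] E}
    (hT : Summable fun n => ‖T (χ n)‖ ^ 2) : IsHilbertSchmidt T := by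
  have hon := χ.orthonormal.toSubtypeRange
  refine ⟨Set.range χ, HilbertBasis.mk hon ?_, ?_⟩
  · rw [Subtype.range_coe, χ.dense_span]
  · rw [HilbertBasis.coe_mk]
    rw [← (Equiv.ofInjective χ χ.orthonormal.linearIndependent.injective).summable_iff]
    exact hT

end Bessel

/-! ### Weak derivatives tested against smooth functions that only vanish at the end points. -/

section WeakDerivative

variable {a : ℝ}

/-- The second property confines the derivative of `cutoff a k` to layers of width `2 / k` at the
end points. -/
theorem Real.exists_smoothTransition_deriv_le :
    ∃ B, ∀ t : ℝ, |deriv Real.smoothTransition t| ≤ B ∧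
      (1 < t → deriv Real.smoothTransition t = 0) := by
  have hc : Continuous (deriv Real.smoothTransition) :=
    (Real.smoothTransition.contDiff (n := 1)).continuous_deriv le_rfl
  have h1 {t : ℝ} (ht : 1 < t) : deriv Real.smoothTransition t = 0 := by
    have : Real.smoothTransition =ᶠ[𝓝 t] fun _ => 1 := by
      filter_upwards [lt_mem_nhds ht] with s hs
      exact Real.smoothTransition.one_of_one_le hs.le
    rw [this.deriv_eq, deriv_const]
  have h0 {t : ℝ} (ht : t < 0) : deriv Real.smoothTransition t = 0 := by
    have : Real.smoothTransition =ᶠ[𝓝 t] fun _ => 0 := by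
      filter_upwards [gt_mem_nhds ht] with s hs
      exact Real.smoothTransition.zero_of_nonpos hs.le
    rw [this.deriv_eq, deriv_const]
  obtain ⟨B, hB⟩ := (isCompact_Icc (a := (0 : ℝ)) (b := 1)).exists_bound_of_continuousOn
    hc.continuousOn
  refine ⟨B, fun t => ⟨?_, h1⟩⟩
  have hB0 : 0 ≤ B := (norm_nonneg _).trans (hB 0 (by simp))
  rcases lt_or_ge t 0 with ht | ht
  · rwa [h0 ht, abs_zero]
  rcases lt_or_ge 1 t with ht' | ht'
  · rwa [h1 ht', abs_zero]
  · exact hB t ⟨ht, ht'⟩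

/-- A smooth cutoff function which vanishes near `±a` and is one at distance `≥ 2 / k`. -/
noncomputable def cutoff (a : ℝ) (k : ℕ) (x : ℝ) : ℝ :=
  Real.smoothTransition (k * (x + a) - 1) * Real.smoothTransition (k * (a - x) - 1)

theorem contDiff_cutoff (a : ℝ) (k : ℕ) : ContDiff ℝ ∞ (cutoff a k) := by
  unfold cutoff
  have h : ContDiff ℝ ∞ Real.smoothTransition := Real.smoothTransition.contDiff
  exact (h.comp (by fun_prop)).mul (h.comp (by fun_prop))

theorem cutoff_nonneg (a : ℝ) (k : ℕ) (x : ℝ) : 0 ≤ cutoff a k x :=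
  mul_nonneg (Real.smoothTransition.nonneg _) (Real.smoothTransition.nonneg _)

theorem cutoff_le_one (a : ℝ) (k : ℕ) (x : ℝ) : cutoff a k x ≤ 1 :=
  mul_le_one₀ (Real.smoothTransition.le_one _) (Real.smoothTransition.nonneg _)
    (Real.smoothTransition.le_one _)

theorem cutoff_support_subset (a : ℝ) {k : ℕ} (hk : 0 < k) :
    Function.support (cutoff a k) ⊆ Icc (-a + 1 / k) (a - 1 / k) := by
  intro x hx
  have hk' : (0 : ℝ) < k := by exact_mod_cast hk
  rw [Function.mem_support, cutoff, mul_ne_zero_iff] at hx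
  have h1 : 0 < k * (x + a) - 1 := by
    by_contra h
    exact hx.1 (Real.smoothTransition.zero_of_nonpos (not_lt.1 h))
  have h2 : 0 < k * (a - x) - 1 := by
    by_contra h
    exact hx.2 (Real.smoothTransition.zero_of_nonpos (not_lt.1 h))
  have e1 : 1 / (k : ℝ) < x + a := by rw [div_lt_iff₀ hk']; linarith
  have e2 : 1 / (k : ℝ) < a - x := by rw [div_lt_iff₀ hk']; linarith
  constructor <;> linarith

theorem eventually_cutoff_eq_one {x : ℝ} (hx : x ∈ Ioo (-a) a) :
    ∀ᶠ k : ℕ in atTop, cutoff a k =ᶠ[𝓝 x] fun _ => 1 := by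
  have h (c : ℝ) (hc : 0 < c) : ∀ᶠ k : ℕ in atTop, 2 < k * c :=
    (tendsto_natCast_atTop_atTop.atTop_mul_const hc).eventually_gt_atTop 2
  filter_upwards [h (x + a) (by linarith [hx.1]), h (a - x) (by linarith [hx.2])] with k h1 h2
  have c1 : ∀ᶠ y in 𝓝 x, 2 < k * (y + a) :=
    (by fun_prop : Continuous fun y : ℝ => k * (y + a)).continuousAt.eventually_const_lt h1
  have c2 : ∀ᶠ y in 𝓝 x, 2 < k * (a - y) :=
    (by fun_prop : Continuous fun y : ℝ => k * (a - y)).continuousAt.eventually_const_lt h2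
  filter_upwards [c1, c2] with y h3 h4
  rw [cutoff, Real.smoothTransition.one_of_one_le (by linarith),
    Real.smoothTransition.one_of_one_le (by linarith), one_mul]

/-- The derivative of the cutoff is of order `k`, but only within distance `2 / k` of `±a`, where
the Lipschitz function `w` is of order `1 / k`. The bound is uniform in `k` and so permits dominated
convergence. -/
theorem exists_deriv_cutoff_mul_le {w : ℝ → ℝ} (hw : ContDiff ℝ ∞ w) (h1 : w a = 0)
    (h2 : w (-a) = 0) :
    ∃ C, ∀ (k : ℕ), ∀ x ∈ Ioo (-a) a, |deriv (cutoff a k) x * w x| ≤ C := by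
  obtain ⟨B, hB⟩ := Real.exists_smoothTransition_deriv_le
  obtain ⟨K, hK⟩ := (isCompact_Icc (a := -a) (b := a)).exists_bound_of_continuousOn
    (hw.continuous_deriv (by simp)).continuousOn
  have hlip {x y : ℝ} (hx : x ∈ Icc (-a) a) (hy : y ∈ Icc (-a) a) : |w y - w x| ≤ K * |y - x| :=
    (convex_Icc (-a) a).norm_image_sub_le_of_norm_deriv_le
      (fun z _ => (hw.differentiable (by simp)) z) hK hx hy
  refine ⟨2 * B * K + 2 * B * K, fun k x hx => ?_⟩
  have hxI : x ∈ Icc (-a) a := Ioo_subset_Icc_self hx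
  have hB0 : 0 ≤ B := (abs_nonneg _).trans (hB 0).1
  have hK0 : 0 ≤ K := (norm_nonneg _).trans (hK x hxI)
  have ha : -a ≤ a := hxI.1.trans hxI.2
  have w1 : |w x| ≤ K * (x + a) := by
    have := hlip (left_mem_Icc.2 ha) hxI
    rwa [h2, sub_zero, sub_neg_eq_add, abs_of_nonneg (a := x + a) (by linarith [hxI.1])] at this
  have w2 : |w x| ≤ K * (a - x) := by
    have := hlip hxI (right_mem_Icc.2 ha)
    rwa [h1, zero_sub, abs_neg, abs_of_nonneg (a := a - x) (by linarith [hxI.2])] at this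
  have key (t : ℝ) (ht : 0 ≤ t) (hw : |w x| ≤ K * t) :
      |k * deriv Real.smoothTransition (k * t - 1) * w x| ≤ 2 * B * K := by
    rcases lt_or_ge 1 (k * t - 1) with h | h
    · rw [(hB _).2 h, mul_zero, zero_mul, abs_zero]
      positivity
    · have hk : |(k : ℝ)| = k := abs_of_nonneg (Nat.cast_nonneg k)
      rw [abs_mul, abs_mul, hk]
      calc (k : ℝ) * |deriv Real.smoothTransition (k * t - 1)| * |w x|
          ≤ k * B * (K * t) := by
            gcongr
            exact (hB _).1
        _ = (k * t) * (B * K) := by ring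
        _ ≤ 2 * (B * K) := by
            gcongr
            linarith
        _ = 2 * B * K := by ring
  have hS := fun t => ((Real.smoothTransition.contDiff (n := 1)).differentiable (by simp)
    t).hasDerivAt
  have hd : HasDerivAt (cutoff a k)
      (deriv Real.smoothTransition (k * (x + a) - 1) * (k * 1) *
          Real.smoothTransition (k * (a - x) - 1) +
        Real.smoothTransition (k * (x + a) - 1) *
          (deriv Real.smoothTransition (k * (a - x) - 1) * (k * -1))) x := by
    have d1 : HasDerivAt (fun x : ℝ => k * (x + a) - 1) (k * 1) x :=
      (((hasDerivAt_id x).add_const a).const_mul (k : ℝ)).sub_const 1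
    have d2 : HasDerivAt (fun x : ℝ => k * (a - x) - 1) (k * -1) x :=
      (((hasDerivAt_id x).const_sub a).const_mul (k : ℝ)).sub_const 1
    exact ((hS _).comp x d1).mul ((hS _).comp x d2)
  rw [hd.deriv]
  have s1 (t : ℝ) : |Real.smoothTransition t| ≤ 1 := by
    rw [abs_of_nonneg (Real.smoothTransition.nonneg _)]
    exact Real.smoothTransition.le_one _
  have k1 := key (x + a) (by linarith [hxI.1]) w1
  have k2 := key (a - x) (by linarith [hxI.2]) w2
  calc _ = |k * deriv Real.smoothTransition (k * (x + a) - 1) * w x *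
            Real.smoothTransition (k * (a - x) - 1) -
          k * deriv Real.smoothTransition (k * (a - x) - 1) * w x *
            Real.smoothTransition (k * (x + a) - 1)| := by
        congr 1
        ring
    _ ≤ _ := by
        refine (abs_sub _ _).trans (add_le_add ?_ ?_)
        · rw [abs_mul]
          exact (mul_le_of_le_one_right (abs_nonneg _) (s1 _)).trans k1
        · rw [abs_mul]
          exact (mul_le_of_le_one_right (abs_nonneg _) (s1 _)).trans k2

theorem integrable_L2 (f : L2 a) : Integrable f (volume.restrict (Ioo (-a) a)) :=
  memLp_one_iff_integrable.1 ((Lp.memLp f).mono_exponent (by norm_num))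

theorem tendsto_integral_smul_of_bounded (f : L2 a) {F : ℕ → ℝ → ℝ} {G : ℝ → ℝ} {C : ℝ}
    (hF : ∀ k, Continuous (F k)) (hC : ∀ k, ∀ x ∈ Ioo (-a) a, |F k x| ≤ C)
    (hG : ∀ x ∈ Ioo (-a) a, Tendsto (fun k => F k x) atTop (𝓝 (G x))) :
    Tendsto (fun k => ∫ x in Ioo (-a) a, F k x • f x) atTop
      (𝓝 (∫ x in Ioo (-a) a, G x • f x)) := by
  refine tendsto_integral_of_dominated_convergence (fun x => C * ‖f x‖)
    (fun k => (hF k).aestronglyMeasurable.smul (Lp.aestronglyMeasurable f))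
    ((integrable_L2 f).norm.const_mul C) (fun k => ?_) ?_
  · filter_upwards [ae_restrict_mem measurableSet_Ioo] with x hx
    rw [norm_smul]
    gcongr
    exact hC k x hx
  · filter_upwards [ae_restrict_mem measurableSet_Ioo] with x hx
    exact (hG x hx).smul_const _

/-- Integration by parts against smooth functions vanishing at the end points. -/
theorem HasWeakDeriv.integral_deriv_smul {f g : L2 a} (h : HasWeakDeriv a f g)
    {w : ℝ → ℝ} (hw : ContDiff ℝ ∞ w) (h1 : w a = 0) (h2 : w (-a) = 0) :
    ∫ x in Ioo (-a) a, deriv w x • f x = -∫ x in Ioo (-a) a, w x • g x := by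
  have hd (k : ℕ) (x : ℝ) : deriv (fun x => cutoff a k x * w x) x =
      deriv (cutoff a k) x * w x + cutoff a k x * deriv w x :=
    (((contDiff_cutoff a k).differentiable (by simp) x).hasDerivAt.mul
      ((hw.differentiable (by simp)) x).hasDerivAt).deriv
  have hw' : Continuous (deriv w) := hw.continuous_deriv (by simp)
  have hη (k : ℕ) : ContDiff ℝ ∞ fun x => cutoff a k x * w x := (contDiff_cutoff a k).mul hw
  obtain ⟨C, hC⟩ := exists_deriv_cutoff_mul_le hw h1 h2
  obtain ⟨K, hK⟩ := (isCompact_Icc (a := -a) (b := a)).exists_bound_of_continuousOn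
    hw'.continuousOn
  obtain ⟨W, hW⟩ := (isCompact_Icc (a := -a) (b := a)).exists_bound_of_continuousOn
    hw.continuous.continuousOn
  have hmul {k : ℕ} {x y : ℝ} : |cutoff a k x * y| ≤ |y| := by
    rw [abs_mul, abs_of_nonneg (cutoff_nonneg a k x)]
    exact mul_le_of_le_one_left (abs_nonneg _) (cutoff_le_one a k x)
  -- Near a fixed interior point the cutoff is identically one for large `k`, so the integrands are
  -- eventually constant in `k` at each point.
  have t1 : Tendsto (fun k => ∫ x in Ioo (-a) a, deriv (fun x => cutoff a k x * w x) x • f x) atTop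
      (𝓝 (∫ x in Ioo (-a) a, deriv w x • f x)) := by
    refine tendsto_integral_smul_of_bounded f (C := C + K)
      (fun k => (hη k).continuous_deriv (by simp)) (fun k x hx => ?_) fun x hx => ?_
    · rw [hd]
      exact (abs_add_le _ _).trans
        (add_le_add (hC k x hx) (hmul.trans (hK x (Ioo_subset_Icc_self hx))))
    · refine tendsto_const_nhds.congr' ?_
      filter_upwards [eventually_cutoff_eq_one hx] with k hk
      rw [hd, hk.deriv_eq, hk.eq_of_nhds, deriv_const, zero_mul, one_mul, zero_add]
  have t2 : Tendsto (fun k => ∫ x in Ioo (-a) a, (cutoff a k x * w x) • g x) atTop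
      (𝓝 (∫ x in Ioo (-a) a, w x • g x)) := by
    refine tendsto_integral_smul_of_bounded g (C := W)
      (fun k => (hη k).continuous) (fun k x hx => ?_) fun x hx => ?_
    · exact hmul.trans (hW x (Ioo_subset_Icc_self hx))
    · refine tendsto_const_nhds.congr' ?_
      filter_upwards [eventually_cutoff_eq_one hx] with k hk
      rw [hk.eq_of_nhds, one_mul]
  refine tendsto_nhds_unique t1 (t2.neg.congr' ?_)
  filter_upwards [eventually_gt_atTop 0] with k hk
  have hk' : (0 : ℝ) < 1 / k := by positivity
  have hsub : tsupport (fun x => cutoff a k x * w x) ⊆ Icc (-a + 1 / k) (a - 1 / k) := by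
    refine closure_minimal ?_ isClosed_Icc
    exact (Function.support_mul_subset_left _ _).trans (cutoff_support_subset a hk)
  refine (h _ (hη k) ?_ (hsub.trans fun x hx => ?_)).symm
  · exact isCompact_Icc.of_isClosed_subset (isClosed_tsupport _) hsub
  · exact ⟨by linarith [hx.1], by linarith [hx.2]⟩

end WeakDerivative

/-! ### Elements of `L²` given by continuous functions, boundary values, integration by parts. -/

noncomputable section ContinuousRepresentatives

variable {a : ℝ}

theorem coeFn_toL2 (a : ℝ) (u : C(ℝ, ℂ)) : toL2 a u =ᵐ[volume.restrict (Ioo (-a) a)] u :=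
  MemLp.coeFn_toLp _

theorem toL2_add (a : ℝ) (u v : C(ℝ, ℂ)) : toL2 a (u + v) = toL2 a u + toL2 a v := rfl

theorem toL2_sub (a : ℝ) (u v : C(ℝ, ℂ)) : toL2 a (u - v) = toL2 a u - toL2 a v := rfl

theorem toL2_smul (a : ℝ) (c : ℂ) (u : C(ℝ, ℂ)) : toL2 a (c • u) = c • toL2 a u := rfl

theorem eq_toL2 {f : L2 a} {u : C(ℝ, ℂ)} (h : f =ᵐ[volume.restrict (Ioo (-a) a)] u) :
    f = toL2 a u :=
  Lp.ext (h.trans (coeFn_toL2 a u).symm)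

theorem toL2_congr {u v : C(ℝ, ℂ)} (h : ∀ x ∈ Ioo (-a) a, u x = v x) : toL2 a u = toL2 a v := by
  refine eq_toL2 ((coeFn_toL2 a u).trans ?_)
  filter_upwards [ae_restrict_mem measurableSet_Ioo] with x hx using h x hx

theorem inner_toL2_left (u : C(ℝ, ℂ)) (f : L2 a) :
    inner ℂ (toL2 a u) f = ∫ x in Ioo (-a) a, conj (u x) * f x := by
  rw [L2.inner_def]
  refine integral_congr_ae ?_
  filter_upwards [coeFn_toL2 a u] with x hx
  rw [hx, RCLike.inner_apply, mul_comm]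

theorem inner_toL2_toL2 (ha : 0 < a) (u v : C(ℝ, ℂ)) :
    inner ℂ (toL2 a u) (toL2 a v) = ∫ x in (-a)..a, conj (u x) * v x := by
  rw [inner_toL2_left, intervalIntegral.integral_of_le (by linarith),
    integral_Ioc_eq_integral_Ioo]
  refine integral_congr_ae ?_
  filter_upwards [coeFn_toL2 a v] with x hx
  rw [hx]

theorem norm_toL2_le (ha : 0 < a) {u : C(ℝ, ℂ)} {C : ℝ} (hC : ∀ x ∈ Ioo (-a) a, ‖u x‖ ≤ C) :
    ‖toL2 a u‖ ≤ √(2 * a) * C := by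
  have hC0 : 0 ≤ C := (norm_nonneg _).trans (hC 0 ⟨by linarith, ha⟩)
  have h := Lp.norm_le_of_ae_bound (f := toL2 a u) hC0 (by
    filter_upwards [coeFn_toL2 a u, ae_restrict_mem measurableSet_Ioo] with x hx hx'
    rw [hx]
    exact hC x hx')
  refine h.trans (le_of_eq ?_)
  congr 1
  rw [measureUnivNNReal, Measure.restrict_apply_univ, Real.volume_Ioo, Real.sqrt_eq_rpow]
  simp only [ENNReal.coe_toNNReal_eq_toReal]
  rw [ENNReal.toReal_ofReal (by linarith)]
  norm_num
  ring_nf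

/-- An element of `L²(-a, a)` which is orthogonal to all test functions vanishes. -/
theorem eq_zero_of_integral_test_smul {f : L2 a}
    (h : ∀ η : ℝ → ℝ, ContDiff ℝ ∞ η → HasCompactSupport η → tsupport η ⊆ Ioo (-a) a →
      ∫ x in Ioo (-a) a, η x • f x = 0) : f = 0 := by
  refine HasWeakDeriv.eq_zero (a := a) fun η h1 h2 h3 => ?_
  rw [h η h1 h2 h3, neg_zero, ← integral_zero ℝ ℂ (μ := volume.restrict (Ioo (-a) a))]
  refine integral_congr_ae ?_
  filter_upwards [Lp.coeFn_zero ℂ 2 (volume.restrict (Ioo (-a) a))] with x hx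
  rw [hx, Pi.zero_apply, smul_zero]

/-- A real continuous function as a complex one. -/
def ofRealMap (η : ℝ → ℝ) (hη : Continuous η) : C(ℝ, ℂ) :=
  ⟨fun x => (η x : ℂ), Complex.continuous_ofReal.comp hη⟩

theorem inner_ofRealMap (η : ℝ → ℝ) (hη : Continuous η) (f : L2 a) :
    inner ℂ (toL2 a (ofRealMap η hη)) f = ∫ x in Ioo (-a) a, η x • f x := by
  rw [inner_toL2_left]
  refine integral_congr_ae (Eventually.of_forall fun x => ?_)
  simp [ofRealMap]

theorem eq_zero_of_inner_toL2 {f : L2 a} (h : ∀ u : C(ℝ, ℂ), inner ℂ (toL2 a u) f = 0) :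
    f = 0 :=
  eq_zero_of_integral_test_smul fun η h1 _ _ => by rw [← inner_ofRealMap η h1.continuous, h]

/-- In this form the condition consists of equations between continuous functionals of `f` and `g`,
so it passes to limits in `L²`; `HasWeakDeriv.hasSum` is the resulting termwise differentiation. -/
theorem hasWeakDeriv_iff_inner {f g : L2 a} : HasWeakDeriv a f g ↔
    ∀ (η : ℝ → ℝ) (h1 : ContDiff ℝ ∞ η), HasCompactSupport η → tsupport η ⊆ Ioo (-a) a →
      inner ℂ (toL2 a (ofRealMap (deriv η) (h1.continuous_deriv (by simp)))) f =
        -inner ℂ (toL2 a (ofRealMap η h1.continuous)) g := by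
  unfold HasWeakDeriv
  simp only [inner_ofRealMap]

theorem HasWeakDeriv.hasSum {f g : ℕ → L2 a} {F G : L2 a} (h : ∀ n, HasWeakDeriv a (f n) (g n))
    (hf : HasSum f F) (hg : HasSum g G) : HasWeakDeriv a F G := by
  rw [hasWeakDeriv_iff_inner]
  intro η h1 h2 h3
  have e1 := hf.mapL (innerSL ℂ (toL2 a (ofRealMap (deriv η) (h1.continuous_deriv (by simp)))))
  have e2 := (hg.mapL (innerSL ℂ (toL2 a (ofRealMap η h1.continuous)))).neg
  simp only [innerSL_apply_apply] at e1 e2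
  simp only [fun n => hasWeakDeriv_iff_inner.1 (h n) η h1 h2 h3] at e1
  exact e1.unique e2

theorem HasWeakDeriv.neg {f g : L2 a} (h : HasWeakDeriv a f g) : HasWeakDeriv a (-f) (-g) := by
  simpa using h.smul (-1)

theorem HasWeakDeriv.sub {f g f' g' : L2 a} (hf : HasWeakDeriv a f f') (hg : HasWeakDeriv a g g') :
    HasWeakDeriv a (f - g) (f' - g') := by
  simpa [sub_eq_add_neg] using hf.add hg.neg

theorem HasWeakDeriv.unique {f g g' : L2 a} (h : HasWeakDeriv a f g) (h' : HasWeakDeriv a f g') :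
    g = g' := by
  have := h.sub h'
  rw [sub_self] at this
  exact sub_eq_zero.1 this.eq_zero

theorem hasWeakDeriv_toL2 (ha : 0 < a) {u v : C(ℝ, ℂ)} (h : ∀ x, HasDerivAt u (v x) x) :
    HasWeakDeriv a (toL2 a u) (toL2 a v) := by
  rw [hasWeakDeriv_iff_inner]
  intro η h1 h2 h3
  rw [inner_toL2_toL2 ha, inner_toL2_toL2 ha]
  have hη (x : ℝ) (hx : x ∉ Ioo (-a) a) : η x = 0 :=
    image_eq_zero_of_notMem_tsupport fun hx' => hx (h3 hx')
  have hd : ∀ x, HasDerivAt (fun x => (η x : ℂ)) ((deriv η x : ℝ) : ℂ) x := fun x =>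
    ((h1.differentiable (by simp)) x).hasDerivAt.ofReal_comp
  have key := intervalIntegral.integral_mul_deriv_eq_deriv_mul (a := -a) (b := a)
    (fun x _ => h x) (fun x _ => hd x) (v.continuous.intervalIntegrable _ _)
    ((Complex.continuous_ofReal.comp (h1.continuous_deriv (by simp))).intervalIntegrable _ _)
  rw [hη a (by simp), hη (-a) (by simp)] at key
  simp only [Complex.ofReal_zero, mul_zero, sub_zero, zero_sub] at key
  simp only [ofRealMap, ContinuousMap.coe_mk, Complex.conj_ofReal]
  simp only [mul_comm (_ : ℂ) (u _), mul_comm (_ : ℂ) (v _)] at key ⊢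
  exact key

/-- Test functions are real, so the real and imaginary parts of `w` are treated separately. -/
theorem HasWeakDeriv.inner_toL2_of_boundary {f g : L2 a} (h : HasWeakDeriv a f g)
    {w w' : C(ℝ, ℂ)} (hw : ContDiff ℝ ∞ w) (hd : ∀ x, HasDerivAt w (w' x) x)
    (h1 : w a = 0) (h2 : w (-a) = 0) :
    inner ℂ (toL2 a w') f = -inner ℂ (toL2 a w) g := by
  have hp : ContDiff ℝ ∞ fun x => (w x).re := Complex.reCLM.contDiff.comp hw
  have hq : ContDiff ℝ ∞ fun x => (w x).im := Complex.imCLM.contDiff.comp hw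
  have dp (x : ℝ) : deriv (fun x => (w x).re) x = (w' x).re :=
    (Complex.reCLM.hasFDerivAt.comp_hasDerivAt x (hd x)).deriv
  have dq (x : ℝ) : deriv (fun x => (w x).im) x = (w' x).im :=
    (Complex.imCLM.hasFDerivAt.comp_hasDerivAt x (hd x)).deriv
  have e (u : C(ℝ, ℂ)) : toL2 a u =
      toL2 a (ofRealMap (fun x => (u x).re) (Complex.continuous_re.comp u.continuous)) +
      Complex.I • toL2 a (ofRealMap (fun x => (u x).im)
        (Complex.continuous_im.comp u.continuous)) := by
    rw [← toL2_smul, ← toL2_add]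
    refine toL2_congr fun x _ => ?_
    simp [ofRealMap, mul_comm Complex.I, Complex.re_add_im]
  have k1 := h.integral_deriv_smul hp (by simp [h1]) (by simp [h2])
  have k2 := h.integral_deriv_smul hq (by simp [h1]) (by simp [h2])
  simp only [dp] at k1
  simp only [dq] at k2
  rw [e w', e w, inner_add_left, inner_add_left, inner_smul_left, inner_smul_left,
    inner_ofRealMap, inner_ofRealMap, inner_ofRealMap, inner_ofRealMap, k1, k2]
  ring

/-- The affine function which is `1` at `a` and `0` at `-a`. -/
def rampUp (a : ℝ) : C(ℝ, ℂ) := ⟨fun x => (x + a) / (2 * a), by fun_prop⟩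

/-- The affine function which is `1` at `-a` and `0` at `a`. -/
def rampDown (a : ℝ) : C(ℝ, ℂ) := ⟨fun x => (a - x) / (2 * a), by fun_prop⟩

/-- The value at `a` of the function with weak derivative `g` represented by `f`. -/
def traceRight (a : ℝ) (f g : L2 a) : ℂ :=
  inner ℂ (toL2 a (ContinuousMap.const ℝ (1 / (2 * a) : ℂ))) f + inner ℂ (toL2 a (rampUp a)) g

/-- The value at `-a` of the function with weak derivative `g` represented by `f`. -/
def traceLeft (a : ℝ) (f g : L2 a) : ℂ :=
  inner ℂ (toL2 a (ContinuousMap.const ℝ (1 / (2 * a) : ℂ))) f - inner ℂ (toL2 a (rampDown a)) g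

/-- Subtracting from `w` the affine function with the same end values leaves a function vanishing at
`±a`, which produces no boundary term. The affine part reproduces the two traces by their
definition, so no continuous representative of `f` has to be constructed. -/
theorem HasWeakDeriv.inner_toL2_add (ha : 0 < a) {f g : L2 a} (h : HasWeakDeriv a f g)
    {w w' : C(ℝ, ℂ)} (hw : ContDiff ℝ ∞ w) (hd : ∀ x, HasDerivAt w (w' x) x) :
    inner ℂ (toL2 a w') f + inner ℂ (toL2 a w) g =
      conj (w a) * traceRight a f g - conj (w (-a)) * traceLeft a f g := by
  have ha' : (a : ℂ) ≠ 0 := by exact_mod_cast ha.ne'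
  have hofReal : ContDiff ℝ ∞ fun x : ℝ => (x : ℂ) := Complex.ofRealCLM.contDiff
  have d1 (x : ℝ) : HasDerivAt (rampUp a) (1 / (2 * a)) x :=
    ((hasDerivAt_id x).ofReal_comp.add_const (a : ℂ)).div_const _
  have d2 (x : ℝ) : HasDerivAt (rampDown a) (-1 / (2 * a)) x :=
    ((hasDerivAt_id x).ofReal_comp.const_sub (a : ℂ)).div_const _
  have c1 : ContDiff ℝ ∞ (rampUp a) := by
    change ContDiff ℝ ∞ fun x : ℝ => ((x : ℂ) + a) / (2 * a)
    exact (hofReal.add contDiff_const).div_const _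
  have c2 : ContDiff ℝ ∞ (rampDown a) := by
    change ContDiff ℝ ∞ fun x : ℝ => ((a : ℂ) - x) / (2 * a)
    exact (contDiff_const.sub hofReal).div_const _
  let k : C(ℝ, ℂ) := ContinuousMap.const ℝ (1 / (2 * a) : ℂ)
  have key := h.inner_toL2_of_boundary (w := w - w a • rampUp a - w (-a) • rampDown a)
    (w' := w' - w a • k + w (-a) • k) (by
      change ContDiff ℝ ∞ fun x => w x - w a • rampUp a x - w (-a) • rampDown a x
      exact (hw.sub (c1.const_smul (w a))).sub (c2.const_smul (w (-a))))
    (fun x => by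
      refine (((hd x).sub ((d1 x).const_smul (w a))).sub ((d2 x).const_smul (w (-a)))).congr_deriv ?_
      simp only [ContinuousMap.add_apply, ContinuousMap.sub_apply, ContinuousMap.smul_apply, k,
        ContinuousMap.const_apply, smul_eq_mul]
      ring)
    (by
      simp only [ContinuousMap.sub_apply, ContinuousMap.smul_apply, rampUp, rampDown,
        ContinuousMap.coe_mk, smul_eq_mul]
      field_simp
      ring)
    (by
      simp only [ContinuousMap.sub_apply, ContinuousMap.smul_apply, rampUp, rampDown,
        ContinuousMap.coe_mk, smul_eq_mul]
      push_cast
      field_simp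
      ring)
  simp only [toL2_add, toL2_sub, toL2_smul, inner_add_left, inner_sub_left, inner_smul_left] at key
  simp only [traceRight, traceLeft]
  linear_combination key

theorem exists_trace_bound (a : ℝ) : ∃ C, 0 ≤ C ∧ ∀ f g : L2 a,
    ‖traceRight a f g‖ ≤ C * (‖f‖ + ‖g‖) ∧ ‖traceLeft a f g‖ ≤ C * (‖f‖ + ‖g‖) := by
  set k := toL2 a (ContinuousMap.const ℝ (1 / (2 * a) : ℂ)) with hk
  refine ⟨‖k‖ + ‖toL2 a (rampUp a)‖ + ‖toL2 a (rampDown a)‖, by positivity, fun f g => ?_⟩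
  have b (u v : L2 a) : ‖inner ℂ u v‖ ≤ ‖u‖ * ‖v‖ := norm_inner_le_norm u v
  have hf := norm_nonneg f
  have hg := norm_nonneg g
  constructor
  · refine (norm_add_le _ _).trans ((add_le_add (b k f) (b _ g)).trans ?_)
    nlinarith [norm_nonneg k, norm_nonneg (toL2 a (rampUp a)), norm_nonneg (toL2 a (rampDown a)),
      mul_nonneg (norm_nonneg k) hg, mul_nonneg (norm_nonneg (toL2 a (rampUp a))) hf,
      mul_nonneg (norm_nonneg (toL2 a (rampDown a))) hf,
      mul_nonneg (norm_nonneg (toL2 a (rampDown a))) hg]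
  · refine (norm_sub_le _ _).trans ((add_le_add (b k f) (b _ g)).trans ?_)
    nlinarith [norm_nonneg k, norm_nonneg (toL2 a (rampUp a)), norm_nonneg (toL2 a (rampDown a)),
      mul_nonneg (norm_nonneg k) hg, mul_nonneg (norm_nonneg (toL2 a (rampUp a))) hf,
      mul_nonneg (norm_nonneg (toL2 a (rampUp a))) hg,
      mul_nonneg (norm_nonneg (toL2 a (rampDown a))) hf]

/-- Multiplication by a continuous function. -/
theorem exists_mulOp (ha : 0 < a) (m : C(ℝ, ℂ)) :
    ∃ A : L2 a →L[ℂ] L2 a, ∀ u : C(ℝ, ℂ), A (toL2 a u) = toL2 a (m * u) := by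
  obtain ⟨C, hC⟩ := isCompact_Icc.exists_bound_of_continuousOn
    (m.continuous.continuousOn (s := Icc (-a) a))
  have hC0 : 0 ≤ C := (norm_nonneg _).trans (hC a ⟨by linarith, le_rfl⟩)
  have hm : ∀ᵐ x ∂volume.restrict (Ioo (-a) a), ‖m x‖ ≤ C := by
    filter_upwards [ae_restrict_mem measurableSet_Ioo] with x hx
      using hC x (Ioo_subset_Icc_self hx)
  have hmem (f : L2 a) : MemLp (fun x => m x * f x) 2 (volume.restrict (Ioo (-a) a)) := by
    refine MemLp.of_le_mul (c := C) (Lp.memLp f)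
      (m.continuous.aestronglyMeasurable.mul (Lp.aestronglyMeasurable f)) ?_
    filter_upwards [hm] with x hx
    rw [norm_mul]
    gcongr
  let A : L2 a →ₗ[ℂ] L2 a :=
    { toFun := fun f => (hmem f).toLp _
      map_add' := fun f g => by
        rw [← MemLp.toLp_add, MemLp.toLp_eq_toLp_iff]
        filter_upwards [Lp.coeFn_add f g] with x hx
        rw [hx, Pi.add_apply, Pi.add_apply, mul_add]
      map_smul' := fun c f => by
        rw [RingHom.id_apply, ← MemLp.toLp_const_smul, MemLp.toLp_eq_toLp_iff]
        filter_upwards [Lp.coeFn_smul c f] with x hx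
        rw [hx, Pi.smul_apply, Pi.smul_apply, smul_eq_mul, smul_eq_mul, mul_left_comm] }
  refine ⟨A.mkContinuous C fun f => Lp.norm_le_mul_norm_of_ae_le_mul ?_, fun u => ?_⟩
  · filter_upwards [(hmem f).coeFn_toLp, hm] with x hx hx'
    change ‖((hmem f).toLp _ : L2 a) x‖ ≤ _
    rw [hx, norm_mul]
    gcongr
  · refine eq_toL2 ?_
    change ((hmem (toL2 a u)).toLp _ : L2 a) =ᵐ[volume.restrict (Ioo (-a) a)] _
    filter_upwards [(hmem (toL2 a u)).coeFn_toLp, coeFn_toL2 a u] with x hx hx'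
    rw [hx, hx']
    rfl

end ContinuousRepresentatives

/-! ### The Neumann modes form an orthonormal basis. -/

noncomputable section Neumann

variable {a : ℝ}

/-- The Neumann wave numbers `nπ / (2a)`. -/
def waveNumber (a : ℝ) (n : ℕ) : ℝ := n * Real.pi / (2 * a)

/-- The Neumann eigenfunctions as complex continuous functions. -/
def neumannMap (a : ℝ) (n : ℕ) : C(ℝ, ℂ) := ofRealMap (neumannFun a n) (continuous_neumannFun a n)

/-- The functions `sin (kₙ (x + a)) / √a` as complex continuous functions. -/
def sineMap (a : ℝ) (n : ℕ) : C(ℝ, ℂ) :=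
  ofRealMap (fun x => 1 / √a * Real.sin (waveNumber a n * (x + a))) (by fun_prop)

theorem neumannMode_eq (a : ℝ) (n : ℕ) : neumannMode a n = toL2 a (neumannMap a n) := rfl

theorem waveNumber_zero (a : ℝ) : waveNumber a 0 = 0 := by simp [waveNumber]

theorem sineMap_zero (a : ℝ) : sineMap a 0 = 0 := by
  ext x
  simp [sineMap, ofRealMap, waveNumber_zero]

theorem waveNumber_pos (ha : 0 < a) {n : ℕ} (hn : n ≠ 0) : 0 < waveNumber a n := by
  have : 0 < n := Nat.pos_of_ne_zero hn
  unfold waveNumber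
  positivity

theorem waveNumber_injective (ha : 0 < a) : Function.Injective (waveNumber a) := by
  intro m n h
  have hpi := Real.pi_pos
  unfold waveNumber at h
  field_simp at h
  exact_mod_cast h

theorem neumannFun_of_ne_zero {n : ℕ} (hn : n ≠ 0) (x : ℝ) :
    neumannFun a n x = 1 / √a * Real.cos (waveNumber a n * (x + a)) := if_neg hn

theorem hasDerivAt_neumannMap (a : ℝ) (n : ℕ) (x : ℝ) :
    HasDerivAt (neumannMap a n) (-(waveNumber a n : ℂ) * sineMap a n x) x := by
  rcases eq_or_ne n 0 with rfl | hn
  · rw [sineMap_zero, ContinuousMap.zero_apply, mul_zero]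
    have : (neumannMap a 0 : ℝ → ℂ) = fun _ => ((1 / √(2 * a) : ℝ) : ℂ) := by
      ext x
      simp [neumannMap, ofRealMap, neumannFun]
    rw [this]
    exact hasDerivAt_const _ _
  · have h1 : HasDerivAt (fun x => waveNumber a n * (x + a)) (waveNumber a n) x := by
      simpa using ((hasDerivAt_id x).add_const a).const_mul (waveNumber a n)
    have h2 := (h1.cos.const_mul (1 / √a)).ofReal_comp
    have h3 : (neumannMap a n : ℝ → ℂ) =
        fun x => ((1 / √a * Real.cos (waveNumber a n * (x + a)) : ℝ) : ℂ) := by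
      ext x
      simp only [neumannMap, ofRealMap, ContinuousMap.coe_mk, neumannFun_of_ne_zero hn]
    rw [h3]
    refine h2.congr_deriv ?_
    simp only [sineMap, ofRealMap, ContinuousMap.coe_mk]
    push_cast
    ring

theorem hasDerivAt_sineMap (a : ℝ) (n : ℕ) (x : ℝ) :
    HasDerivAt (sineMap a n) ((waveNumber a n : ℂ) * neumannMap a n x) x := by
  have h1 : HasDerivAt (fun x => waveNumber a n * (x + a)) (waveNumber a n) x := by
    simpa using ((hasDerivAt_id x).add_const a).const_mul (waveNumber a n)
  refine (h1.sin.const_mul (1 / √a)).ofReal_comp.congr_deriv ?_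
  rcases eq_or_ne n 0 with rfl | hn
  · simp [waveNumber_zero]
  · simp only [neumannMap, ofRealMap, ContinuousMap.coe_mk, neumannFun_of_ne_zero hn]
    push_cast
    ring

theorem contDiff_sineMap (a : ℝ) (n : ℕ) : ContDiff ℝ ∞ (sineMap a n) := by
  refine Complex.ofRealCLM.contDiff.comp (f := fun x => 1 / √a * Real.sin (waveNumber a n * (x + a)))
    ?_
  fun_prop

theorem sineMap_left (a : ℝ) (n : ℕ) : sineMap a n (-a) = 0 := by
  simp [sineMap, ofRealMap]

theorem waveNumber_mul (ha : 0 < a) (n : ℕ) : waveNumber a n * (2 * a) = n * Real.pi := by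
  unfold waveNumber
  field_simp

theorem sineMap_right (ha : 0 < a) (n : ℕ) : sineMap a n a = 0 := by
  have : waveNumber a n * (a + a) = n * Real.pi := by rw [← two_mul, waveNumber_mul ha]
  simp only [sineMap, ofRealMap, ContinuousMap.coe_mk, this, Real.sin_nat_mul_pi, mul_zero,
    Complex.ofReal_zero]

/-- The functions `sin (kₙ (x + a)) / √a` as elements of `L²(-a, a)`. -/
def sineMode (a : ℝ) (n : ℕ) : L2 a := toL2 a (sineMap a n)

theorem hasWeakDeriv_neumannMode (ha : 0 < a) (n : ℕ) :
    HasWeakDeriv a (neumannMode a n) (-(waveNumber a n : ℂ) • sineMode a n) :=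
  hasWeakDeriv_toL2 ha (v := -(waveNumber a n : ℂ) • sineMap a n) (hasDerivAt_neumannMap a n)

theorem hasWeakDeriv_sineMode (ha : 0 < a) (n : ℕ) :
    HasWeakDeriv a (sineMode a n) ((waveNumber a n : ℂ) • neumannMode a n) :=
  hasWeakDeriv_toL2 ha (v := (waveNumber a n : ℂ) • neumannMap a n) (hasDerivAt_sineMap a n)

/-- The sines vanish at both ends, so `f` needs no boundary condition. This is how one derivative of
`f` is read off from its Neumann coefficients. -/
theorem HasWeakDeriv.waveNumber_mul_inner (ha : 0 < a) {f g : L2 a} (h : HasWeakDeriv a f g)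
    (n : ℕ) : waveNumber a n * inner ℂ (neumannMode a n) f = -inner ℂ (sineMode a n) g := by
  have := h.inner_toL2_of_boundary (w := sineMap a n)
    (w' := (waveNumber a n : ℂ) • neumannMap a n) (contDiff_sineMap a n) (hasDerivAt_sineMap a n)
    (sineMap_right ha n) (sineMap_left a n)
  rwa [toL2_smul, inner_smul_left, Complex.conj_ofReal] at this

theorem inner_neumannMode_sineMode (ha : 0 < a) (m n : ℕ) :
    (waveNumber a m : ℂ) * inner ℂ (neumannMode a m) (neumannMode a n) =
      waveNumber a n * inner ℂ (sineMode a m) (sineMode a n) := by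
  rw [(hasWeakDeriv_neumannMode ha n).waveNumber_mul_inner ha, inner_smul_right]
  ring

theorem inner_neumannMode_sineMode' (ha : 0 < a) (m n : ℕ) :
    (waveNumber a n : ℂ) * inner ℂ (neumannMode a m) (neumannMode a n) =
      waveNumber a m * inner ℂ (sineMode a m) (sineMode a n) := by
  have := congrArg conj (inner_neumannMode_sineMode ha n m)
  simpa only [map_mul, Complex.conj_ofReal, inner_conj_symm] using this

theorem waveNumber_sq_sub_ne (ha : 0 < a) {m n : ℕ} (h : m ≠ n) :
    (waveNumber a m : ℂ) ^ 2 - waveNumber a n ^ 2 ≠ 0 := by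
  rw [sub_ne_zero]
  norm_cast
  have h0 (n : ℕ) : 0 ≤ waveNumber a n := by unfold waveNumber; positivity
  rw [pow_left_inj₀ (h0 m) (h0 n) two_ne_zero]
  exact fun h' => h (waveNumber_injective ha h')

/-- The two preceding relations form a homogeneous linear system for the inner products of cosines
and of sines, with determinant `±(kₘ² - kₙ²) ≠ 0`. -/
theorem inner_neumannMode_of_ne (ha : 0 < a) {m n : ℕ} (h : m ≠ n) :
    inner ℂ (neumannMode a m) (neumannMode a n) = 0 := by
  refine (mul_eq_zero.1 ?_).resolve_left (waveNumber_sq_sub_ne ha h)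
  linear_combination waveNumber a m * inner_neumannMode_sineMode ha m n -
    waveNumber a n * inner_neumannMode_sineMode' ha m n

theorem inner_sineMode_of_ne (ha : 0 < a) {m n : ℕ} (h : m ≠ n) :
    inner ℂ (sineMode a m) (sineMode a n) = 0 := by
  refine (mul_eq_zero.1 ?_).resolve_left (waveNumber_sq_sub_ne ha h)
  linear_combination waveNumber a n * inner_neumannMode_sineMode ha m n -
    waveNumber a m * inner_neumannMode_sineMode' ha m n

theorem inner_neumannMode_self (ha : 0 < a) (n : ℕ) :
    inner ℂ (neumannMode a n) (neumannMode a n) = 1 := by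
  have ha' : (a : ℂ) ≠ 0 := by exact_mod_cast ha.ne'
  rcases eq_or_ne n 0 with rfl | hn
  · rw [neumannMode_eq, inner_toL2_toL2 ha]
    have : ∀ x, conj (neumannMap a 0 x) * neumannMap a 0 x = 1 / (2 * a) := fun x => by
      simp only [neumannMap, ofRealMap, ContinuousMap.coe_mk, neumannFun, if_true,
        Complex.conj_ofReal]
      norm_cast
      rw [div_mul_div_comm, Real.mul_self_sqrt (by linarith), one_mul]
    simp only [this, intervalIntegral.integral_const]
    rw [Complex.real_smul]
    push_cast
    field_simp
    ring
  -- The squared norms of cosine and sine agree because `kₙ ≠ 0`, and they add up to `2` because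
  -- `cos² + sin² = 1`.
  · have h1 : inner ℂ (neumannMode a n) (neumannMode a n) =
        inner ℂ (sineMode a n) (sineMode a n) := by
      have hk : (waveNumber a n : ℂ) ≠ 0 := by exact_mod_cast (waveNumber_pos ha hn).ne'
      exact mul_left_cancel₀ hk (inner_neumannMode_sineMode ha n n)
    have h2 : inner ℂ (neumannMode a n) (neumannMode a n) +
        inner ℂ (sineMode a n) (sineMode a n) = 2 := by
      rw [sineMode, neumannMode_eq, inner_toL2_toL2 ha, inner_toL2_toL2 ha,
        ← intervalIntegral.integral_add (Continuous.intervalIntegrable (by fun_prop) _ _)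
          (Continuous.intervalIntegrable (by fun_prop) _ _)]
      have : ∀ x, conj (neumannMap a n x) * neumannMap a n x +
          conj (sineMap a n x) * sineMap a n x = 1 / a := fun x => by
        simp only [neumannMap, sineMap, ofRealMap, ContinuousMap.coe_mk, neumannFun_of_ne_zero hn,
          Complex.conj_ofReal]
        norm_cast
        have e1 := Real.sin_sq_add_cos_sq (waveNumber a n * (x + a))
        have e2 : 1 / √a * (1 / √a) = 1 / a := by
          rw [div_mul_div_comm, Real.mul_self_sqrt ha.le, one_mul]
        linear_combination (1 / √a * (1 / √a)) * e1 + e2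
      simp only [this, intervalIntegral.integral_const]
      rw [Complex.real_smul]
      push_cast
      field_simp
      ring
    rw [← h1] at h2
    linear_combination h2 / 2

theorem orthonormal_neumannMode (ha : 0 < a) : Orthonormal ℂ (neumannMode a) := by
  rw [orthonormal_iff_ite]
  intro m n
  split_ifs with h
  · rw [h, inner_neumannMode_self ha]
  · exact inner_neumannMode_of_ne ha h

theorem norm_sineMode_le (ha : 0 < a) (n : ℕ) : ‖sineMode a n‖ ≤ 1 := by
  rcases eq_or_ne n 0 with rfl | hn
  · rw [sineMode, sineMap_zero]
    have : toL2 a 0 = 0 := rfl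
    rw [this, norm_zero]
    exact zero_le_one
  · have hk : (waveNumber a n : ℂ) ≠ 0 := by exact_mod_cast (waveNumber_pos ha hn).ne'
    have h1 := mul_left_cancel₀ hk (inner_neumannMode_sineMode ha n n)
    have h2 : ‖sineMode a n‖ ^ 2 = 1 := by
      rw [← inner_self_eq_norm_sq (𝕜 := ℂ), ← h1, inner_neumannMode_self ha]
      exact Complex.one_re
    nlinarith [norm_nonneg (sineMode a n)]

/-- Induction on the power by `2 cos θ cos nθ = cos (n-1)θ + cos (n+1)θ`. The case `n = 0` gives
orthogonality to all powers of `cos (k₁ (x + a))`. -/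
theorem integral_cos_pow_mul_cos {f : L2 a} (h : ∀ n, inner ℂ (neumannMode a n) f = 0) (ha : 0 < a)
    (j n : ℕ) :
    ∫ x in Ioo (-a) a, (Real.cos (waveNumber a 1 * (x + a)) ^ j *
      Real.cos (waveNumber a n * (x + a))) • f x = 0 := by
  have hint (j n : ℕ) : Integrable (fun x => (Real.cos (waveNumber a 1 * (x + a)) ^ j *
      Real.cos (waveNumber a n * (x + a))) • f x) (volume.restrict (Ioo (-a) a)) := by
    have hc : Continuous fun x => Real.cos (waveNumber a 1 * (x + a)) ^ j *
      Real.cos (waveNumber a n * (x + a)) := by fun_prop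
    refine (integrable_L2 f).bdd_smul 1 hc.aestronglyMeasurable
      (Eventually.of_forall fun x => ?_)
    rw [norm_mul, norm_pow]
    exact mul_le_one₀ (pow_le_one₀ (norm_nonneg _) (Real.abs_cos_le_one _)) (norm_nonneg _)
      (Real.abs_cos_le_one _)
  induction j generalizing n with
  | zero =>
    rcases eq_or_ne n 0 with rfl | hn
    · have h0 := h 0
      have e : neumannMode a 0 = ((1 / √(2 * a) : ℝ) : ℂ) • toL2 a (ofRealMap (fun x =>
          Real.cos (waveNumber a 1 * (x + a)) ^ 0 * Real.cos (waveNumber a 0 * (x + a)))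
          (by fun_prop)) := by
        rw [neumannMode_eq, ← toL2_smul]
        refine toL2_congr fun x _ => ?_
        simp [neumannMap, ofRealMap, neumannFun, waveNumber_zero]
      rw [e, inner_smul_left, inner_ofRealMap, Complex.conj_ofReal] at h0
      refine (mul_eq_zero.1 h0).resolve_left ?_
      have : √(2 * a) ≠ 0 := by positivity
      exact_mod_cast one_div_ne_zero this
    · have h0 := h n
      have e : neumannMode a n = ((1 / √a : ℝ) : ℂ) • toL2 a (ofRealMap (fun x =>
          Real.cos (waveNumber a 1 * (x + a)) ^ 0 * Real.cos (waveNumber a n * (x + a)))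
          (by fun_prop)) := by
        rw [neumannMode_eq, ← toL2_smul]
        refine toL2_congr fun x _ => ?_
        simp [neumannMap, ofRealMap, neumannFun_of_ne_zero hn]
      rw [e, inner_smul_left, inner_ofRealMap, Complex.conj_ofReal] at h0
      refine (mul_eq_zero.1 h0).resolve_left ?_
      have : √a ≠ 0 := by positivity
      exact_mod_cast one_div_ne_zero this
  | succ j ih =>
    rcases n with _ | n
    · have h1 := ih 1
      convert h1 using 4 with x
      simp [waveNumber_zero, pow_succ]
    · have h1 := ih n
      have h2 := ih (n + 2)
      have e (x : ℝ) : (Real.cos (waveNumber a 1 * (x + a)) ^ (j + 1) *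
          Real.cos (waveNumber a (n + 1) * (x + a))) • f x =
          (1 / 2 : ℝ) • ((Real.cos (waveNumber a 1 * (x + a)) ^ j *
            Real.cos (waveNumber a n * (x + a))) • f x +
          (Real.cos (waveNumber a 1 * (x + a)) ^ j *
            Real.cos (waveNumber a (n + 2) * (x + a))) • f x) := by
        have e1 : waveNumber a n * (x + a) =
            waveNumber a (n + 1) * (x + a) - waveNumber a 1 * (x + a) := by
          simp only [waveNumber]
          push_cast
          ring
        have e2 : waveNumber a (n + 2) * (x + a) =
            waveNumber a (n + 1) * (x + a) + waveNumber a 1 * (x + a) := by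
          simp only [waveNumber]
          push_cast
          ring
        rw [← add_smul, smul_smul, e1, e2, Real.cos_sub, Real.cos_add]
        congr 1
        ring
      simp only [e]
      rw [integral_smul, integral_add (hint j n) (hint j (n + 2)), h1, h2, add_zero, smul_zero]

/-- Completeness by Weierstrass approximation: `t = cos (k₁ (x + a))` maps `(-a, a)` injectively
into `[-1, 1]`, so a test function is a uniform limit of polynomials in `t`, to which `f` is
orthogonal. -/
theorem eq_zero_of_inner_neumannMode (ha : 0 < a) {f : L2 a}
    (h : ∀ n, inner ℂ (neumannMode a n) f = 0) : f = 0 := by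
  refine eq_zero_of_integral_test_smul fun η h1 _ _ => ?_
  let θ : ℝ → ℝ := fun x => waveNumber a 1 * (x + a)
  have hpoly (p : Polynomial ℝ) : ∫ x in Ioo (-a) a, p.eval (Real.cos (θ x)) • f x = 0 := by
    induction p using Polynomial.induction_on' with
    | monomial j c =>
      have h2 := integral_cos_pow_mul_cos h ha j 0
      simp only [waveNumber_zero, zero_mul, Real.cos_zero, mul_one] at h2
      simp only [Polynomial.eval_monomial, mul_smul]
      rw [integral_smul, h2, smul_zero]
    | add p q hp hq =>
      have hi (p : Polynomial ℝ) : Integrable (fun x => p.eval (Real.cos (θ x)) • f x)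
          (volume.restrict (Ioo (-a) a)) := by
        obtain ⟨C, hC⟩ := (isCompact_Icc (a := -a) (b := a)).exists_bound_of_continuousOn
          (f := fun x => p.eval (Real.cos (θ x))) (by fun_prop)
        have hc : Continuous fun x => p.eval (Real.cos (θ x)) := by fun_prop
        refine (integrable_L2 f).bdd_smul C hc.aestronglyMeasurable ?_
        filter_upwards [ae_restrict_mem measurableSet_Ioo] with x hx
          using hC x (Ioo_subset_Icc_self hx)
      simp only [Polynomial.eval_add, add_smul]
      rw [integral_add (hi p) (hi q), hp, hq, add_zero]
  rw [← norm_le_zero_iff]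
  refine le_of_forall_pos_le_add fun ε hε => ?_
  set K := √(2 * a) * ‖f‖ with hK
  have hK0 : 0 ≤ K := by positivity
  -- The approximated function is `η` in the variable `t`. The final error is `ε K / (K + 1)`, with
  -- a denominator that is positive even for `K = 0`.
  obtain ⟨p, hp⟩ := exists_polynomial_near_of_continuousOn (-1) 1
    (fun t => η (Real.arccos t / waveNumber a 1 - a))
    (h1.continuous.comp (by fun_prop)).continuousOn (ε / (K + 1)) (by positivity)
  have e1 : ∫ x in Ioo (-a) a, η x • f x = inner ℂ (toL2 a (ofRealMap η h1.continuous -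
      ofRealMap (fun x => p.eval (Real.cos (θ x))) (by fun_prop))) f := by
    rw [toL2_sub, inner_sub_left, inner_ofRealMap, inner_ofRealMap, hpoly, sub_zero]
  have hk := waveNumber_pos ha one_ne_zero
  rw [e1, zero_add]
  refine (norm_inner_le_norm _ _).trans ?_
  have e2 : ‖toL2 a (ofRealMap η h1.continuous -
      ofRealMap (fun x => p.eval (Real.cos (θ x))) (by fun_prop))‖ ≤
      √(2 * a) * (ε / (K + 1)) := by
    refine norm_toL2_le ha fun x hx => ?_
    have hθ0 : 0 ≤ θ x := mul_nonneg hk.le (by linarith [hx.1])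
    have hθ1 : θ x ≤ Real.pi := by
      have := waveNumber_mul ha 1
      have h2 : θ x ≤ waveNumber a 1 * (2 * a) :=
        mul_le_mul_of_nonneg_left (by linarith [hx.2]) hk.le
      rw [this] at h2
      simpa using h2
    have h3 := hp (Real.cos (θ x)) ⟨Real.neg_one_le_cos _, Real.cos_le_one _⟩
    rw [Real.arccos_cos hθ0 hθ1] at h3
    have h4 : θ x / waveNumber a 1 - a = x := by
      simp only [θ]
      rw [mul_div_cancel_left₀ _ hk.ne']
      ring
    rw [h4] at h3
    simp only [ContinuousMap.sub_apply, ofRealMap, ContinuousMap.coe_mk]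
    rw [← Complex.ofReal_sub, Complex.norm_real, norm_sub_rev]
    exact h3.le
  calc _ ≤ √(2 * a) * (ε / (K + 1)) * ‖f‖ := by gcongr
    _ = ε * (K / (K + 1)) := by rw [hK]; ring
    _ ≤ ε * 1 := by
        gcongr
        rw [div_le_one (by positivity)]
        linarith
    _ = ε := mul_one ε

/-- The Neumann eigenfunctions form a Hilbert basis. -/
def neumannBasis (ha : 0 < a) : HilbertBasis ℕ ℂ (L2 a) :=
  HilbertBasis.mkOfOrthogonalEqBot (orthonormal_neumannMode ha) (by
    rw [Submodule.eq_bot_iff]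
    intro f hf
    refine eq_zero_of_inner_neumannMode ha fun n => ?_
    exact (Submodule.mem_orthogonal _ _).1 hf _ (Submodule.subset_span ⟨n, rfl⟩))

@[simp]
theorem neumannBasis_apply (ha : 0 < a) (n : ℕ) : neumannBasis ha n = neumannMode a n := by
  rw [neumannBasis, HilbertBasis.coe_mkOfOrthogonalEqBot]

theorem isBessel_sineMode (ha : 0 < a) : IsBessel (neumannBasis ha) (sineMode a) :=
  IsBessel.of_orthogonal (fun _ _ h => inner_sineMode_of_ne ha h) (norm_sineMode_le ha)

end Neumann

/-! ### Solutions of `-u'' = z u` that are entire in `z`. -/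

noncomputable section Solutions

/-- The entire function `w ↦ cos √w`. -/
def cosSqrt (w : ℂ) : ℂ := Complex.cos (w ^ ((2 : ℕ) : ℂ)⁻¹)

theorem cosSqrt_sq (l : ℂ) : cosSqrt (l ^ 2) = Complex.cos l := by
  have h : ((l ^ 2) ^ ((2 : ℕ) : ℂ)⁻¹) ^ 2 = l ^ 2 := Complex.cpow_nat_inv_pow _ two_ne_zero
  rcases sq_eq_sq_iff_eq_or_eq_neg.1 h with h | h
  · rw [cosSqrt, h]
  · rw [cosSqrt, h, Complex.cos_neg]

/-- Cosine is even, so either square root may be used: the principal one away from the negative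
axis, and `i √(-w)` away from the positive axis. The singularity at `0` is removable by continuity.
-/
theorem differentiable_cosSqrt : Differentiable ℂ cosSqrt := by
  have h1 {w : ℂ} (hw : w ∈ Complex.slitPlane) : DifferentiableAt ℂ cosSqrt w :=
    (differentiableAt_id.cpow_const hw).ccos
  have h2 {w : ℂ} (hw : -w ∈ Complex.slitPlane) : DifferentiableAt ℂ cosSqrt w := by
    have e : cosSqrt = fun w => Complex.cos (Complex.I * (-w) ^ ((2 : ℕ) : ℂ)⁻¹) := by
      ext w
      have h : ((-w) ^ ((2 : ℕ) : ℂ)⁻¹) ^ 2 = -w := Complex.cpow_nat_inv_pow _ two_ne_zero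
      rw [← cosSqrt_sq, mul_pow, h, Complex.I_sq, neg_one_mul, neg_neg]
    rw [e]
    exact ((differentiableAt_id.neg.cpow_const hw).const_mul _).ccos
  have h3 {w : ℂ} (hw : w ≠ 0) : DifferentiableAt ℂ cosSqrt w := by
    by_cases h : w ∈ Complex.slitPlane
    · exact h1 h
    · refine h2 ?_
      rw [Complex.mem_slitPlane_iff, not_or, not_lt, not_not] at h
      refine Complex.mem_slitPlane_iff.2 (Or.inl ?_)
      have : w.re ≠ 0 := fun h' => hw (Complex.ext h' h.2)
      rw [Complex.neg_re]
      exact neg_pos.2 (lt_of_le_of_ne h.1 this)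
  have hc : ContinuousAt cosSqrt 0 := by
    refine Complex.continuous_cos.continuousAt.comp ?_
    refine (continuousAt_of_tendsto_nhds (y := 0) ?_)
    rw [tendsto_zero_iff_norm_tendsto_zero]
    have e (w : ℂ) : ‖w ^ ((2 : ℕ) : ℂ)⁻¹‖ = √‖w‖ := by
      rw [eq_comm, Real.sqrt_eq_iff_mul_self_eq (norm_nonneg _) (norm_nonneg _), ← norm_mul, ← sq,
        Complex.cpow_nat_inv_pow _ two_ne_zero]
    simp only [e]
    have := (Real.continuous_sqrt.comp continuous_norm).tendsto (0 : ℂ)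
    simpa [Function.comp_def] using this
  intro w
  rcases eq_or_ne w 0 with rfl | hw
  · refine (Complex.analyticAt_of_differentiable_on_punctured_nhds_of_continuousAt ?_
      hc).differentiableAt
    filter_upwards [self_mem_nhdsWithin] with w hw using h3 hw
  · exact h3 hw

/-- The iterated derivatives of `w ↦ cos √w`. -/
def cosSqrtDeriv (n : ℕ) : ℂ → ℂ := deriv^[n] cosSqrt

theorem differentiable_cosSqrtDeriv (n : ℕ) : Differentiable ℂ (cosSqrtDeriv n) := by
  induction n with
  | zero => exact differentiable_cosSqrt
  | succ n ih =>
    rw [cosSqrtDeriv, Function.iterate_succ_apply']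
    exact ih.deriv

theorem hasDerivAt_cosSqrtDeriv (n : ℕ) (w : ℂ) :
    HasDerivAt (cosSqrtDeriv n) (cosSqrtDeriv (n + 1) w) w := by
  rw [cosSqrtDeriv, cosSqrtDeriv, Function.iterate_succ_apply']
  exact (differentiable_cosSqrtDeriv n w).hasDerivAt

theorem cosSqrtDeriv_zero_sq (l : ℂ) : cosSqrtDeriv 0 (l ^ 2) = Complex.cos l := cosSqrt_sq l

theorem cosSqrtDeriv_one_sq (l : ℂ) : 2 * l * cosSqrtDeriv 1 (l ^ 2) = -Complex.sin l := by
  have h1 : HasDerivAt (fun l : ℂ => cosSqrtDeriv 0 (l ^ 2)) (cosSqrtDeriv 1 (l ^ 2) * (2 * l)) l := by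
    refine ((hasDerivAt_cosSqrtDeriv 0 (l ^ 2)).comp l (hasDerivAt_pow 2 l)).congr_deriv ?_
    norm_num
  simp only [cosSqrtDeriv_zero_sq] at h1
  rw [← h1.unique (Complex.hasDerivAt_cos l)]
  ring

/-- Two derivatives of `cosSqrt (l²) = cos l`. With its own derivatives below, this identity reduces
the differential equations in `y` and in `z` to algebra, without an exceptional case at `z = 0`. -/
theorem cosSqrtDeriv_ode (w : ℂ) :
    4 * w * cosSqrtDeriv 2 w + 2 * cosSqrtDeriv 1 w + cosSqrtDeriv 0 w = 0 := by
  obtain ⟨l, rfl⟩ : ∃ l : ℂ, l ^ 2 = w := IsAlgClosed.exists_pow_nat_eq w two_pos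
  have h1 : HasDerivAt (fun l : ℂ => 2 * l * cosSqrtDeriv 1 (l ^ 2))
      (2 * cosSqrtDeriv 1 (l ^ 2) + 2 * l * (cosSqrtDeriv 2 (l ^ 2) * (2 * l))) l := by
    refine (((hasDerivAt_id l).const_mul 2).mul
      ((hasDerivAt_cosSqrtDeriv 1 (l ^ 2)).comp l (hasDerivAt_pow 2 l))).congr_deriv ?_
    simp only [id, mul_one, Function.comp_apply, pow_one, Nat.cast_ofNat, Nat.add_one_sub_one]
    rfl
  simp only [cosSqrtDeriv_one_sq] at h1
  have h2 := h1.unique (Complex.hasDerivAt_sin l).neg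
  rw [cosSqrtDeriv_zero_sq]
  linear_combination h2

theorem cosSqrtDeriv_ode_succ (w : ℂ) :
    4 * w * cosSqrtDeriv 3 w + 6 * cosSqrtDeriv 2 w + cosSqrtDeriv 1 w = 0 := by
  have h1 := ((((hasDerivAt_id w).const_mul 4).mul (hasDerivAt_cosSqrtDeriv 2 w)).add
    ((hasDerivAt_cosSqrtDeriv 1 w).const_mul 2)).add (hasDerivAt_cosSqrtDeriv 0 w)
  have h2 := h1.congr_of_eventuallyEq (f₁ := fun _ => (0 : ℂ))
    (Eventually.of_forall fun w => (cosSqrtDeriv_ode w).symm)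
  have h3 := h2.unique (hasDerivAt_const w (0 : ℂ))
  simp only [id, mul_one] at h3
  linear_combination h3

theorem cosSqrtDeriv_ode_succ_succ (w : ℂ) :
    4 * w * cosSqrtDeriv 4 w + 10 * cosSqrtDeriv 3 w + cosSqrtDeriv 2 w = 0 := by
  have h1 := ((((hasDerivAt_id w).const_mul 4).mul (hasDerivAt_cosSqrtDeriv 3 w)).add
    ((hasDerivAt_cosSqrtDeriv 2 w).const_mul 6)).add (hasDerivAt_cosSqrtDeriv 1 w)
  have h2 := h1.congr_of_eventuallyEq (f₁ := fun _ => (0 : ℂ))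
    (Eventually.of_forall fun w => (cosSqrtDeriv_ode_succ w).symm)
  have h3 := h2.unique (hasDerivAt_const w (0 : ℂ))
  simp only [id, mul_one] at h3
  linear_combination h3

/-- The solution of `-u'' = z u` with `u(0) = 1` and `u'(0) = 0`. -/
def cosSol (z y : ℂ) : ℂ := cosSqrtDeriv 0 (z * y ^ 2)

/-- The solution of `-u'' = z u` with `u(0) = 0` and `u'(0) = 1`. -/
def sinSol (z y : ℂ) : ℂ := -2 * y * cosSqrtDeriv 1 (z * y ^ 2)

theorem cosSol_sq (l y : ℂ) : cosSol (l ^ 2) y = Complex.cos (l * y) := by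
  rw [cosSol, ← mul_pow, cosSqrtDeriv_zero_sq]

theorem mul_sinSol_sq (l y : ℂ) : l * sinSol (l ^ 2) y = Complex.sin (l * y) := by
  rw [sinSol, ← mul_pow]
  linear_combination -cosSqrtDeriv_one_sq (l * y)

theorem cosSol_zero (z : ℂ) : cosSol z 0 = 1 := by
  have := cosSqrt_sq 0
  simpa [cosSol, cosSqrtDeriv] using this

theorem sinSol_zero (z : ℂ) : sinSol z 0 = 0 := by simp [sinSol]

theorem cosSol_sq_add (z y : ℂ) : cosSol z y ^ 2 + z * sinSol z y ^ 2 = 1 := by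
  obtain ⟨l, rfl⟩ : ∃ l : ℂ, l ^ 2 = z := IsAlgClosed.exists_pow_nat_eq z two_pos
  rw [← mul_pow, mul_sinSol_sq, cosSol_sq]
  exact Complex.cos_sq_add_sin_sq _

theorem hasDerivAt_cosSqrtDeriv_comp (n : ℕ) (z y : ℂ) :
    HasDerivAt (fun y => cosSqrtDeriv n (z * y ^ 2))
      (cosSqrtDeriv (n + 1) (z * y ^ 2) * (z * (2 * y))) y := by
  refine ((hasDerivAt_cosSqrtDeriv n (z * y ^ 2)).comp y
    ((hasDerivAt_pow 2 y).const_mul z)).congr_deriv ?_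
  norm_num

theorem hasDerivAt_cosSqrtDeriv_param (n : ℕ) (z y : ℂ) :
    HasDerivAt (fun z => cosSqrtDeriv n (z * y ^ 2))
      (cosSqrtDeriv (n + 1) (z * y ^ 2) * y ^ 2) z := by
  refine ((hasDerivAt_cosSqrtDeriv n (z * y ^ 2)).comp z
    ((hasDerivAt_id z).mul_const (y ^ 2))).congr_deriv ?_
  ring

theorem hasDerivAt_cosSol (z y : ℂ) : HasDerivAt (cosSol z) (-(z * sinSol z y)) y := by
  refine (hasDerivAt_cosSqrtDeriv_comp 0 z y).congr_deriv ?_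
  rw [sinSol]
  ring

theorem hasDerivAt_sinSol (z y : ℂ) : HasDerivAt (sinSol z) (cosSol z y) y := by
  refine (((hasDerivAt_id y).const_mul (-2)).mul
    (hasDerivAt_cosSqrtDeriv_comp 1 z y)).congr_deriv ?_
  rw [cosSol, id, mul_one]
  linear_combination -cosSqrtDeriv_ode (z * y ^ 2)

/-- The solution of `-u'' = z u` with `u(0) = 1` and `u'(0) = -c`. -/
def robinSol (c z y : ℂ) : ℂ := cosSol z y - c * sinSol z y

/-- The derivative of `robinSol`. -/
def robinSolDeriv (c z y : ℂ) : ℂ := -(z * sinSol z y) - c * cosSol z y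

theorem hasDerivAt_robinSol (c z y : ℂ) : HasDerivAt (robinSol c z) (robinSolDeriv c z y) y :=
  (hasDerivAt_cosSol z y).sub ((hasDerivAt_sinSol z y).const_mul c)

theorem hasDerivAt_robinSolDeriv (c z y : ℂ) :
    HasDerivAt (robinSolDeriv c z) (-(z * robinSol c z y)) y := by
  refine (((hasDerivAt_sinSol z y).const_mul z).neg.sub
    ((hasDerivAt_cosSol z y).const_mul c)).congr_deriv ?_
  rw [robinSol]
  ring

theorem robinSol_zero (c z : ℂ) : robinSol c z 0 = 1 := by
  rw [robinSol, cosSol_zero, sinSol_zero, mul_zero, sub_zero]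

theorem robinSolDeriv_zero (c z : ℂ) : robinSolDeriv c z 0 = -c := by
  rw [robinSolDeriv, cosSol_zero, sinSol_zero, mul_zero, mul_one, neg_zero, zero_sub]

/-- The derivative of `robinSol` with respect to the spectral parameter. -/
def robinSolParam (c z y : ℂ) : ℂ :=
  y ^ 2 * cosSqrtDeriv 1 (z * y ^ 2) + 2 * c * y ^ 3 * cosSqrtDeriv 2 (z * y ^ 2)

/-- The derivative of `robinSolParam`. -/
def robinSolParamDeriv (c z y : ℂ) : ℂ :=
  2 * y * cosSqrtDeriv 1 (z * y ^ 2) + 2 * z * y ^ 3 * cosSqrtDeriv 2 (z * y ^ 2) +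
    6 * c * y ^ 2 * cosSqrtDeriv 2 (z * y ^ 2) + 4 * c * z * y ^ 4 * cosSqrtDeriv 3 (z * y ^ 2)

theorem hasDerivAt_robinSolParam (c z y : ℂ) :
    HasDerivAt (robinSolParam c z) (robinSolParamDeriv c z y) y := by
  refine (((hasDerivAt_pow 2 y).mul (hasDerivAt_cosSqrtDeriv_comp 1 z y)).add
    (((hasDerivAt_pow 3 y).const_mul (2 * c)).mul
      (hasDerivAt_cosSqrtDeriv_comp 2 z y))).congr_deriv ?_
  rw [robinSolParamDeriv]
  push_cast
  ring

/-- Differentiating `-u'' = z u` in `z` gives `-v'' = z v + u` for `v = ∂u/∂z`: `v` is a candidate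
for a generalized eigenfunction. -/
theorem hasDerivAt_robinSolParamDeriv (c z y : ℂ) :
    HasDerivAt (robinSolParamDeriv c z) (-(z * robinSolParam c z y + robinSol c z y)) y := by
  refine (((((((hasDerivAt_id y).const_mul 2).mul (hasDerivAt_cosSqrtDeriv_comp 1 z y)).add
    (((hasDerivAt_pow 3 y).const_mul (2 * z)).mul (hasDerivAt_cosSqrtDeriv_comp 2 z y))).add
    (((hasDerivAt_pow 2 y).const_mul (6 * c)).mul (hasDerivAt_cosSqrtDeriv_comp 2 z y)))).add
    (((hasDerivAt_pow 4 y).const_mul (4 * c * z)).mul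
      (hasDerivAt_cosSqrtDeriv_comp 3 z y))).congr_deriv ?_
  have e0 := cosSqrtDeriv_ode (z * y ^ 2)
  have e1 := cosSqrtDeriv_ode_succ (z * y ^ 2)
  have e2 := cosSqrtDeriv_ode_succ_succ (z * y ^ 2)
  rw [robinSolParam, robinSol, cosSol, sinSol]
  simp only [id]
  push_cast
  linear_combination e0 + z * y ^ 2 * e1 + 2 * c * y * e1 + 2 * c * z * y ^ 3 * e2

/-- The characteristic function, whose zeros are the eigenvalues of `robinOp a cp cm`. -/
def robinCharFun (a : ℝ) (cp cm z : ℂ) : ℂ :=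
  robinSolDeriv cm z (2 * a) + cp * robinSol cm z (2 * a)

theorem hasDerivAt_robinCharFun (a : ℝ) (cp cm z : ℂ) :
    HasDerivAt (robinCharFun a cp cm)
      (robinSolParamDeriv cm z (2 * a) + cp * robinSolParam cm z (2 * a)) z := by
  have hc (y : ℂ) : HasDerivAt (fun z => cosSol z y) (cosSqrtDeriv 1 (z * y ^ 2) * y ^ 2) z :=
    hasDerivAt_cosSqrtDeriv_param 0 z y
  have hs (y : ℂ) : HasDerivAt (fun z => sinSol z y)
      (-2 * y * (cosSqrtDeriv 2 (z * y ^ 2) * y ^ 2)) z :=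
    (hasDerivAt_cosSqrtDeriv_param 1 z y).const_mul (-2 * y)
  refine (((((hasDerivAt_id z).mul (hs (2 * a))).neg.sub ((hc (2 * a)).const_mul cm)).add
    (((hc (2 * a)).sub ((hs (2 * a)).const_mul cm)).const_mul cp))).congr_deriv ?_
  have e1 := cosSqrtDeriv_ode_succ (z * (2 * a) ^ 2)
  rw [robinSolParam, robinSolParamDeriv, sinSol]
  simp only [id]
  linear_combination -cm * (2 * a) ^ 2 * e1

theorem robinCharFun_sq (a : ℝ) (cp cm l : ℂ) :
    l * robinCharFun a cp cm (l ^ 2) = -(l ^ 2 + cp * cm) * Complex.sin (l * (2 * a)) +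
      (cp - cm) * l * Complex.cos (l * (2 * a)) := by
  rw [robinCharFun, robinSol, robinSolDeriv, cosSol_sq, ← mul_sinSol_sq]
  ring

end Solutions

/-! ### Spectral theory of the Robin operator and of its adjoint. -/

noncomputable section RobinOperator

variable {a : ℝ} {cp cm : ℂ}

section LinearPMap

variable {E : Type*} [AddCommGroup E] [Module ℂ E] {T : E →ₗ.[ℂ] E} {μ : ℂ} {f : E}

theorem mem_kerPow_succ {n : ℕ} {w : E} :
    w ∈ kerPow T μ (n + 1) ↔ ∃ v, (w, v) ∈ T.graph ∧ v - μ • w ∈ kerPow T μ n := by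
  simp only [kerPow, Submodule.mem_map, Submodule.mem_inf, Submodule.mem_comap, Prod.exists,
    LinearMap.fst_apply, LinearMap.sub_apply, LinearMap.snd_apply, LinearMap.smul_apply]
  constructor
  · rintro ⟨x, v, ⟨h1, h2⟩, rfl⟩
    exact ⟨v, h2, h1⟩
  · rintro ⟨v, h1, h2⟩
    exact ⟨w, v, ⟨h2, h1⟩, rfl⟩

/-- An eigenvector for a simple eigenvalue `μ` is not in the range of `T - μ`. -/
theorem IsSimpleEigenvalue.not_mem_graph (h : IsSimpleEigenvalue T μ) (hf : IsEigenvector T μ f)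
    (w : E) : (w, μ • w + f) ∉ T.graph := by
  intro hw
  have h1 : f ∈ kerPow T μ 1 := mem_kerPow_succ.2 ⟨μ • f, hf.2, by simp [kerPow]⟩
  have h2 : w ∈ kerPow T μ 2 := mem_kerPow_succ.2 ⟨_, hw, by simpa using h1⟩
  have h1' : f ∈ ⨆ n, kerPow T μ n := Submodule.mem_iSup_of_mem 1 h1
  have h2' : w ∈ ⨆ n, kerPow T μ n := Submodule.mem_iSup_of_mem 2 h2
  -- Such a `w` would lie in the one-dimensional root space, hence be `c • f`; subtracting `c • (f,
  -- μ • f)` puts `(0, f)` into the graph and forces `f = 0`.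
  obtain ⟨c, hc⟩ := exists_smul_eq_of_finrank_eq_one h
    (x := (⟨f, h1'⟩ : (⨆ n, kerPow T μ n : Submodule ℂ E)))
    (fun h => hf.1 (congrArg Subtype.val h)) ⟨w, h2'⟩
  have hc' : c • f = w := congrArg Subtype.val hc
  have h3 := T.graph.sub_mem hw (T.graph.smul_mem c hf.2)
  rw [← hc'] at h3
  have h4 : (c • f, μ • c • f + f) - c • (f, μ • f) = ((0 : E), f) := by
    rw [Prod.smul_mk, Prod.mk_sub_mk, sub_self, smul_comm μ c, add_sub_cancel_left]
  rw [h4] at h3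
  exact hf.1 (T.graph_fst_eq_zero_snd h3 rfl)

end LinearPMap

theorem toL2_mem_robinGraph (ha : 0 < a) {u v F : C(ℝ, ℂ)} (hu : ∀ x, HasDerivAt u (v x) x)
    (hv : ∀ x, HasDerivAt v (-F x) x) (h1 : v a + cp * u a = 0) (h2 : v (-a) + cm * u (-a) = 0) :
    (toL2 a u, toL2 a F) ∈ robinGraph a cp cm :=
  ⟨toL2 a v, hasWeakDeriv_toL2 ha hu, hasWeakDeriv_toL2 ha (v := -F) hv, u, v,
    u.continuous.continuousOn, v.continuous.continuousOn, coeFn_toL2 a u, coeFn_toL2 a v, h1, h2⟩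

/-- Test functions satisfy every boundary condition. Density is what gives `LinearPMap.adjoint` its
meaning. -/
theorem dense_robinOp_domain (ha : 0 < a) :
    Dense ((robinOp a cp cm).domain : Set (L2 a)) := by
  rw [Submodule.dense_iff_topologicalClosure_eq_top, Submodule.topologicalClosure_eq_top_iff,
    Submodule.eq_bot_iff]
  intro f hf
  refine eq_zero_of_integral_test_smul fun η h1 _ h3 => ?_
  have hη {x : ℝ} (hx : x ∉ Ioo (-a) a) : η x = 0 :=
    image_eq_zero_of_notMem_tsupport fun hx' => hx (h3 hx')
  have hη' {x : ℝ} (hx : x ∉ Ioo (-a) a) : deriv η x = 0 :=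
    image_eq_zero_of_notMem_tsupport fun hx' =>
      hx (h3 (closure_minimal (support_deriv_subset) (isClosed_tsupport _) hx'))
  have c1 : ContDiff ℝ ∞ (deriv η) := h1.deriv' 
  have c2 : Continuous (deriv (deriv η)) := c1.continuous_deriv (by simp)
  have hmem := toL2_mem_robinGraph (cp := cp) (cm := cm) ha (u := ofRealMap η h1.continuous)
    (v := ofRealMap (deriv η) c1.continuous) (F := -ofRealMap (deriv (deriv η)) c2)
    (fun x => ((h1.differentiable (by simp)) x).hasDerivAt.ofReal_comp)
    (fun x => by
      rw [ContinuousMap.neg_apply, neg_neg]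
      exact ((c1.differentiable (by simp)) x).hasDerivAt.ofReal_comp)
    (by simp [ofRealMap, hη, hη']) (by simp [ofRealMap, hη, hη'])
  rw [← robinOp_graph] at hmem
  rw [← inner_ofRealMap η h1.continuous]
  exact (Submodule.mem_orthogonal _ _).1 hf _ (LinearPMap.mem_domain_of_mem_graph hmem)

/-- Apart from `φ ≠ 0`, this weak form is all that is used about adjoint eigenvectors; the domain of
the adjoint is never determined. -/
theorem IsEigenvector.adjoint_inner {φ : L2 a} {z : ℂ} (ha : 0 < a)
    (h : IsEigenvector (robinOp a cp cm).adjoint (conj z) φ) {ψ F : L2 a}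
    (hψ : (ψ, F) ∈ robinGraph a cp cm) : inner ℂ φ F = z * inner ℂ φ ψ := by
  rw [← robinOp_graph] at hψ
  have h1 := LinearPMap.adjoint_isFormalAdjoint (dense_robinOp_domain (cp := cp) (cm := cm) ha)
  obtain ⟨x, hx1, hx2⟩ := LinearPMap.mem_graph_iff _ |>.1 h.2
  obtain ⟨y, hy1, hy2⟩ := LinearPMap.mem_graph_iff _ |>.1 hψ
  have h2 := h1 x y
  simp only at hx1 hx2 hy1 hy2
  rw [hx1, hx2, hy1, hy2, inner_smul_left, Complex.conj_conj] at h2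
  exact h2.symm

theorem hasDerivAt_comp_ofReal_add {g : ℂ → ℂ} {g' : ℂ} {x : ℝ} (h : HasDerivAt g g' (x + a)) :
    HasDerivAt (fun x : ℝ => g (x + a)) g' x :=
  (h.comp_add_const (x : ℂ) (a : ℂ)).comp_ofReal

/-- `robinSol` as a function on `ℝ`, shifted so that the base point is `-a`. -/
def robinMap (a : ℝ) (c z : ℂ) : C(ℝ, ℂ) :=
  ⟨fun x => robinSol c z (x + a), by
    have : Continuous (robinSol c z) :=
      continuous_iff_continuousAt.2 fun y => (hasDerivAt_robinSol c z y).continuousAt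
    fun_prop⟩

/-- The derivative of `robinMap`. -/
def robinMapDeriv (a : ℝ) (c z : ℂ) : C(ℝ, ℂ) :=
  ⟨fun x => robinSolDeriv c z (x + a), by
    have : Continuous (robinSolDeriv c z) :=
      continuous_iff_continuousAt.2 fun y => (hasDerivAt_robinSolDeriv c z y).continuousAt
    fun_prop⟩

theorem hasDerivAt_robinMap (c z : ℂ) (x : ℝ) :
    HasDerivAt (robinMap a c z) (robinMapDeriv a c z x) x :=
  hasDerivAt_comp_ofReal_add (hasDerivAt_robinSol c z _)

theorem hasDerivAt_robinMapDeriv (c z : ℂ) (x : ℝ) :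
    HasDerivAt (robinMapDeriv a c z) (-(z * robinMap a c z x)) x :=
  hasDerivAt_comp_ofReal_add (hasDerivAt_robinSolDeriv c z _)

theorem robinMap_left (a : ℝ) (c z : ℂ) : robinMap a c z (-a) = 1 := by
  simp [robinMap, robinSol_zero]

theorem robinMapDeriv_left (a : ℝ) (c z : ℂ) : robinMapDeriv a c z (-a) = -c := by
  simp [robinMapDeriv, robinSolDeriv_zero]

theorem robinCharFun_eq (a : ℝ) (cp cm z : ℂ) :
    robinCharFun a cp cm z = robinMapDeriv a cm z a + cp * robinMap a cm z a := by
  simp [robinMap, robinMapDeriv, robinCharFun, two_mul]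

theorem toL2_ne_zero (ha : 0 < a) {u : C(ℝ, ℂ)} (hu : u (-a) ≠ 0) : toL2 a u ≠ 0 := by
  intro h
  have h1 : u =ᵐ[volume.restrict (Ioo (-a) a)] fun _ => (0 : ℂ) := by
    refine (coeFn_toL2 a u).symm.trans ?_
    rw [h]
    exact Lp.coeFn_zero _ _ _
  have h2 : EqOn u (fun _ => 0) (Ioo (-a) a) :=
    Measure.eqOn_open_of_ae_eq h1 isOpen_Ioo u.continuous.continuousOn continuousOn_const
  have h3 := h2.closure u.continuous continuous_const
  rw [closure_Ioo (by linarith)] at h3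
  exact hu (h3 ⟨le_rfl, by linarith⟩)

theorem toL2_robinMap_ne_zero (ha : 0 < a) (c z : ℂ) : toL2 a (robinMap a c z) ≠ 0 :=
  toL2_ne_zero ha (by rw [robinMap_left]; exact one_ne_zero)

theorem robinMap_mem_graph (ha : 0 < a) {z : ℂ} (hz : robinCharFun a cp cm z = 0) :
    (toL2 a (robinMap a cm z), z • toL2 a (robinMap a cm z)) ∈ robinGraph a cp cm := by
  rw [← toL2_smul]
  refine toL2_mem_robinGraph ha (hasDerivAt_robinMap cm z) (hasDerivAt_robinMapDeriv cm z) ?_ ?_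
  · rw [← robinCharFun_eq, hz]
  · rw [robinMap_left, robinMapDeriv_left]
    ring

theorem isEigenvector_robinMap (ha : 0 < a) {z : ℂ} (hz : robinCharFun a cp cm z = 0) :
    IsEigenvector (robinOp a cp cm) z (toL2 a (robinMap a cm z)) :=
  ⟨toL2_robinMap_ne_zero ha cm z, by rw [robinOp_graph]; exact robinMap_mem_graph ha hz⟩

/-- Simple eigenvalues are simple zeros of the characteristic function. -/
theorem deriv_robinCharFun_ne_zero (ha : 0 < a) {z : ℂ} (hz : robinCharFun a cp cm z = 0)
    (hs : IsSimpleEigenvalue (robinOp a cp cm) z) : deriv (robinCharFun a cp cm) z ≠ 0 := by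
  intro hd
  rw [(hasDerivAt_robinCharFun a cp cm z).deriv] at hd
  -- At a double zero the `z`-derivative of the Robin solution meets both boundary conditions and
  -- solves `(H - z) v = u`, which a simple eigenvalue forbids.
  let v : C(ℝ, ℂ) := ⟨fun x => robinSolParam cm z (x + a), by
    have : Continuous (robinSolParam cm z) :=
      continuous_iff_continuousAt.2 fun y => (hasDerivAt_robinSolParam cm z y).continuousAt
    fun_prop⟩
  let v' : C(ℝ, ℂ) := ⟨fun x => robinSolParamDeriv cm z (x + a), by
    have : Continuous (robinSolParamDeriv cm z) :=
      continuous_iff_continuousAt.2 fun y => (hasDerivAt_robinSolParamDeriv cm z y).continuousAt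
    fun_prop⟩
  have h := toL2_mem_robinGraph (cp := cp) (cm := cm) ha (u := v) (v := v')
    (F := z • v + robinMap a cm z)
    (fun x => hasDerivAt_comp_ofReal_add (hasDerivAt_robinSolParam cm z _))
    (fun x => hasDerivAt_comp_ofReal_add (hasDerivAt_robinSolParamDeriv cm z _))
    (by
      simp only [v, v', ContinuousMap.coe_mk, ← two_mul]
      exact hd)
    (by simp [v, v', robinSolParam, robinSolParamDeriv])
  rw [toL2_add, toL2_smul, ← robinOp_graph] at h
  exact hs.not_mem_graph (isEigenvector_robinMap ha hz) _ h

theorem exists_forall_hasDerivAt {f : ℝ → ℂ} (hf : Continuous f) (x₀ : ℝ) :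
    ∃ F : ℝ → ℂ, F x₀ = 0 ∧ (∀ x, F x = ∫ t in x₀..x, f t) ∧ ∀ x, HasDerivAt F (f x) x :=
  ⟨fun x => ∫ t in x₀..x, f t, by simp, fun _ => rfl, fun x =>
    intervalIntegral.integral_hasDerivAt_right (hf.intervalIntegrable _ _)
      (hf.stronglyMeasurableAtFilter _ _) hf.continuousAt⟩

/-- The equation `(H - z) w = g` is solvable for continuous `g` if `z` is not an eigenvalue, or if
`g` is orthogonal to the eigenfunction of the adjoint operator. -/
theorem exists_mem_robinGraph (ha : 0 < a) {z : ℂ} (g : C(ℝ, ℂ))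
    (h : robinCharFun a cp cm z ≠ 0 ∨
      robinCharFun a cp cm z = 0 ∧ ∫ x in (-a)..a, robinMap a cm z x * g x = 0) :
    ∃ w : L2 a, (w, z • w + toL2 a g) ∈ robinGraph a cp cm := by
  let c : ℝ → ℂ := fun x => cosSol z (x + a)
  let s : ℝ → ℂ := fun x => sinSol z (x + a)
  have hc (x : ℝ) : HasDerivAt c (-(z * s x)) x := hasDerivAt_comp_ofReal_add (hasDerivAt_cosSol z _)
  have hs (x : ℝ) : HasDerivAt s (c x) x := hasDerivAt_comp_ofReal_add (hasDerivAt_sinSol z _)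
  have hcc : Continuous c := continuous_iff_continuousAt.2 fun x => (hc x).continuousAt
  have hsc : Continuous s := continuous_iff_continuousAt.2 fun x => (hs x).continuousAt
  have hcs (x : ℝ) : c x ^ 2 + z * s x ^ 2 = 1 := cosSol_sq_add z _
  obtain ⟨P, hP0, hPi, hP⟩ := exists_forall_hasDerivAt (f := fun x => c x * g x)
    (hcc.mul g.continuous) (-a)
  obtain ⟨Q, hQ0, hQi, hQ⟩ := exists_forall_hasDerivAt (f := fun x => s x * g x)
    (hsc.mul g.continuous) (-a)
  have hPc : Continuous P := continuous_iff_continuousAt.2 fun x => (hP x).continuousAt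
  have hQc : Continuous Q := continuous_iff_continuousAt.2 fun x => (hQ x).continuousAt
  have hu : ∀ x, robinMap a cm z x = c x - cm * s x := fun x => rfl
  have hu' : ∀ x, robinMapDeriv a cm z x = -(z * s x) - cm * c x := fun x => rfl
  -- Variation of constants: `-s P + c Q` solves the equation with zero data at `-a`, and adding `α
  -- u` keeps the condition there. The condition at `a` determines `α` if the characteristic
  -- function is nonzero; otherwise orthogonality makes `α = 0` work.
  obtain ⟨α, hα⟩ : ∃ α : ℂ, -(c a + cp * s a) * P a + (cp * c a - z * s a) * Q a +
      α * robinCharFun a cp cm z = 0 := by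
    rcases h with h | ⟨h, hg⟩
    · refine ⟨-(-(c a + cp * s a) * P a + (cp * c a - z * s a) * Q a) / robinCharFun a cp cm z, ?_⟩
      field_simp
      ring
    · refine ⟨0, ?_⟩
      have e : P a - cm * Q a = 0 := by
        have i1 : IntervalIntegrable (fun x => c x * g x) volume (-a) a :=
          (hcc.mul g.continuous).intervalIntegrable _ _
        have i2 : IntervalIntegrable (fun x => cm * (s x * g x)) volume (-a) a :=
          (continuous_const.mul (hsc.mul g.continuous)).intervalIntegrable _ _
        rw [← hg, hPi, hQi, ← intervalIntegral.integral_const_mul,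
          ← intervalIntegral.integral_sub i1 i2]
        refine intervalIntegral.integral_congr fun x _ => ?_
        simp only [hu]
        ring
      rw [robinCharFun_eq, hu, hu'] at h
      linear_combination Q a * h - (c a + cp * s a) * e
  let w : C(ℝ, ℂ) := ⟨fun x => -(s x * P x) + c x * Q x + α * robinMap a cm z x, by fun_prop⟩
  let w' : C(ℝ, ℂ) := ⟨fun x => -(c x * P x) - z * (s x * Q x) + α * robinMapDeriv a cm z x,
    by fun_prop⟩
  refine ⟨toL2 a w, ?_⟩
  rw [← toL2_smul, ← toL2_add]
  refine toL2_mem_robinGraph ha (v := w') (fun x => ?_) (fun x => ?_) ?_ ?_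
  · refine ((((hs x).mul (hP x)).neg.add ((hc x).mul (hQ x))).add
      ((hasDerivAt_robinMap cm z x).const_mul α)).congr_deriv ?_
    simp only [w', ContinuousMap.coe_mk]
    ring
  · refine ((((hc x).mul (hP x)).neg.sub (((hs x).mul (hQ x)).const_mul z)).add
      ((hasDerivAt_robinMapDeriv cm z x).const_mul α)).congr_deriv ?_
    simp only [w, ContinuousMap.coe_mk, ContinuousMap.add_apply, ContinuousMap.smul_apply,
      smul_eq_mul]
    linear_combination -g x * hcs x
  · rw [robinCharFun_eq] at hα
    simp only [w, w', ContinuousMap.coe_mk]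
    linear_combination hα
  · simp only [w, w', ContinuousMap.coe_mk, hP0, hQ0, robinMap_left, robinMapDeriv_left]
    ring

/-- The complex conjugate of `robinMap`. -/
def robinMapConj (a : ℝ) (c z : ℂ) : C(ℝ, ℂ) :=
  ⟨fun x => conj (robinMap a c z x), by fun_prop⟩

theorem inner_robinMapConj (ha : 0 < a) (c z : ℂ) (g : C(ℝ, ℂ)) :
    inner ℂ (toL2 a (robinMapConj a c z)) (toL2 a g) = ∫ x in (-a)..a, robinMap a c z x * g x := by
  rw [inner_toL2_toL2 ha]
  simp [robinMapConj]

variable {z : ℂ} {φ : L2 a}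

/-- An adjoint eigenvector is orthogonal to the range of `H - z`, and the continuous functions
allowed here lie in that range. -/
theorem IsEigenvector.inner_adjoint_eq_zero (ha : 0 < a)
    (hφ : IsEigenvector (robinOp a cp cm).adjoint (conj z) φ) (g : C(ℝ, ℂ))
    (h : robinCharFun a cp cm z ≠ 0 ∨ robinCharFun a cp cm z = 0 ∧
      inner ℂ (toL2 a (robinMapConj a cm z)) (toL2 a g) = 0) : inner ℂ φ (toL2 a g) = 0 := by
  rw [inner_robinMapConj ha] at h
  obtain ⟨w, hw⟩ := exists_mem_robinGraph ha g h
  have := hφ.adjoint_inner ha hw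
  rw [inner_add_right, inner_smul_right] at this
  linear_combination this

theorem eq_zero_of_inner_toL2_right {f : L2 a} (h : ∀ u : C(ℝ, ℂ), inner ℂ f (toL2 a u) = 0) :
    f = 0 :=
  eq_zero_of_inner_toL2 fun u => by rw [← inner_conj_symm, h, map_zero]

theorem IsEigenvector.robinCharFun_eq_zero (ha : 0 < a)
    (hφ : IsEigenvector (robinOp a cp cm).adjoint (conj z) φ) : robinCharFun a cp cm z = 0 := by
  by_contra h
  exact hφ.1 (eq_zero_of_inner_toL2_right fun u => hφ.inner_adjoint_eq_zero ha u (Or.inl h))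

theorem toL2_robinMapConj_ne_zero (ha : 0 < a) (c z : ℂ) : toL2 a (robinMapConj a c z) ≠ 0 :=
  toL2_ne_zero ha (by simp [robinMapConj, robinMap_left])

/-- `φ` annihilates every continuous function orthogonal to `U`, the conjugate of the Robin
solution. Projecting an arbitrary continuous function onto the complement of `U` shows that `φ` is a
multiple of `U`, without regularity theory for the adjoint. -/
theorem IsEigenvector.exists_eq_smul (ha : 0 < a)
    (hφ : IsEigenvector (robinOp a cp cm).adjoint (conj z) φ) :
    ∃ α : ℂ, α ≠ 0 ∧ φ = α • toL2 a (robinMapConj a cm z) := by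
  have hz := hφ.robinCharFun_eq_zero ha
  set U := toL2 a (robinMapConj a cm z) with hU
  have hN : inner ℂ U U ≠ 0 := inner_self_ne_zero.2 (toL2_robinMapConj_ne_zero ha cm z)
  have key (g : C(ℝ, ℂ)) : inner ℂ φ (toL2 a g) = inner ℂ φ U / inner ℂ U U * inner ℂ U (toL2 a g) := by
    have h := hφ.inner_adjoint_eq_zero ha
      (g - (inner ℂ U (toL2 a g) / inner ℂ U U) • robinMapConj a cm z) (Or.inr ⟨hz, by
        rw [toL2_sub, toL2_smul, inner_sub_right, inner_smul_right, ← hU, div_mul_cancel₀ _ hN,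
          sub_self]⟩)
    rw [toL2_sub, toL2_smul, inner_sub_right, inner_smul_right, ← hU] at h
    rw [sub_eq_zero.1 h]
    ring
  have heq : φ = conj (inner ℂ φ U / inner ℂ U U) • U := by
    refine sub_eq_zero.1 (eq_zero_of_inner_toL2_right fun g => ?_)
    rw [inner_sub_left, inner_smul_left, Complex.conj_conj, key, sub_self]
  refine ⟨_, fun h0 => hφ.1 ?_, heq⟩
  rw [heq, h0, zero_smul]

/-- If the pairing vanished, the eigenfunction would lie in the range of `H - z`, against
simplicity. -/
theorem inner_robinMapConj_self_ne_zero (ha : 0 < a) (hz : robinCharFun a cp cm z = 0)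
    (hs : IsSimpleEigenvalue (robinOp a cp cm) z) :
    inner ℂ (toL2 a (robinMapConj a cm z)) (toL2 a (robinMap a cm z)) ≠ 0 := by
  intro h
  rw [inner_robinMapConj ha] at h
  obtain ⟨w, hw⟩ := exists_mem_robinGraph ha _ (Or.inr ⟨hz, h⟩)
  rw [← robinOp_graph] at hw
  exact hs.not_mem_graph (isEigenvector_robinMap ha hz) w hw

theorem IsEigenvector.inner_robinMap_of_ne (ha : 0 < a)
    (hφ : IsEigenvector (robinOp a cp cm).adjoint (conj z) φ) {z' : ℂ}
    (hz' : robinCharFun a cp cm z' = 0) (hne : z' ≠ z) :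
    inner ℂ φ (toL2 a (robinMap a cm z')) = 0 := by
  have h := hφ.adjoint_inner ha (robinMap_mem_graph ha hz')
  rw [inner_smul_right] at h
  refine (mul_eq_zero.1 ?_).resolve_left (sub_ne_zero.2 hne)
  linear_combination h

end RobinOperator

/-! ### Argument principle and Rouché's theorem for simple zeros. -/

section Rouche

open Metric

variable {f g : ℂ → ℂ} {R : ℝ}

theorem circleIntegrable_logDeriv (hR : 0 < R) (hf : Differentiable ℂ f)
    (h0 : ∀ z ∈ sphere (0 : ℂ) R, f z ≠ 0) :
    CircleIntegrable (fun z => deriv f z / f z) 0 R :=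
  ContinuousOn.circleIntegrable hR.le
    (hf.deriv.continuous.continuousOn.div hf.continuous.continuousOn h0)

/-- The argument principle for an entire function with simple zeros. -/
theorem circleIntegral_logDeriv_eq_card (hR : 0 < R) (Z : Finset ℂ) :
    ∀ f : ℂ → ℂ, Differentiable ℂ f → (∀ z ∈ closedBall (0 : ℂ) R, f z = 0 ↔ z ∈ Z) →
      (∀ z ∈ Z, z ∈ ball (0 : ℂ) R ∧ deriv f z ≠ 0) →
      (∮ z in C(0, R), deriv f z / f z) = Z.card * (2 * Real.pi * Complex.I) := by
  induction Z using Finset.induction_on with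
  | empty =>
    intro f hf h1 _
    have hd : DifferentiableOn ℂ (fun z => deriv f z / f z) (closedBall 0 R) := fun z hz =>
      ((hf.deriv z).div (hf z) (by simpa using h1 z hz)).differentiableWithinAt
    have hc := hd.diffContOnCl_ball Subset.rfl
    rw [hc.circleIntegral_eq_zero hR.le]
    simp
  | insert s Z hs ih =>
    intro f hf h1 h2
    have hsb := (h2 s (Finset.mem_insert_self s Z)).1
    have hs0 : f s = 0 := (h1 s (ball_subset_closedBall hsb)).2 (Finset.mem_insert_self s Z)
    -- The zero `s` is divided out. The quotient keeps the other zeros, still simple, and the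
    -- logarithmic derivatives differ by `1 / (z - s)`.
    have hF : Differentiable ℂ (dslope f s) := by
      rw [← differentiableOn_univ, Complex.differentiableOn_dslope univ_mem]
      exact hf.differentiableOn
    have hfac : f = fun z => (z - s) * dslope f s z := by
      ext z
      have := sub_smul_dslope f s z
      rw [hs0, sub_zero, smul_eq_mul] at this
      exact this.symm
    have hder (z : ℂ) : deriv f z = dslope f s z + (z - s) * deriv (dslope f s) z := by
      have h := ((hasDerivAt_id z).sub_const s).mul (hF z).hasDerivAt
      have h' : HasDerivAt f (1 * dslope f s z + (id z - s) * deriv (dslope f s) z) z := by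
        refine HasDerivAt.congr_of_eventuallyEq h (Eventually.of_forall fun w => ?_)
        exact congrFun hfac w
      rw [h'.deriv, one_mul, id]
    have hFs : dslope f s s ≠ 0 := by
      rw [dslope_same]
      exact (h2 s (Finset.mem_insert_self s Z)).2
    have hF1 : ∀ z ∈ closedBall (0 : ℂ) R, dslope f s z = 0 ↔ z ∈ Z := by
      intro z hz
      rcases eq_or_ne z s with rfl | hzs
      · exact iff_of_false hFs hs
      · have h3 := h1 z hz
        rw [congrFun hfac z, mul_eq_zero, Finset.mem_insert] at h3
        simpa [sub_eq_zero, hzs] using h3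
    have hF2 : ∀ z ∈ Z, z ∈ ball (0 : ℂ) R ∧ deriv (dslope f s) z ≠ 0 := by
      intro z hz
      have h3 := h2 z (Finset.mem_insert_of_mem hz)
      refine ⟨h3.1, fun h4 => h3.2 ?_⟩
      rw [hder, h4, (hF1 z (ball_subset_closedBall h3.1)).2 hz, mul_zero, add_zero]
    have hsph : ∀ z ∈ sphere (0 : ℂ) R, z - s ≠ 0 ∧ dslope f s z ≠ 0 := by
      intro z hz
      have hnotZ : z ∉ insert s Z := fun h => by
        have h3 := mem_ball.1 (h2 z h).1
        rw [mem_sphere.1 hz] at h3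
        exact lt_irrefl _ h3
      rw [Finset.mem_insert, not_or] at hnotZ
      exact ⟨sub_ne_zero.2 hnotZ.1, fun h => hnotZ.2 ((hF1 z (sphere_subset_closedBall hz)).1 h)⟩
    have e : (∮ z in C(0, R), deriv f z / f z) =
        ∮ z in C(0, R), ((z - s)⁻¹ + deriv (dslope f s) z / dslope f s z) := by
      refine circleIntegral.integral_congr hR.le fun z hz => ?_
      obtain ⟨h3, h4⟩ := hsph z hz
      rw [hder, congrFun hfac z]
      field_simp
    have i1 : CircleIntegrable (fun z => (z - s)⁻¹) 0 R :=
      ContinuousOn.circleIntegrable hR.le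
        (ContinuousOn.inv₀ (by fun_prop) fun z hz => (hsph z hz).1)
    rw [e, circleIntegral.integral_add i1
      (circleIntegrable_logDeriv hR hF fun z hz => (hsph z hz).2),
      circleIntegral.integral_sub_inv_of_mem_ball hsb, ih _ hF hF1 hF2, Finset.card_insert_of_notMem hs]
    push_cast
    ring

/-- Simple zeros are isolated, and a closed discrete subset of a compact ball is finite. -/
theorem finite_zeros_closedBall (hf : Differentiable ℂ f)
    (h : ∀ z ∈ closedBall (0 : ℂ) R, f z = 0 → deriv f z ≠ 0) :
    {z ∈ closedBall (0 : ℂ) R | f z = 0}.Finite := by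
  have hcl : IsClosed {z ∈ closedBall (0 : ℂ) R | f z = 0} :=
    isClosed_closedBall.inter (isClosed_eq hf.continuous continuous_const)
  refine ((isCompact_closedBall (0 : ℂ) R).of_isClosed_subset hcl fun z hz => hz.1).finite ?_
  refine isDiscrete_iff_forall_mem_exists_isOpen.2 fun z hz => ?_
  obtain ⟨U, hU, hUo, hzU⟩ := _root_.eventually_nhds_iff.1 (eventually_nhdsWithin_iff.1
    ((hf z).hasDerivAt.eventually_ne (c := 0) (h z hz.1 hz.2)))
  refine ⟨U, hUo, ?_⟩
  ext w
  constructor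
  · rintro ⟨hwU, hw⟩
    by_contra hne
    exact hU w hwU hne hw.2
  · rintro rfl
    exact ⟨hzU, hz⟩

/-- Rouché's theorem for entire functions with simple zeros. -/
theorem ncard_zeros_eq_of_norm_sub_lt (hR : 0 < R) (hf : Differentiable ℂ f)
    (hg : Differentiable ℂ g) (hfg : ∀ z ∈ sphere (0 : ℂ) R, ‖f z - g z‖ < ‖g z‖)
    (hf' : ∀ z, f z = 0 → deriv f z ≠ 0) (hg' : ∀ z, g z = 0 → deriv g z ≠ 0) :
    {z ∈ closedBall (0 : ℂ) R | f z = 0}.ncard = {z ∈ closedBall (0 : ℂ) R | g z = 0}.ncard := by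
  have hg0 : ∀ z ∈ sphere (0 : ℂ) R, g z ≠ 0 := fun z hz h => by
    have := hfg z hz
    rw [h, norm_zero] at this
    exact absurd this (not_lt.2 (norm_nonneg _))
  have hf0 : ∀ z ∈ sphere (0 : ℂ) R, f z ≠ 0 := fun z hz h => by
    have := hfg z hz
    rw [h, zero_sub, norm_neg] at this
    exact lt_irrefl _ this
  have key {f : ℂ → ℂ} (hf : Differentiable ℂ f) (hf0 : ∀ z ∈ sphere (0 : ℂ) R, f z ≠ 0)
      (hf' : ∀ z, f z = 0 → deriv f z ≠ 0) : (∮ z in C(0, R), deriv f z / f z) =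
      ({z ∈ closedBall (0 : ℂ) R | f z = 0}.ncard : ℂ) * (2 * Real.pi * Complex.I) := by
    have hfin := finite_zeros_closedBall (R := R) hf fun z _ => hf' z
    rw [ncard_eq_toFinset_card _ hfin]
    refine circleIntegral_logDeriv_eq_card hR _ f hf (fun z hz => ?_) fun z hz => ?_
    · rw [Set.Finite.mem_toFinset]
      exact ⟨fun h => ⟨hz, h⟩, fun h => h.2⟩
    · rw [Set.Finite.mem_toFinset] at hz
      refine ⟨?_, hf' z hz.2⟩
      rw [← ball_union_sphere] at hz
      exact hz.1.resolve_right fun h => hf0 z h hz.2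
  -- On the circle `f / g` stays at distance less than one from `1`, so the principal `log (f / g)`
  -- is a primitive of the difference.
  have hdiff : (∮ z in C(0, R), (deriv f z / f z - deriv g z / g z)) = 0 := by
    refine circleIntegral.integral_eq_zero_of_hasDerivWithinAt
      (f := fun z => Complex.log (f z / g z)) hR.le fun z hz => ?_
    have hz1 := hf0 z hz
    have hz2 := hg0 z hz
    have hslit : f z / g z ∈ Complex.slitPlane := by
      have h1 : ‖f z / g z - 1‖ < 1 := by
        rw [div_sub_one hz2, norm_div, div_lt_one (norm_pos_iff.2 hz2)]
        exact hfg z hz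
      refine Complex.mem_slitPlane_iff.2 (Or.inl ?_)
      have h2 := (abs_le.1 ((Complex.abs_re_le_norm _).trans h1.le)).1
      have h3 := (Complex.abs_re_le_norm (f z / g z - 1)).trans_lt h1
      rw [Complex.sub_re, Complex.one_re, abs_lt] at h3
      linarith [h3.1]
    refine (((hf z).hasDerivAt.div (hg z).hasDerivAt hz2).clog hslit).hasDerivWithinAt.congr_deriv ?_
    rw [Pi.div_apply]
    field_simp
  rw [circleIntegral.integral_sub (circleIntegrable_logDeriv hR hf hf0)
    (circleIntegrable_logDeriv hR hg hg0), key hf hf0 hf', key hg hg0 hg', ← sub_mul] at hdiff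
  have h1 := (mul_eq_zero.1 hdiff).resolve_right Complex.two_pi_I_ne_zero
  exact_mod_cast sub_eq_zero.1 h1

end Rouche

/-! ### Counting and asymptotics of the eigenvalues. -/

section Asymptotics

open Metric

theorem Complex.norm_sin_sq (z : ℂ) : ‖Complex.sin z‖ ^ 2 = Real.sin z.re ^ 2 + Real.sinh z.im ^ 2 := by
  rw [Complex.sin_eq z, ← Complex.normSq_eq_norm_sq]
  simp only [← Complex.ofReal_sin, ← Complex.ofReal_cos, ← Complex.ofReal_sinh,
    ← Complex.ofReal_cosh, ← Complex.ofReal_mul]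
  rw [Complex.normSq_add_mul_I]
  linear_combination Real.sin z.re ^ 2 * Real.cosh_sq z.im +
    Real.sinh z.im ^ 2 * Real.sin_sq_add_cos_sq z.re

theorem Complex.norm_cos_sq (z : ℂ) : ‖Complex.cos z‖ ^ 2 = Real.cos z.re ^ 2 + Real.sinh z.im ^ 2 := by
  rw [Complex.cos_eq z, ← Complex.normSq_eq_norm_sq, sub_eq_add_neg, ← neg_mul]
  simp only [← Complex.ofReal_sin, ← Complex.ofReal_cos, ← Complex.ofReal_sinh,
    ← Complex.ofReal_cosh, ← Complex.ofReal_mul, ← Complex.ofReal_neg]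
  rw [Complex.normSq_add_mul_I]
  linear_combination Real.cos z.re ^ 2 * Real.cosh_sq z.im +
    Real.sinh z.im ^ 2 * Real.sin_sq_add_cos_sq z.re

theorem Complex.norm_cos_le (z : ℂ) : ‖Complex.cos z‖ ≤ 1 + ‖Complex.sin z‖ := by
  have h1 := Complex.norm_sin_sq z
  have h2 := Complex.norm_cos_sq z
  have h3 := Real.sin_sq_add_cos_sq z.re
  refine le_of_sq_le_sq ?_ (by positivity)
  nlinarith [norm_nonneg (Complex.sin z), sq_nonneg (Real.sin z.re)]

theorem Complex.abs_im_le_norm_sin (z : ℂ) : |z.im| ≤ ‖Complex.sin z‖ := by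
  have h1 := Complex.norm_sin_sq z
  have h2 : |z.im| ≤ |Real.sinh z.im| := by
    rw [Real.abs_sinh]
    exact Real.self_le_sinh_iff.2 (abs_nonneg _)
  refine h2.trans (abs_le_of_sq_le_sq' ?_ (norm_nonneg _) |> abs_le.2)
  nlinarith [sq_nonneg (Real.sin z.re)]

theorem Complex.abs_sin_re_le_norm_sin (z : ℂ) : |Real.sin z.re| ≤ ‖Complex.sin z‖ := by
  have h1 := Complex.norm_sin_sq z
  refine abs_le.2 (abs_le_of_sq_le_sq' ?_ (norm_nonneg _))
  nlinarith [sq_nonneg (Real.sinh z.im)]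

theorem Real.half_lt_cos {t : ℝ} (ht : |t| ≤ 1 / 2) : 1 / 2 < Real.cos t := by
  have h := Real.one_sub_sq_div_two_le_cos (x := t)
  have h2 : t ^ 2 ≤ (1 / 2) ^ 2 := sq_le_sq' (abs_le.1 ht).1 (abs_le.1 ht).2
  nlinarith

theorem Real.abs_sin_add_nat_mul_pi (x : ℝ) (n : ℕ) :
    |Real.sin (x + n * Real.pi)| = |Real.sin x| := by
  rw [Real.sin_add_nat_mul_pi, abs_mul, abs_pow, abs_neg, abs_one, one_pow, one_mul]

/-- If the sine were smaller, `|Im z|` would be below `1/2` and `|Re z|` within `1/2` of `(m + 1/2)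
π`, where the sine of the real part exceeds `1/2` in modulus. -/
theorem Complex.half_le_norm_sin {z : ℂ} {m : ℕ} (hz : ‖z‖ = (m + 1 / 2) * Real.pi) :
    1 / 2 ≤ ‖Complex.sin z‖ := by
  by_contra! h
  have hy := (Complex.abs_im_le_norm_sin z).trans_lt h
  have hx := (Complex.abs_sin_re_le_norm_sin z).trans_lt h
  have h1 : ‖z‖ ≤ |z.re| + |z.im| := Complex.norm_le_abs_re_add_abs_im z
  have h2 : |z.re| ≤ ‖z‖ := Complex.abs_re_le_norm z
  set t := (m + 1 / 2) * Real.pi - |z.re| with ht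
  have ht2 : |t| ≤ 1 / 2 := abs_le.2 ⟨by linarith, by linarith⟩
  have h3 : |Real.sin z.re| = |Real.cos t| := by
    have h4 : |Real.sin z.re| = |Real.sin (|z.re|)| := by
      rcases abs_choice z.re with h | h <;> rw [h]
      rw [Real.sin_neg, abs_neg]
    have h5 : |z.re| = Real.pi / 2 - t + m * Real.pi := by rw [ht]; ring
    rw [h4, h5, Real.abs_sin_add_nat_mul_pi, Real.sin_pi_div_two_sub]
  rw [h3] at hx
  linarith [Real.half_lt_cos ht2, le_abs_self (Real.cos t)]


theorem differentiable_robinCharFun (a : ℝ) (cp cm : ℂ) : Differentiable ℂ (robinCharFun a cp cm) :=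
  fun z => (hasDerivAt_robinCharFun a cp cm z).differentiableAt

variable {a : ℝ} {cp cm : ℂ}

theorem robinCharFun_zero_sq (a : ℝ) (l : ℂ) :
    robinCharFun a 0 0 (l ^ 2) = -(l * Complex.sin (l * (2 * a))) := by
  rw [robinCharFun, robinSol, robinSolDeriv, ← mul_sinSol_sq]
  ring

theorem robinCharFun_zero_waveNumber (ha : 0 < a) (n : ℕ) :
    robinCharFun a 0 0 ((waveNumber a n : ℂ) ^ 2) = 0 := by
  rw [robinCharFun_zero_sq]
  have : (waveNumber a n : ℂ) * (2 * a) = n * Real.pi := by exact_mod_cast waveNumber_mul ha n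
  rw [this, Complex.sin_nat_mul_pi, mul_zero, neg_zero]

theorem exists_waveNumber_of_robinCharFun_zero (ha : 0 < a) {z : ℂ}
    (hz : robinCharFun a 0 0 z = 0) : ∃ n : ℕ, z = (waveNumber a n : ℂ) ^ 2 := by
  obtain ⟨l, rfl⟩ : ∃ l : ℂ, l ^ 2 = z := IsAlgClosed.exists_pow_nat_eq z two_pos
  rw [robinCharFun_zero_sq, neg_eq_zero, mul_eq_zero] at hz
  rcases hz with rfl | hz
  · exact ⟨0, by simp [waveNumber_zero]⟩
  · obtain ⟨k, hk⟩ := Complex.sin_eq_zero_iff.1 hz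
    have ha' : (a : ℂ) ≠ 0 := by exact_mod_cast ha.ne'
    have hl : l = k * Real.pi / (2 * a) := by
      rw [← hk]
      field_simp
    refine ⟨k.natAbs, ?_⟩
    have h1 : ((k.natAbs : ℕ) : ℂ) ^ 2 = (k : ℂ) ^ 2 := by
      have := congrArg (Int.cast (R := ℂ)) (Int.natAbs_sq k)
      rwa [Int.cast_pow, Int.cast_pow, Int.cast_natCast] at this
    rw [hl, waveNumber]
    push_cast
    rw [div_pow, div_pow, mul_pow, mul_pow, mul_pow, h1]

/-- Away from `0` the chain rule through `z = l²` applies, and sine and cosine have no common zero.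
At `z = 0` the map `l ↦ l²` is degenerate, so the derivative is computed directly. -/
theorem deriv_robinCharFun_zero_ne_zero (ha : 0 < a) {z : ℂ} (hz : robinCharFun a 0 0 z = 0) :
    deriv (robinCharFun a 0 0) z ≠ 0 := by
  have ha' : (a : ℂ) ≠ 0 := by exact_mod_cast ha.ne'
  rcases eq_or_ne z 0 with rfl | hz0
  · rw [(hasDerivAt_robinCharFun a 0 0 0).deriv]
    have h1 := cosSqrtDeriv_ode 0
    have h2 := cosSol_zero 0
    rw [cosSol, zero_mul] at h2
    rw [h2] at h1
    simp only [robinSolParam, robinSolParamDeriv, zero_mul, mul_zero, add_zero]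
    intro h3
    have h4 : cosSqrtDeriv 1 0 = 0 := by simpa [ha'] using h3
    rw [h4] at h1
    simp at h1
  · obtain ⟨l, rfl⟩ : ∃ l : ℂ, l ^ 2 = z := IsAlgClosed.exists_pow_nat_eq z two_pos
    have hl : l ≠ 0 := fun h => hz0 (by simp [h])
    intro hd
    have h1 := (differentiable_robinCharFun a 0 0 (l ^ 2)).hasDerivAt
    rw [hd] at h1
    have h2 := h1.comp l (hasDerivAt_pow 2 l)
    have h3 : HasDerivAt (fun l : ℂ => -(l * Complex.sin (l * (2 * a))))
        (-(1 * Complex.sin (l * (2 * a)) + l * (Complex.cos (l * (2 * a)) * (1 * (2 * a))))) l :=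
      ((hasDerivAt_id l).mul ((hasDerivAt_id l).mul_const (2 * a : ℂ)).csin).neg
    have h4 : robinCharFun a 0 0 ∘ (fun l => l ^ 2) =
        fun l : ℂ => -(l * Complex.sin (l * (2 * a))) := by
      ext l
      exact robinCharFun_zero_sq a l
    rw [h4] at h2
    have h5 := h3.unique h2
    rw [robinCharFun_zero_sq, neg_eq_zero, mul_eq_zero] at hz
    have hs := hz.resolve_left hl
    have hc := Complex.sin_sq_add_cos_sq (l * (2 * a))
    rw [hs, zero_mul, mul_zero, zero_add, neg_eq_zero] at h5
    have hc0 : Complex.cos (l * (2 * a)) = 0 := by simpa [hl, ha'] using h5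
    rw [hs, hc0] at hc
    simp at hc

/-- The radii half way between consecutive Neumann wave numbers. -/
noncomputable def midRadius (a : ℝ) (m : ℕ) : ℝ := (m + 1 / 2) * Real.pi / (2 * a)

theorem midRadius_pos (ha : 0 < a) (m : ℕ) : 0 < midRadius a m := by
  unfold midRadius
  positivity

theorem tendsto_midRadius (ha : 0 < a) : Tendsto (midRadius a) atTop atTop := by
  have : midRadius a = fun m : ℕ => ((m : ℝ) + 1 / 2) * (Real.pi / (2 * a)) := by
    ext m
    rw [midRadius, mul_div_assoc]
  rw [this]
  exact (tendsto_atTop_add_const_right _ _ tendsto_natCast_atTop_atTop).atTop_mul_const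
    (by positivity)

theorem zeros_robinCharFun_zero (ha : 0 < a) (m : ℕ) :
    {z ∈ closedBall (0 : ℂ) (midRadius a m ^ 2) | robinCharFun a 0 0 z = 0} =
      (fun n : ℕ => (waveNumber a n : ℂ) ^ 2) '' Iio (m + 1) := by
  have key (n : ℕ) : (waveNumber a n : ℂ) ^ 2 ∈ closedBall (0 : ℂ) (midRadius a m ^ 2) ↔
      n ∈ Iio (m + 1) := by
    have h0 : 0 ≤ waveNumber a n := by unfold waveNumber; positivity
    rw [mem_closedBall_zero_iff, norm_pow, Complex.norm_real, Real.norm_of_nonneg h0,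
      pow_le_pow_iff_left₀ h0 (midRadius_pos ha m).le two_ne_zero, waveNumber, midRadius,
      div_le_div_iff_of_pos_right (by positivity), mul_le_mul_iff_left₀ Real.pi_pos, mem_Iio]
    constructor
    · intro h
      have : (n : ℝ) < m + 1 := by linarith
      exact_mod_cast this
    · intro h
      have : (n : ℝ) ≤ m := by exact_mod_cast Nat.lt_succ_iff.1 h
      linarith
  ext z
  constructor
  · rintro ⟨h1, h2⟩
    obtain ⟨n, rfl⟩ := exists_waveNumber_of_robinCharFun_zero ha h2
    exact ⟨n, (key n).1 h1, rfl⟩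
  · rintro ⟨n, hn, rfl⟩
    exact ⟨(key n).2 hn, robinCharFun_zero_waveNumber ha n⟩

theorem ncard_zeros_robinCharFun_zero (ha : 0 < a) (m : ℕ) :
    {z ∈ closedBall (0 : ℂ) (midRadius a m ^ 2) | robinCharFun a 0 0 z = 0}.ncard = m + 1 := by
  rw [zeros_robinCharFun_zero ha, ncard_image_of_injective, Set.ncard_Iio_nat]
  intro n n' h
  by_contra hne
  exact waveNumber_sq_sub_ne ha hne (sub_eq_zero.2 h)

/-- With `z = l²`, `|l| = r` and `S = |sin (2al)| ≥ 1/2`, the Neumann function has modulus `r S`,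
while the difference is at most `(|c₊c₋| / r + 3 |c₊ - c₋|) S`. The `3` comes from `|cos| ≤ 1 + S ≤
3 S`. -/
theorem norm_robinCharFun_sub_lt (ha : 0 < a) {m : ℕ} (hm1 : 1 ≤ midRadius a m)
    (hm : ‖cp * cm‖ + 3 * ‖cp - cm‖ < midRadius a m) {z : ℂ}
    (hz : z ∈ sphere (0 : ℂ) (midRadius a m ^ 2)) :
    ‖robinCharFun a cp cm z - robinCharFun a 0 0 z‖ < ‖robinCharFun a 0 0 z‖ := by
  obtain ⟨l, rfl⟩ : ∃ l : ℂ, l ^ 2 = z := IsAlgClosed.exists_pow_nat_eq z two_pos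
  set r := midRadius a m with hr
  have hr0 : 0 < r := midRadius_pos ha m
  have hl : ‖l‖ = r := by
    rw [mem_sphere_zero_iff_norm, norm_pow] at hz
    exact (pow_left_inj₀ (norm_nonneg _) hr0.le two_ne_zero).1 hz
  set S := ‖Complex.sin (l * (2 * a))‖ with hS
  have hS2 : 1 / 2 ≤ S := by
    refine Complex.half_le_norm_sin (m := m) ?_
    rw [norm_mul, hl, hr, midRadius]
    have : ‖(2 * a : ℂ)‖ = 2 * a := by
      rw [norm_mul, Complex.norm_real, Real.norm_of_nonneg ha.le]
      norm_num
    rw [this]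
    field_simp
  have hC : ‖Complex.cos (l * (2 * a))‖ ≤ 3 * S := by
    linarith [Complex.norm_cos_le (l * (2 * a))]
  have e1 : l * (robinCharFun a cp cm (l ^ 2) - robinCharFun a 0 0 (l ^ 2)) =
      -(cp * cm) * Complex.sin (l * (2 * a)) + (cp - cm) * l * Complex.cos (l * (2 * a)) := by
    rw [mul_sub, robinCharFun_sq, robinCharFun_sq]
    ring
  have e2 : ‖robinCharFun a 0 0 (l ^ 2)‖ = r * S := by
    rw [robinCharFun_zero_sq, norm_neg, norm_mul, hl]
  have e3 : r * ‖robinCharFun a cp cm (l ^ 2) - robinCharFun a 0 0 (l ^ 2)‖ ≤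
      ‖cp * cm‖ * S + ‖cp - cm‖ * r * (3 * S) := by
    rw [← hl, ← norm_mul, e1]
    refine (norm_add_le _ _).trans ?_
    rw [norm_mul, norm_neg, norm_mul (_ * l), norm_mul (cp - cm)]
    gcongr
  refine lt_of_mul_lt_mul_left (e3.trans_lt ?_) hr0.le
  rw [e2]
  have h5 : ‖cp * cm‖ + 3 * ‖cp - cm‖ * r < r * r := by
    have : ‖cp * cm‖ * 1 ≤ ‖cp * cm‖ * r := by gcongr
    nlinarith
  nlinarith

/-- An eventually monotone sequence is localized by its counting function. -/
theorem eventually_lt_of_ncard {x R : ℕ → ℝ} (hx : ∀ᶠ n in atTop, x n ≤ x (n + 1))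
    (hR : Tendsto R atTop atTop) (hcard : ∀ᶠ m in atTop, {n | x n ≤ R m}.ncard = m + 1) :
    ∀ᶠ m in atTop, R m < x (m + 1) ∧ x (m + 1) ≤ R (m + 1) := by
  obtain ⟨N, hN⟩ := eventually_atTop.1 hx
  have hmono {n m : ℕ} (hn : N ≤ n) (hnm : n ≤ m) : x n ≤ x m := by
    induction m, hnm using Nat.le_induction with
    | base => exact le_rfl
    | succ m hm ih => exact ih.trans (hN m (hn.trans hm))
  -- Monotonicity is only eventual; the finitely many earlier terms lie below `R m` once `m` is
  -- large, so the counted set is still an initial segment.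
  have hfirst : ∀ᶠ m in atTop, ∀ n ∈ Finset.range (N + 1), x n ≤ R m :=
    (Filter.eventually_all_finset _).2 fun n _ => hR.eventually_ge_atTop (x n)
  have key : ∀ᶠ m in atTop, ∀ n, x n ≤ R m ↔ n < m + 1 := by
    filter_upwards [hfirst, hcard] with m h1 h2
    -- `ncard` of an infinite set is `0`, so the count `m + 1` also gives finiteness.
    have hfin : {n | x n ≤ R m}.Finite := finite_of_ncard_ne_zero (by rw [h2]; exact m.succ_ne_zero)
    have hdown {n k : ℕ} (hn : x n ≤ R m) (hk : k ≤ n) : x k ≤ R m := by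
      rcases le_or_gt k N with h | h
      · exact h1 k (Finset.mem_range.2 (Nat.lt_succ_iff.2 h))
      · exact (hmono h.le hk).trans hn
    have hsub : {n | x n ≤ R m} ⊆ Iio (m + 1) := by
      intro n hn
      have h3 : Iio (n + 1) ⊆ {n | x n ≤ R m} := fun k hk => hdown hn (Nat.lt_succ_iff.1 hk)
      have h4 := ncard_le_ncard h3 hfin
      rw [Set.ncard_Iio_nat, h2] at h4
      exact h4
    have heq := eq_of_subset_of_ncard_le hsub (by rw [Set.ncard_Iio_nat, h2]) (finite_Iio _)
    intro n
    exact Set.ext_iff.1 heq n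
  filter_upwards [key, (tendsto_add_atTop_nat 1).eventually key] with m h1 h2
  exact ⟨not_le.1 fun h => lt_irrefl _ ((h1 _).1 h), (h2 _).2 (Nat.lt_succ_self _)⟩

/-- The characteristic equation reads `(l² + c₊c₋) sin = (c₊ - c₋) l cos`. The size conditions keep
the left factor above `|l|² / 2` and absorb the sine contained in `|cos| ≤ 1 + |sin|`. -/
theorem norm_sin_le_of_robinCharFun_eq_zero {l : ℂ} (h : robinCharFun a cp cm (l ^ 2) = 0)
    (h1 : 2 * ‖cp * cm‖ ≤ ‖l‖ ^ 2) (h2 : 4 * ‖cp - cm‖ ≤ ‖l‖) (h0 : 0 < ‖l‖) :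
    ‖Complex.sin (l * (2 * a))‖ ≤ 4 * ‖cp - cm‖ / ‖l‖ := by
  have e := robinCharFun_sq a cp cm l
  rw [h, mul_zero] at e
  set S := ‖Complex.sin (l * (2 * a))‖ with hS
  have e1 : ‖l ^ 2 + cp * cm‖ * S ≤ ‖cp - cm‖ * ‖l‖ * (1 + S) := by
    have : (l ^ 2 + cp * cm) * Complex.sin (l * (2 * a)) =
        (cp - cm) * l * Complex.cos (l * (2 * a)) := by linear_combination e
    rw [hS, ← norm_mul, this, norm_mul, norm_mul]
    gcongr
    exact Complex.norm_cos_le _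
  have e2 : ‖l‖ ^ 2 / 2 ≤ ‖l ^ 2 + cp * cm‖ := by
    have := norm_sub_le (l ^ 2 + cp * cm) (cp * cm)
    rw [add_sub_cancel_right, norm_pow] at this
    linarith
  have hS0 : 0 ≤ S := norm_nonneg _
  have e3 : ‖l‖ ^ 2 / 2 * S ≤ ‖cp - cm‖ * ‖l‖ * (1 + S) := (by gcongr : _ ≤ _).trans e1
  have e4 : ‖l‖ / 2 * S ≤ ‖cp - cm‖ * (1 + S) := by
    refine le_of_mul_le_mul_left ?_ h0
    nlinarith
  rw [le_div_iff₀ h0]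
  nlinarith

theorem norm_sub_nat_mul_pi_le {τ : ℂ} {n : ℕ} {s : ℝ} (hre : 0 ≤ τ.re)
    (h1 : (n - 1 / 2) * Real.pi ≤ ‖τ‖) (h2 : ‖τ‖ ≤ (n + 1 / 2) * Real.pi)
    (hs : ‖Complex.sin τ‖ ≤ s) (hs4 : s ≤ 1 / 4) : ‖τ - n * Real.pi‖ ≤ 3 * s := by
  have hy := (Complex.abs_im_le_norm_sin τ).trans hs
  have hx := (Complex.abs_sin_re_le_norm_sin τ).trans hs
  have h3 : ‖τ‖ ≤ |τ.re| + |τ.im| := Complex.norm_le_abs_re_add_abs_im τ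
  have h4 : |τ.re| ≤ ‖τ‖ := Complex.abs_re_le_norm τ
  rw [abs_of_nonneg hre] at h3 h4
  set t := τ.re - n * Real.pi with ht
  have h5 : |Real.sin t| ≤ s := by
    rw [← Real.abs_sin_add_nat_mul_pi t n, ht, sub_add_cancel]
    exact hx
  -- The lower bound on `‖τ‖` only gives `t ≥ -π/2 - |Im τ|`; in the small interval beyond `-π/2`
  -- the sine would exceed `1/2` in modulus.
  have h6 : |t| ≤ Real.pi / 2 := by
    rw [abs_le]
    refine ⟨?_, by linarith⟩
    by_contra! h7
    have h8 : |t + Real.pi / 2| ≤ 1 / 2 := abs_le.2 ⟨by linarith, by linarith⟩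
    have h9 := Real.half_lt_cos h8
    rw [Real.cos_add_pi_div_two] at h9
    linarith [neg_abs_le (Real.sin t)]
  have h7 := Real.mul_abs_le_abs_sin h6
  have h8 : |t| ≤ 2 * s := by
    have h9 : 2 / Real.pi * |t| ≤ s := h7.trans h5
    rw [div_mul_eq_mul_div, div_le_iff₀ Real.pi_pos] at h9
    have hs0 : 0 ≤ s := (abs_nonneg _).trans hy
    nlinarith [Real.pi_le_four]
  calc ‖τ - n * Real.pi‖ ≤ |(τ - n * Real.pi).re| + |(τ - n * Real.pi).im| :=
        Complex.norm_le_abs_re_add_abs_im _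
    _ = |t| + |τ.im| := by simp [ht]
    _ ≤ 3 * s := by linarith

/-- The square roots of the eigenvalues are asymptotic to the Neumann wave numbers. -/
theorem exists_sqrt_near_waveNumber (ha : 0 < a) {lam : ℕ → ℂ} (hinj : Function.Injective lam)
    (hord : ∀ᶠ n in atTop, ‖lam n‖ ≤ ‖lam (n + 1)‖)
    (hzero : ∀ z, robinCharFun a cp cm z = 0 ↔ ∃ n, lam n = z)
    (hsimple : ∀ z, robinCharFun a cp cm z = 0 → deriv (robinCharFun a cp cm) z ≠ 0) :
    ∃ C, ∀ᶠ n : ℕ in atTop, ∃ l : ℂ, l ^ 2 = lam n ∧ ‖l - waveNumber a n‖ ≤ C / n := by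
  have hcard : ∀ᶠ m in atTop, {n | ‖lam n‖ ≤ midRadius a m ^ 2}.ncard = m + 1 := by
    filter_upwards [(tendsto_midRadius ha).eventually_ge_atTop 1,
      (tendsto_midRadius ha).eventually_gt_atTop (‖cp * cm‖ + 3 * ‖cp - cm‖)] with m h1 h2
    have h3 := ncard_zeros_eq_of_norm_sub_lt (pow_pos (midRadius_pos ha m) 2)
      (differentiable_robinCharFun a cp cm) (differentiable_robinCharFun a 0 0)
      (fun z hz => norm_robinCharFun_sub_lt ha h1 h2 hz) hsimple
      (fun z hz => deriv_robinCharFun_zero_ne_zero ha hz)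
    rw [ncard_zeros_robinCharFun_zero ha] at h3
    rw [← h3, ← ncard_image_of_injective _ hinj]
    congr 1
    ext z
    constructor
    · rintro ⟨n, hn, rfl⟩
      exact ⟨mem_closedBall_zero_iff.2 hn, (hzero _).2 ⟨n, rfl⟩⟩
    · rintro ⟨h4, h5⟩
      obtain ⟨n, rfl⟩ := (hzero z).1 h5
      exact ⟨n, mem_closedBall_zero_iff.1 h4, rfl⟩
  have hloc := eventually_lt_of_ncard hord
    ((tendsto_pow_atTop two_ne_zero).comp (tendsto_midRadius ha)) hcard
  set K := ‖cp - cm‖ with hK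
  have hbig : ∀ c : ℝ, ∀ᶠ m : ℕ in atTop, c ≤ midRadius a m :=
    fun c => (tendsto_midRadius ha).eventually_ge_atTop c
  refine ⟨6 * K / a * (4 * a / Real.pi), ?_⟩
  -- Counting from zero, the annulus between `midRadius a m` and `midRadius a (m + 1)` belongs to
  -- index `m + 1`.
  rw [← map_add_atTop_eq_nat 1, eventually_map]
  filter_upwards [hloc, hbig (16 * K), hbig 1, hbig (2 * ‖cp * cm‖)] with m ⟨h1, h2⟩ h3 h4 h5
  -- Of the two square roots, the one in the right half plane is near the positive wave number.
  obtain ⟨l, hl, hre⟩ : ∃ l : ℂ, l ^ 2 = lam (m + 1) ∧ 0 ≤ l.re := by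
    obtain ⟨l, hl⟩ : ∃ l : ℂ, l ^ 2 = lam (m + 1) := IsAlgClosed.exists_pow_nat_eq _ two_pos
    rcases le_total 0 l.re with h | h
    · exact ⟨l, hl, h⟩
    · exact ⟨-l, by rw [neg_sq, hl], by simpa using h⟩
  refine ⟨l, hl, ?_⟩
  have hr0 := midRadius_pos ha m
  rw [Function.comp_apply, ← hl, norm_pow, pow_lt_pow_iff_left₀ hr0.le (norm_nonneg _) two_ne_zero]
    at h1
  rw [Function.comp_apply, ← hl, norm_pow,
    pow_le_pow_iff_left₀ (norm_nonneg _) (midRadius_pos ha _).le two_ne_zero] at h2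
  have hl0 : 0 < ‖l‖ := hr0.trans h1
  have hsin := norm_sin_le_of_robinCharFun_eq_zero (a := a) (cp := cp) (cm := cm) (l := l)
    (by rw [hl]; exact (hzero _).2 ⟨_, rfl⟩) (by nlinarith) (by linarith [norm_nonneg (cp - cm)]) hl0
  have h2a : ‖(2 * a : ℂ)‖ = 2 * a := by
    rw [norm_mul, Complex.norm_real, Real.norm_of_nonneg ha.le]
    norm_num
  have hnear := norm_sub_nat_mul_pi_le (τ := l * (2 * a)) (n := m + 1) (s := 4 * K / ‖l‖)
    (by
      have : (l * (2 * a)).re = l.re * (2 * a) := by simp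
      rw [this]
      positivity)
    (by
      rw [norm_mul, h2a]
      rw [midRadius, div_lt_iff₀ (by positivity)] at h1
      push_cast
      linarith)
    (by
      rw [norm_mul, h2a]
      rwa [midRadius, le_div_iff₀ (by positivity)] at h2)
    hsin (by
      rw [div_le_iff₀ hl0]
      linarith)
  have ha' : (a : ℂ) ≠ 0 := by exact_mod_cast ha.ne'
  have e1 : l * (2 * a) - ((m + 1 : ℕ) : ℂ) * Real.pi = (l - waveNumber a (m + 1)) * (2 * a) := by
    have : ((waveNumber a (m + 1) * (2 * a) : ℝ) : ℂ) = (((m + 1 : ℕ) * Real.pi : ℝ) : ℂ) :=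
      congrArg _ (waveNumber_mul ha (m + 1))
    rw [sub_mul]
    push_cast at this ⊢
    rw [this]
  rw [e1, norm_mul, h2a, ← le_div_iff₀ (by positivity)] at hnear
  refine hnear.trans ?_
  have h6 : Real.pi / (4 * a) * (m + 1 : ℕ) ≤ ‖l‖ := by
    refine le_trans ?_ h1.le
    rw [midRadius, div_mul_eq_mul_div, div_le_div_iff₀ (by positivity) (by positivity)]
    push_cast
    nlinarith [mul_pos Real.pi_pos ha, mul_nonneg (mul_pos Real.pi_pos ha).le (Nat.cast_nonneg (α := ℝ) m)]
  have hm0 : (0 : ℝ) < (m + 1 : ℕ) := by positivity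
  calc 3 * (4 * K / ‖l‖) / (2 * a) = 6 * K / a / ‖l‖ := by
        field_simp
        ring
    _ ≤ 6 * K / a / (Real.pi / (4 * a) * (m + 1 : ℕ)) := by
        gcongr
    _ = 6 * K / a * (4 * a / Real.pi) / (m + 1 : ℕ) := by
        field_simp

end Asymptotics

/-! ### Uniform expansions of the eigenfunctions around the Neumann modes. -/

noncomputable section Perturbation

open Asymptotics

theorem Complex.norm_cos_sub_one_le {z : ℂ} (hz : ‖z‖ ≤ 1) : ‖Complex.cos z - 1‖ ≤ ‖z‖ ^ 2 := by
  have h1 := Complex.norm_exp_sub_one_sub_id_le (x := z * Complex.I) (by simpa using hz)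
  have h2 := Complex.norm_exp_sub_one_sub_id_le (x := -z * Complex.I) (by simpa using hz)
  have e : Complex.cos z - 1 = ((Complex.exp (z * Complex.I) - 1 - z * Complex.I) +
      (Complex.exp (-z * Complex.I) - 1 - -z * Complex.I)) / 2 := by
    rw [Complex.cos]
    ring
  simp only [norm_mul, norm_neg, Complex.norm_I, mul_one] at h1 h2
  rw [e, norm_div, Complex.norm_two, div_le_iff₀ two_pos]
  exact (norm_add_le _ _).trans (by linarith)

theorem Complex.norm_sin_sub_self_le {z : ℂ} (hz : ‖z‖ ≤ 1) : ‖Complex.sin z - z‖ ≤ ‖z‖ ^ 2 := by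
  have h1 := Complex.norm_exp_sub_one_sub_id_le (x := z * Complex.I) (by simpa using hz)
  have h2 := Complex.norm_exp_sub_one_sub_id_le (x := -z * Complex.I) (by simpa using hz)
  have e : Complex.sin z - z = ((Complex.exp (-z * Complex.I) - 1 - -z * Complex.I) -
      (Complex.exp (z * Complex.I) - 1 - z * Complex.I)) * Complex.I / 2 := by
    rw [Complex.sin]
    linear_combination -z * Complex.I_sq
  simp only [norm_mul, norm_neg, Complex.norm_I, mul_one] at h1 h2
  rw [e, norm_div, Complex.norm_two, norm_mul, Complex.norm_I, mul_one, div_le_iff₀ two_pos]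
  exact (norm_sub_le _ _).trans (by linarith)

/-- Uniform convergence in `x ∈ [-a, a]` as `n → ∞`. -/
def uniformFilter (a : ℝ) : Filter (ℕ × ℝ) := atTop ×ˢ 𝓟 (Icc (-a) a)

variable {a : ℝ} {l : ℕ → ℂ} {C : ℝ}

theorem eventually_uniformFilter {p : ℕ × ℝ → Prop} :
    (∀ᶠ q in uniformFilter a, p q) ↔ ∀ᶠ n in atTop, ∀ x ∈ Icc (-a) a, p (n, x) :=
  eventually_prod_principal_iff

theorem isBigO_uniformFilter_of_seq {E F : Type*} [Norm E] [Norm F] {u : ℕ → E} {v : ℕ → F}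
    (h : u =O[atTop] v) :
    (fun q : ℕ × ℝ => u q.1) =O[uniformFilter a] fun q => v q.1 :=
  h.comp_tendsto tendsto_fst

theorem norm_waveNumber (ha : 0 < a) (n : ℕ) : ‖(waveNumber a n : ℂ)‖ = waveNumber a n := by
  rw [Complex.norm_real, Real.norm_of_nonneg]
  unfold waveNumber
  positivity

theorem isBigO_waveNumber (a : ℝ) :
    (fun n => (waveNumber a n : ℂ)) =O[atTop] fun n : ℕ => (n : ℝ) := by
  refine IsBigO.of_bound |Real.pi / (2 * a)| (Eventually.of_forall fun n => ?_)
  rw [Complex.norm_real, waveNumber, mul_div_assoc, norm_mul, mul_comm]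
  rfl

theorem isBigO_inv_one : (fun n : ℕ => (n : ℝ)⁻¹) =O[atTop] fun _ => (1 : ℝ) :=
  (tendsto_inv_atTop_zero.comp tendsto_natCast_atTop_atTop).isBigO_one ℝ

theorem isBigO_sub_waveNumber (hl : ∀ᶠ n : ℕ in atTop, ‖l n - waveNumber a n‖ ≤ C / n) :
    (fun n => conj (l n) - (waveNumber a n : ℂ)) =O[atTop] fun n : ℕ => (n : ℝ)⁻¹ := by
  refine IsBigO.of_bound C ?_
  filter_upwards [hl] with n hn
  rw [← Complex.conj_ofReal, ← map_sub, RCLike.norm_conj, Real.norm_of_nonneg (by positivity),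
    ← div_eq_mul_inv]
  exact hn

theorem eventually_one_le_norm (ha : 0 < a)
    (hl : ∀ᶠ n : ℕ in atTop, ‖l n - waveNumber a n‖ ≤ C / n) : ∀ᶠ n in atTop, 1 ≤ ‖l n‖ := by
  have h1 : Tendsto (fun n : ℕ => waveNumber a n) atTop atTop := by
    have : waveNumber a = fun n : ℕ => (n : ℝ) * (Real.pi / (2 * a)) := by
      ext n
      rw [waveNumber, mul_div_assoc]
    rw [this]
    exact tendsto_natCast_atTop_atTop.atTop_mul_const (by positivity)
  have h2 : Tendsto (fun n : ℕ => C / n) atTop (𝓝 0) := tendsto_const_div_atTop_nhds_zero_nat C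
  filter_upwards [hl, h1.eventually_ge_atTop 2, h2.eventually_le_const one_pos] with n h3 h4 h5
  have h6 : ‖(waveNumber a n : ℂ)‖ ≤ ‖l n‖ + ‖l n - waveNumber a n‖ := by
    rw [← norm_neg (l n - _)]
    simpa using norm_add_le (l n) (-(l n - waveNumber a n))
  rw [norm_waveNumber ha] at h6
  linarith

/-- The difference of squares factors as `O(1/n) · O(n)`. -/
theorem eventually_norm_sq_sub_le (hl : ∀ᶠ n : ℕ in atTop, ‖l n - waveNumber a n‖ ≤ C / n) :
    ∃ K, ∀ᶠ n in atTop, ‖conj (l n ^ 2) - (waveNumber a n : ℂ) ^ 2‖ ≤ K := by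
  have h1 := isBigO_sub_waveNumber hl
  have h2 : (fun n => conj (l n) + (waveNumber a n : ℂ)) =O[atTop] fun n : ℕ => (n : ℝ) := by
    have h3 : (fun n : ℕ => (n : ℝ)⁻¹) =O[atTop] fun n : ℕ => (n : ℝ) := by
      refine isBigO_inv_one.trans ((isBigO_const_left_iff_pos_le_norm one_ne_zero).2 ⟨1, one_pos, ?_⟩)
      filter_upwards [eventually_ge_atTop 1] with n hn
      rw [Real.norm_of_nonneg (by positivity)]
      exact_mod_cast hn
    have h4 := ((h1.trans h3).add ((isBigO_waveNumber a).const_mul_left 2))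
    refine h4.congr_left fun n => ?_
    ring
  obtain ⟨K, hK⟩ := (h1.mul h2).bound
  refine ⟨K, ?_⟩
  filter_upwards [hK, eventually_gt_atTop 0] with n hn hn0
  have : (n : ℝ) ≠ 0 := by exact_mod_cast hn0.ne'
  rw [inv_mul_cancel₀ this, norm_one, mul_one] at hn
  have e : conj (l n ^ 2) - (waveNumber a n : ℂ) ^ 2 =
      (conj (l n) - waveNumber a n) * (conj (l n) + waveNumber a n) := by
    rw [map_pow]
    ring
  rwa [e]

/-- The expansions of `cos (l y)` and `sin (l y)` around a real wave number. -/
theorem exists_trig_expansion (hl : ∀ᶠ n : ℕ in atTop, ‖l n - waveNumber a n‖ ≤ C / n) :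
    ∃ e₁ e₂ : ℕ × ℝ → ℂ,
      (e₁ =O[uniformFilter a] fun q => (q.1 : ℝ)⁻¹ ^ 2) ∧
      (e₂ =O[uniformFilter a] fun q => (q.1 : ℝ)⁻¹ ^ 2) ∧
      (∀ q : ℕ × ℝ, Complex.cos (conj (l q.1) * (q.2 + a)) =
        Real.cos (waveNumber a q.1 * (q.2 + a)) * (1 + e₁ q) -
          Real.sin (waveNumber a q.1 * (q.2 + a)) *
            ((conj (l q.1) - waveNumber a q.1) * (q.2 + a) + e₂ q)) ∧
      ∀ q : ℕ × ℝ, Complex.sin (conj (l q.1) * (q.2 + a)) =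
        Real.sin (waveNumber a q.1 * (q.2 + a)) * (1 + e₁ q) +
          Real.cos (waveNumber a q.1 * (q.2 + a)) *
            ((conj (l q.1) - waveNumber a q.1) * (q.2 + a) + e₂ q) := by
  let ζ : ℕ × ℝ → ℂ := fun q => (conj (l q.1) - waveNumber a q.1) * (q.2 + a)
  have hy : (fun q : ℕ × ℝ => ((q.2 : ℂ) + a)) =O[uniformFilter a] fun _ => (1 : ℝ) := by
    refine IsBigO.of_bound (2 * a) (eventually_uniformFilter.2 (Eventually.of_forall
      fun n x hx => ?_))
    rw [norm_one, mul_one, ← Complex.ofReal_add, Complex.norm_real,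
      Real.norm_of_nonneg (by linarith [hx.1])]
    linarith [hx.2]
  have hζ : ζ =O[uniformFilter a] fun q => (q.1 : ℝ)⁻¹ := by
    simpa using (isBigO_uniformFilter_of_seq (a := a) (isBigO_sub_waveNumber hl)).mul hy
  have hζ1 : ∀ᶠ q in uniformFilter a, ‖ζ q‖ ≤ 1 := by
    have h0 : Tendsto (fun q : ℕ × ℝ => (q.1 : ℝ)⁻¹) (uniformFilter a) (𝓝 0) :=
      (tendsto_inv_atTop_zero.comp tendsto_natCast_atTop_atTop).comp tendsto_fst
    have h1 := hζ.trans_tendsto h0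
    have h2 := h1.norm
    rw [norm_zero] at h2
    exact h2.eventually_le_const one_pos
  have hsum (q : ℕ × ℝ) : conj (l q.1) * (q.2 + a) =
      ((waveNumber a q.1 * (q.2 + a) : ℝ) : ℂ) + ζ q := by
    simp only [ζ]
    push_cast
    ring
  refine ⟨fun q => Complex.cos (ζ q) - 1, fun q => Complex.sin (ζ q) - ζ q, ?_, ?_, fun q => ?_,
    fun q => ?_⟩
  · refine IsBigO.trans (IsBigO.of_bound 1 ?_) (hζ.pow 2)
    filter_upwards [hζ1] with q hq
    rw [one_mul, norm_pow]
    exact Complex.norm_cos_sub_one_le hq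
  · refine IsBigO.trans (IsBigO.of_bound 1 ?_) (hζ.pow 2)
    filter_upwards [hζ1] with q hq
    rw [one_mul, norm_pow]
    exact Complex.norm_sin_sub_self_le hq
  · rw [hsum, Complex.cos_add, Complex.ofReal_cos, Complex.ofReal_sin]
    simp only [ζ]
    ring
  · rw [hsum, Complex.sin_add, Complex.ofReal_cos, Complex.ofReal_sin]
    simp only [ζ]
    ring

/-- The errors in replacing the functions `cos (l y)` and `sin (l y)` by their first order
expansions around a real wave number. -/
theorem isBigO_remainder (ha : 0 < a) (c : ℂ)
    (hl : ∀ᶠ n : ℕ in atTop, ‖l n - waveNumber a n‖ ≤ C / n) :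
    ((fun q : ℕ × ℝ => Complex.cos (conj (l q.1) * (q.2 + a)) -
        c / conj (l q.1) * Complex.sin (conj (l q.1) * (q.2 + a)) -
        Real.cos (waveNumber a q.1 * (q.2 + a))) =O[uniformFilter a] fun q => (q.1 : ℝ)⁻¹) ∧
    ((fun q : ℕ × ℝ => waveNumber a q.1 * (Complex.cos (conj (l q.1) * (q.2 + a)) -
        c / conj (l q.1) * Complex.sin (conj (l q.1) * (q.2 + a)) -
        Real.cos (waveNumber a q.1 * (q.2 + a))) +
        waveNumber a q.1 * (conj (l q.1) - waveNumber a q.1) * (q.2 + a) *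
          Real.sin (waveNumber a q.1 * (q.2 + a)) +
        c * Real.sin (waveNumber a q.1 * (q.2 + a))) =O[uniformFilter a] fun q => (q.1 : ℝ)⁻¹) ∧
    ((fun q : ℕ × ℝ => -(conj (l q.1) * Complex.sin (conj (l q.1) * (q.2 + a))) -
        c * Complex.cos (conj (l q.1) * (q.2 + a)) +
        waveNumber a q.1 * Real.sin (waveNumber a q.1 * (q.2 + a)) +
        waveNumber a q.1 * (conj (l q.1) - waveNumber a q.1) * (q.2 + a) *
          Real.cos (waveNumber a q.1 * (q.2 + a)) +
        c * Real.cos (waveNumber a q.1 * (q.2 + a))) =O[uniformFilter a] fun q => (q.1 : ℝ)⁻¹) := by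
  obtain ⟨e₁, e₂, he₁, he₂, hcos, hsin⟩ := exists_trig_expansion hl
  set S : ℕ × ℝ → ℂ := fun q => Real.sin (waveNumber a q.1 * (q.2 + a)) with hS
  set D : ℕ × ℝ → ℂ := fun q => Real.cos (waveNumber a q.1 * (q.2 + a)) with hD
  set θ : ℕ × ℝ → ℂ := fun q => conj (l q.1) with hθ
  set k : ℕ × ℝ → ℂ := fun q => waveNumber a q.1 with hk
  set y : ℕ × ℝ → ℂ := fun q => (q.2 : ℂ) + a with hyd
  set ι : ℕ × ℝ → ℝ := fun q => (q.1 : ℝ)⁻¹ with hι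
  have bS : S =O[uniformFilter a] fun _ => (1 : ℝ) :=
    IsBigO.of_bound 1 (Eventually.of_forall fun q => by
      rw [norm_one, mul_one, hS, Complex.norm_real]
      exact Real.abs_sin_le_one _)
  have bD : D =O[uniformFilter a] fun _ => (1 : ℝ) :=
    IsBigO.of_bound 1 (Eventually.of_forall fun q => by
      rw [norm_one, mul_one, hD, Complex.norm_real]
      exact Real.abs_cos_le_one _)
  have by' : y =O[uniformFilter a] fun _ => (1 : ℝ) := by
    refine IsBigO.of_bound (2 * a) (eventually_uniformFilter.2 (Eventually.of_forall
      fun n x hx => ?_))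
    simp only [hyd]
    rw [norm_one, mul_one, ← Complex.ofReal_add, Complex.norm_real,
      Real.norm_of_nonneg (by linarith [hx.1])]
    linarith [hx.2]
  have bι : ι =O[uniformFilter a] fun _ => (1 : ℝ) := isBigO_uniformFilter_of_seq isBigO_inv_one
  have bε : (fun q => θ q - k q) =O[uniformFilter a] ι :=
    isBigO_uniformFilter_of_seq (isBigO_sub_waveNumber hl)
  have bk : k =O[uniformFilter a] fun q => (q.1 : ℝ) :=
    isBigO_uniformFilter_of_seq (isBigO_waveNumber a)
  have hι2 : (fun q => ι q ^ 2) =O[uniformFilter a] ι := by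
    simpa [sq] using bι.mul (isBigO_refl ι _)
  have small {u : ℕ × ℝ → ℂ} (hu : u =O[uniformFilter a] fun q => ι q ^ 2) :
      (fun q => k q * u q) =O[uniformFilter a] ι := by
    refine (bk.mul hu).trans (IsBigO.of_bound 1 (Eventually.of_forall fun q => ?_))
    simp only [hι]
    rcases eq_or_ne (q.1 : ℝ) 0 with h | h
    · simp [h]
    · rw [sq, mul_inv_cancel_left₀ h, one_mul]
  have mulD {u : ℕ × ℝ → ℂ} {v : ℕ × ℝ → ℝ} (hu : u =O[uniformFilter a] v) :
      (fun q => D q * u q) =O[uniformFilter a] v := by simpa using bD.mul hu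
  have mulS {u : ℕ × ℝ → ℂ} {v : ℕ × ℝ → ℝ} (hu : u =O[uniformFilter a] v) :
      (fun q => S q * u q) =O[uniformFilter a] v := by simpa using bS.mul hu
  have bζ : (fun q => (θ q - k q) * y q + e₂ q) =O[uniformFilter a] ι := by
    have : (fun q => (θ q - k q) * y q) =O[uniformFilter a] ι := by simpa using bε.mul by'
    exact this.add (he₂.trans hι2)
  have dcos : (fun q => Complex.cos (θ q * y q) - D q) =O[uniformFilter a] ι := by
    refine ((mulD (he₁.trans hι2)).sub (mulS bζ)).congr_left fun q => ?_
    rw [hcos q]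
    simp only [hS, hD, hθ, hk, hyd]
    ring
  have dsin : (fun q => Complex.sin (θ q * y q) - S q) =O[uniformFilter a] ι := by
    refine ((mulS (he₁.trans hι2)).add (mulD bζ)).congr_left fun q => ?_
    rw [hsin q]
    simp only [hS, hD, hθ, hk, hyd]
    ring
  have bsin : (fun q => Complex.sin (θ q * y q)) =O[uniformFilter a] fun _ => (1 : ℝ) := by
    simpa using (dsin.trans bι).add bS
  have hne : ∀ᶠ q in uniformFilter a, 1 ≤ ‖θ q‖ :=
    eventually_uniformFilter.2 ((eventually_one_le_norm ha hl).mono fun n hn x _ => by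
      rwa [hθ, RCLike.norm_conj])
  have bθ : (fun q => (θ q)⁻¹) =O[uniformFilter a] fun _ => (1 : ℝ) := by
    refine IsBigO.of_bound 1 (hne.mono fun q hq => ?_)
    rw [norm_inv, norm_one, mul_one]
    exact inv_le_one_of_one_le₀ hq
  -- `1/θ = (1/k)(k/θ)`, where `k/θ = 1 - (θ - k)/θ` is bounded.
  have bθι : (fun q => (θ q)⁻¹) =O[uniformFilter a] ι := by
    have h1 : (fun q => k q * (θ q)⁻¹) =O[uniformFilter a] fun _ => (1 : ℝ) := by
      have h2 := (isBigO_const_const (1 : ℂ) (one_ne_zero (α := ℝ)) (uniformFilter a)).sub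
        (((bε.trans bι).mul bθ).congr_right fun _ => one_mul _)
      refine h2.congr' ?_ (EventuallyEq.refl _ _)
      filter_upwards [hne] with q hq
      have : θ q ≠ 0 := norm_pos_iff.1 (one_pos.trans_le hq)
      field_simp
      ring
    have h3 : (fun q => (k q)⁻¹) =O[uniformFilter a] ι := by
      refine isBigO_uniformFilter_of_seq (u := fun n => (waveNumber a n : ℂ)⁻¹)
        (v := fun n => (n : ℝ)⁻¹) ?_
      refine IsBigO.of_bound (2 * a / Real.pi) (Eventually.of_forall fun n => ?_)
      rw [norm_inv, norm_waveNumber ha, waveNumber, Real.norm_of_nonneg (by positivity)]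
      apply le_of_eq
      rw [inv_div, mul_comm (n : ℝ), div_mul_eq_div_div, div_eq_mul_inv _ (n : ℝ)]
    refine (h3.mul h1).congr' ?_ (EventuallyEq.of_eq (by simp))
    have hk0 : ∀ᶠ q in uniformFilter a, k q ≠ 0 :=
      eventually_uniformFilter.2 ((eventually_gt_atTop 0).mono fun n hn x _ => by
        simp only [hk]
        exact_mod_cast (waveNumber_pos ha hn.ne').ne')
    filter_upwards [hk0] with q hq
    rw [inv_mul_cancel_left₀ hq]
  -- The last two expansions subtract terms that are merely bounded: a bounded coefficient times a
  -- sine or cosine, possibly times `x + a`. These are Bessel families although they are not square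
  -- summable.
  refine ⟨?_, ?_, ?_⟩
  · have h1 : (fun q => c * ((θ q)⁻¹ * Complex.sin (θ q * y q))) =O[uniformFilter a] ι := by
      simpa using (bθι.mul bsin).const_mul_left c
    refine (dcos.sub h1).congr_left fun q => ?_
    simp only [hθ, hyd, hD]
    ring
  · have h1 := (small (mulD he₁)).sub (small (mulS he₂))
    have h2 : (fun q => (θ q - k q) * ((θ q)⁻¹ * Complex.sin (θ q * y q))) =O[uniformFilter a] ι := by
      simpa using bε.mul (bθ.mul bsin)
    refine ((h1.sub (dsin.const_mul_left c)).add (h2.const_mul_left c)).congr' ?_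
      (EventuallyEq.refl _ _)
    filter_upwards [hne] with q hq
    have hq0 : θ q ≠ 0 := norm_pos_iff.1 (one_pos.trans_le hq)
    have e1 := hcos q
    change Complex.cos (θ q * y q) = D q * (1 + e₁ q) - S q * ((θ q - k q) * y q + e₂ q) at e1
    change _ = k q * (Complex.cos (θ q * y q) - c / θ q * Complex.sin (θ q * y q) - D q) +
      k q * (θ q - k q) * y q * S q + c * S q
    rw [e1]
    field_simp
    ring
  · have h1 := (small (mulS he₁)).add (small (mulD he₂))
    have h2 : (fun q => (θ q - k q) * Complex.sin (θ q * y q)) =O[uniformFilter a] ι := by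
      simpa using bε.mul bsin
    refine ((h2.add h1).add (dcos.const_mul_left c)).neg_left.congr_left fun q => ?_
    have e1 := hsin q
    change Complex.sin (θ q * y q) = S q * (1 + e₁ q) + D q * ((θ q - k q) * y q + e₂ q) at e1
    change _ = -(θ q * Complex.sin (θ q * y q)) - c * Complex.cos (θ q * y q) + k q * S q +
      k q * (θ q - k q) * y q * D q + c * D q
    rw [e1]
    ring

end Perturbation

/-! ### Bessel families formed from the adjoint eigenfunctions. -/

noncomputable section BesselFamilies

open Asymptotics

variable {a : ℝ} {l : ℕ → ℂ} {C : ℝ}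

/-- The derivative of `robinMapConj`. -/
def robinMapConjDeriv (a : ℝ) (c z : ℂ) : C(ℝ, ℂ) :=
  ⟨fun x => conj (robinMapDeriv a c z x), by fun_prop⟩

theorem HasDerivAt.conj_real {f : ℝ → ℂ} {f' : ℂ} {x : ℝ} (h : HasDerivAt f f' x) :
    HasDerivAt (fun x => conj (f x)) (conj f') x :=
  Complex.conjCLE.toContinuousLinearMap.hasFDerivAt.comp_hasDerivAt x h

theorem hasDerivAt_robinMapConj (c z : ℂ) (x : ℝ) :
    HasDerivAt (robinMapConj a c z) (robinMapConjDeriv a c z x) x :=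
  (hasDerivAt_robinMap c z x).conj_real

theorem hasDerivAt_robinMapConjDeriv (c z : ℂ) (x : ℝ) :
    HasDerivAt (robinMapConjDeriv a c z) (-(conj z * robinMapConj a c z x)) x := by
  have := (hasDerivAt_robinMapDeriv (a := a) c z x).conj_real
  rwa [map_neg, map_mul] at this

theorem contDiff_robinMapConjDeriv (a : ℝ) (c z : ℂ) : ContDiff ℝ ∞ (robinMapConjDeriv a c z) := by
  have h1 : Differentiable ℂ (robinSolDeriv c z) := fun y =>
    (hasDerivAt_robinSolDeriv c z y).differentiableAt
  have h2 : ContDiff ℝ ∞ (robinSolDeriv c z) := (h1.contDiff (n := ∞)).restrict_scalars ℝ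
  have h3 : ContDiff ℝ ∞ fun x : ℝ => (x : ℂ) + a := Complex.ofRealCLM.contDiff.add contDiff_const
  exact Complex.conjCLE.toContinuousLinearMap.contDiff.comp (h2.comp h3)

theorem robinMapConj_apply (a : ℝ) (c : ℂ) {l : ℂ} (hl : l ≠ 0) (x : ℝ) :
    robinMapConj a c (l ^ 2) x = Complex.cos (conj l * (x + a)) -
      conj c / conj l * Complex.sin (conj l * (x + a)) := by
  have h : sinSol (l ^ 2) (x + a) = Complex.sin (l * (x + a)) / l := by
    rw [← mul_sinSol_sq, mul_div_cancel_left₀ _ hl]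
  simp only [robinMapConj, robinMap, ContinuousMap.coe_mk, robinSol, cosSol_sq, h, map_sub, map_mul,
    map_div₀, ← Complex.cos_conj, ← Complex.sin_conj, map_add, Complex.conj_ofReal]
  ring

theorem robinMapConjDeriv_apply (a : ℝ) (c l : ℂ) (x : ℝ) :
    robinMapConjDeriv a c (l ^ 2) x = -(conj l * Complex.sin (conj l * (x + a))) -
      conj c * Complex.cos (conj l * (x + a)) := by
  have h : robinSolDeriv c (l ^ 2) (x + a) =
      -(l * Complex.sin (l * (x + a))) - c * Complex.cos (l * (x + a)) := by
    rw [robinSolDeriv, cosSol_sq, ← mul_sinSol_sq]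
    ring
  simp only [robinMapConjDeriv, robinMapDeriv, ContinuousMap.coe_mk, h,
    map_sub, map_mul, map_neg, ← Complex.cos_conj, ← Complex.sin_conj, map_add,
    Complex.conj_ofReal]

theorem eventually_norm_toL2_le (ha : 0 < a) {R : ℕ → C(ℝ, ℂ)}
    (h : (fun q : ℕ × ℝ => R q.1 q.2) =O[uniformFilter a] fun q => (q.1 : ℝ)⁻¹) :
    ∃ K, ∀ᶠ n : ℕ in atTop, ‖toL2 a (R n)‖ ≤ K / n := by
  obtain ⟨K, hK⟩ := h.bound
  refine ⟨√(2 * a) * K, ?_⟩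
  filter_upwards [eventually_uniformFilter.1 hK] with n hn
  rw [mul_div_assoc]
  refine norm_toL2_le ha fun x hx => (hn x (Ioo_subset_Icc_self hx)).trans (le_of_eq ?_)
  rw [Real.norm_of_nonneg (by positivity), div_eq_mul_inv]

theorem isBessel_toL2_of_isBigO (ha : 0 < a) {R : ℕ → C(ℝ, ℂ)}
    (h : (fun q : ℕ × ℝ => R q.1 q.2) =O[uniformFilter a] fun q => (q.1 : ℝ)⁻¹) :
    IsBessel (neumannBasis ha) fun n => toL2 a (R n) := by
  obtain ⟨K, hK⟩ := eventually_norm_toL2_le ha h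
  exact IsBessel.of_le_div hK

theorem IsBessel.smul_eventually {E : Type*} [NormedAddCommGroup E] [InnerProductSpace ℂ E]
    [CompleteSpace E] {χ : HilbertBasis ℕ ℂ E} {v : ℕ → E} (hv : IsBessel χ v) {b : ℕ → ℂ} {C : ℝ}
    (hb : ∀ᶠ n in atTop, ‖b n‖ ≤ C) : IsBessel χ fun n => b n • v n := by
  classical
  refine IsBessel.congr_eventually
    (hv.smul (b := fun n => if ‖b n‖ ≤ |C| then b n else 0) (C := |C|) fun n => ?_) ?_
  · split_ifs with h
    · exact h
    · simp
  · filter_upwards [hb] with n hn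
    rw [if_pos (hn.trans (le_abs_self C))]

/-- The function `x ↦ x + a`. -/
def shiftMap (a : ℝ) : C(ℝ, ℂ) := ⟨fun x => x + a, by fun_prop⟩

/-- The coefficient of the first order terms is `O(n) · O(1/n)`. -/
theorem isBessel_waveNumber_error (hl : ∀ᶠ n : ℕ in atTop, ‖l n - waveNumber a n‖ ≤ C / n) :
    ∃ K, ∀ᶠ n in atTop, ‖(waveNumber a n : ℂ) * (conj (l n) - waveNumber a n)‖ ≤ K := by
  obtain ⟨K, hK⟩ := ((isBigO_waveNumber a).mul (isBigO_sub_waveNumber hl)).bound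
  refine ⟨K, ?_⟩
  filter_upwards [hK, eventually_gt_atTop 0] with n hn hn0
  have : (n : ℝ) ≠ 0 := by exact_mod_cast hn0.ne'
  rwa [mul_inv_cancel₀ this, norm_one, mul_one] at hn

/-- The normalized eigenfunction of the adjoint operator. -/
def adjointMap (a : ℝ) (c z : ℂ) : C(ℝ, ℂ) := (1 / (√a : ℂ)) • robinMapConj a c z

/-- The derivative of `adjointMap`. -/
def adjointMapDeriv (a : ℝ) (c z : ℂ) : C(ℝ, ℂ) := (1 / (√a : ℂ)) • robinMapConjDeriv a c z

theorem isBessel_neumannMode (ha : 0 < a) : IsBessel (neumannBasis ha) (neumannMode a) :=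
  ⟨ContinuousLinearMap.id ℂ (L2 a), neumannBasis_apply ha⟩

theorem eventually_ne_zero_of_near (ha : 0 < a)
    (hl : ∀ᶠ n : ℕ in atTop, ‖l n - waveNumber a n‖ ≤ C / n) : ∀ᶠ n in atTop, l n ≠ 0 := by
  filter_upwards [eventually_one_le_norm ha hl] with n hn h0
  rw [h0, norm_zero] at hn
  exact absurd hn (not_le.2 one_pos)

theorem adjointMap_sub_isBigO (ha : 0 < a) (c : ℂ)
    (hl : ∀ᶠ n : ℕ in atTop, ‖l n - waveNumber a n‖ ≤ C / n) :
    (fun q : ℕ × ℝ => (adjointMap a c (l q.1 ^ 2) - neumannMap a q.1) q.2) =O[uniformFilter a]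
      fun q => (q.1 : ℝ)⁻¹ := by
  have h1 := (isBigO_remainder ha (conj c) hl).1.const_mul_left (1 / (√a : ℂ))
  refine h1.congr' (eventually_uniformFilter.2 ?_) (EventuallyEq.refl _ _)
  filter_upwards [eventually_ne_zero_of_near ha hl, eventually_ne_atTop 0] with n hn hn0 x _
  simp only [adjointMap, ContinuousMap.sub_apply, ContinuousMap.smul_apply,
    robinMapConj_apply a c hn, neumannMap, ofRealMap, ContinuousMap.coe_mk,
    neumannFun_of_ne_zero hn0, smul_eq_mul]
  push_cast
  ring

/-- To first order the family is `-kₙ (conj lₙ - kₙ) (x + a) sₙ - conj c sₙ`. It is Bessel because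
the `sₙ` are orthogonal and bounded, multiplication by `x + a` is a bounded operator, and the
coefficients are bounded; the remainder `R` is `O(1/n)`. -/
theorem isBessel_waveNumber_smul_adjointMap_sub (ha : 0 < a) (c : ℂ)
    (hl : ∀ᶠ n : ℕ in atTop, ‖l n - waveNumber a n‖ ≤ C / n) :
    IsBessel (neumannBasis ha) fun n =>
      (waveNumber a n : ℂ) • (toL2 a (adjointMap a c (l n ^ 2)) - neumannMode a n) := by
  obtain ⟨A, hA⟩ := exists_mulOp ha (shiftMap a)
  obtain ⟨K, hK⟩ := isBessel_waveNumber_error hl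
  let R : ℕ → C(ℝ, ℂ) := fun n => (waveNumber a n : ℂ) • (adjointMap a c (l n ^ 2) - neumannMap a n) +
    ((waveNumber a n : ℂ) * (conj (l n) - waveNumber a n)) • (shiftMap a * sineMap a n) +
    conj c • sineMap a n
  have hR : IsBessel (neumannBasis ha) fun n => toL2 a (R n) := by
    refine isBessel_toL2_of_isBigO ha ?_
    have h1 := (isBigO_remainder ha (conj c) hl).2.1.const_mul_left (1 / (√a : ℂ))
    refine h1.congr' (eventually_uniformFilter.2 ?_) (EventuallyEq.refl _ _)
    filter_upwards [eventually_ne_zero_of_near ha hl, eventually_ne_atTop 0] with n hn hn0 x _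
    simp only [R, adjointMap, ContinuousMap.add_apply, ContinuousMap.sub_apply,
      ContinuousMap.smul_apply, ContinuousMap.mul_apply, robinMapConj_apply a c hn, neumannMap,
      sineMap, shiftMap, ofRealMap, ContinuousMap.coe_mk, neumannFun_of_ne_zero hn0, smul_eq_mul]
    push_cast
    ring
  have h2 := ((isBessel_sineMode ha).map A).smul_eventually hK
  have h3 := (isBessel_sineMode ha).smul (b := fun _ => conj c) (fun _ => le_rfl)
  refine Eq.subst (motive := IsBessel (neumannBasis ha)) (funext fun n => ?_) ((hR.sub h2).sub h3)
  simp only [R, toL2_add, toL2_sub, toL2_smul, sineMode, hA, neumannMode_eq]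
  abel

theorem isBessel_adjointMapDeriv_add (ha : 0 < a) (c : ℂ)
    (hl : ∀ᶠ n : ℕ in atTop, ‖l n - waveNumber a n‖ ≤ C / n) :
    IsBessel (neumannBasis ha) fun n =>
      toL2 a (adjointMapDeriv a c (l n ^ 2)) + (waveNumber a n : ℂ) • sineMode a n := by
  obtain ⟨A, hA⟩ := exists_mulOp ha (shiftMap a)
  obtain ⟨K, hK⟩ := isBessel_waveNumber_error hl
  let R : ℕ → C(ℝ, ℂ) := fun n => adjointMapDeriv a c (l n ^ 2) + (waveNumber a n : ℂ) • sineMap a n +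
    ((waveNumber a n : ℂ) * (conj (l n) - waveNumber a n)) • (shiftMap a * neumannMap a n) +
    conj c • neumannMap a n
  have hR : IsBessel (neumannBasis ha) fun n => toL2 a (R n) := by
    refine isBessel_toL2_of_isBigO ha ?_
    have h1 := (isBigO_remainder ha (conj c) hl).2.2.const_mul_left (1 / (√a : ℂ))
    refine h1.congr' (eventually_uniformFilter.2 ?_) (EventuallyEq.refl _ _)
    filter_upwards [eventually_ne_atTop 0] with n hn0 x _
    simp only [R, adjointMapDeriv, ContinuousMap.add_apply,
      ContinuousMap.smul_apply, ContinuousMap.mul_apply, robinMapConjDeriv_apply, neumannMap,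
      sineMap, shiftMap, ofRealMap, ContinuousMap.coe_mk, neumannFun_of_ne_zero hn0, smul_eq_mul]
    push_cast
    ring
  have hχ := isBessel_neumannMode ha
  have h2 := (hχ.map A).smul_eventually hK
  have h3 := hχ.smul (b := fun _ => conj c) (fun _ => le_rfl)
  refine Eq.subst (motive := IsBessel (neumannBasis ha)) (funext fun n => ?_) ((hR.sub h2).sub h3)
  simp only [R, toL2_add, toL2_smul, sineMode, hA, neumannMode_eq]
  abel

end BesselFamilies

/-! ### Operators that gain one derivative. -/

noncomputable section Smoothing

variable {a : ℝ}

/-- `K` is bounded from `L²(-a, a)` to `W^{1,2}(-a, a)` and from `W^{1,2}(-a, a)` to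
`W^{2,2}(-a, a)`. -/
structure IsSmoothing (a : ℝ) (K : L2 a →L[ℂ] L2 a) : Prop where
  exists_deriv : ∃ D : L2 a →L[ℂ] L2 a, ∀ f, HasWeakDeriv a (K f) (D f)
  exists_second_deriv : ∃ C, ∀ f f' : L2 a, HasWeakDeriv a f f' →
    ∃ g g' : L2 a, HasWeakDeriv a (K f) g ∧ HasWeakDeriv a g g' ∧ ‖g'‖ ≤ C * (‖f‖ + ‖f'‖)

theorem norm_add_sq_le {E : Type*} [SeminormedAddCommGroup E] (x y : E) :
    ‖x + y‖ ^ 2 ≤ 2 * ‖x‖ ^ 2 + 2 * ‖y‖ ^ 2 := by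
  have := norm_add_le x y
  nlinarith [norm_nonneg (x + y), sq_nonneg (‖x‖ - ‖y‖)]

theorem sq_norm_clm_le {E F : Type*} [NormedAddCommGroup E] [NormedSpace ℂ E]
    [NormedAddCommGroup F] [NormedSpace ℂ F] (T : E →L[ℂ] F) (x : E) :
    ‖T x‖ ^ 2 ≤ ‖T‖ ^ 2 * ‖x‖ ^ 2 := by
  rw [← mul_pow]
  gcongr
  exact T.le_opNorm x

variable {K B : L2 a →L[ℂ] L2 a}

/-- Only boundedness of `B` on `L²` enters, so `B` may be an inverse not yet known to preserve
Sobolev spaces. -/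
theorem IsSmoothing.boundedOnW12 (hK : IsSmoothing a K) (B : L2 a →L[ℂ] L2 a) :
    BoundedOnW12 a (ContinuousLinearMap.id ℂ (L2 a) + K ∘L B) := by
  obtain ⟨D, hD⟩ := hK.exists_deriv
  refine ⟨2 + 2 * ‖K ∘L B‖ ^ 2 + 2 * ‖D ∘L B‖ ^ 2, fun f f' hf => ⟨f' + D (B f),
    hf.add (hD (B f)), ?_⟩⟩
  have h1 := norm_add_sq_le f ((K ∘L B) f)
  have h2 := norm_add_sq_le f' ((D ∘L B) f)
  have h3 := sq_norm_clm_le (K ∘L B) f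
  have h4 := sq_norm_clm_le (D ∘L B) f
  have h5 : 0 ≤ (‖K ∘L B‖ ^ 2 + ‖D ∘L B‖ ^ 2) * ‖f'‖ ^ 2 := by positivity
  change ‖f + (K ∘L B) f‖ ^ 2 + ‖f' + (D ∘L B) f‖ ^ 2 ≤ _
  nlinarith

theorem IsSmoothing.boundedOnW22 (hK : IsSmoothing a K) (hB : BoundedOnW12 a B) :
    BoundedOnW22 a (ContinuousLinearMap.id ℂ (L2 a) + K ∘L B) := by
  obtain ⟨D, hD⟩ := hK.exists_deriv
  obtain ⟨C, hC⟩ := hK.exists_second_deriv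
  obtain ⟨C', hC'⟩ := hB
  refine ⟨2 + 2 * ‖K ∘L B‖ ^ 2 + 2 * ‖D ∘L B‖ ^ 2 + 4 * C ^ 2 * |C'|, fun f f' f'' hf hf' => ?_⟩
  obtain ⟨u, hu, hu2⟩ := hC' f f' hf
  obtain ⟨g, g', hg, hg', hb⟩ := hC (B f) u hu
  obtain rfl : g = D (B f) := hg.unique (hD _)
  refine ⟨f' + D (B f), f'' + g', hf.add (hD (B f)), hf'.add hg', ?_⟩
  have h1 := norm_add_sq_le f ((K ∘L B) f)
  have h2 := norm_add_sq_le f' ((D ∘L B) f)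
  have h3 := sq_norm_clm_le (K ∘L B) f
  have h4 := sq_norm_clm_le (D ∘L B) f
  have h5 := norm_add_sq_le f'' g'
  have h6 : ‖g'‖ ^ 2 ≤ C ^ 2 * (‖B f‖ + ‖u‖) ^ 2 := by
    rw [← mul_pow]
    exact pow_le_pow_left₀ (norm_nonneg _) hb 2
  have h7 : (‖B f‖ + ‖u‖) ^ 2 ≤ 2 * (|C'| * (‖f‖ ^ 2 + ‖f'‖ ^ 2)) := by
    have h8 : C' * (‖f‖ ^ 2 + ‖f'‖ ^ 2) ≤ |C'| * (‖f‖ ^ 2 + ‖f'‖ ^ 2) := by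
      gcongr
      exact le_abs_self C'
    nlinarith [sq_nonneg (‖B f‖ - ‖u‖)]
  have h9 : ‖g'‖ ^ 2 ≤ C ^ 2 * (2 * (|C'| * (‖f‖ ^ 2 + ‖f'‖ ^ 2))) := by
    refine h6.trans ?_
    gcongr
  have p1 : 0 ≤ (‖K ∘L B‖ ^ 2 + ‖D ∘L B‖ ^ 2) * (‖f'‖ ^ 2 + ‖f''‖ ^ 2) := by positivity
  have p2 : 0 ≤ C ^ 2 * |C'| * ‖f''‖ ^ 2 := by positivity
  change ‖f + (K ∘L B) f‖ ^ 2 + ‖f' + (D ∘L B) f‖ ^ 2 + _ ≤ _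
  nlinarith [sq_nonneg ‖f‖, sq_nonneg ‖f'‖, sq_nonneg ‖f''‖]

theorem boundedOnW12_id : BoundedOnW12 a (ContinuousLinearMap.id ℂ (L2 a)) :=
  ⟨1, fun f f' hf => ⟨f', hf, by simp⟩⟩

theorem BoundedOnW12.neg (hB : BoundedOnW12 a B) : BoundedOnW12 a (-B) := by
  obtain ⟨C, hC⟩ := hB
  refine ⟨C, fun f f' hf => ?_⟩
  obtain ⟨g, hg, hb⟩ := hC f f' hf
  exact ⟨-g, hg.neg, by simpa using hb⟩

theorem IsSmoothing.bounded_id_add (hK : IsSmoothing a K) :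
    BoundedOnW12 a (ContinuousLinearMap.id ℂ (L2 a) + K) ∧
      BoundedOnW22 a (ContinuousLinearMap.id ℂ (L2 a) + K) := by
  have h1 := hK.boundedOnW12 (ContinuousLinearMap.id ℂ (L2 a))
  have h2 := hK.boundedOnW22 boundedOnW12_id
  rw [ContinuousLinearMap.comp_id] at h1 h2
  exact ⟨h1, h2⟩

/-- Bootstrap: boundedness of `B` on `L²` yields it on `W^{1,2}`, and inserting that into the same
equation yields it on `W^{2,2}`. -/
theorem IsSmoothing.bounded_of_eq (hK : IsSmoothing a K)
    (hB : B = ContinuousLinearMap.id ℂ (L2 a) + K ∘L (-B)) :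
    BoundedOnW12 a B ∧ BoundedOnW22 a B := by
  have h1 : BoundedOnW12 a B := by
    rw [hB]
    exact hK.boundedOnW12 _
  refine ⟨h1, ?_⟩
  rw [hB]
  exact hK.boundedOnW22 h1.neg

variable {d d' d'' : ℕ → L2 a} {T : L2 a →L[ℂ] L2 a}

/-- Synthesis operators of families with controlled derivatives are smoothing. -/
theorem isSmoothing_of_bessel (ha : 0 < a) (hT : ∀ n, T (neumannMode a n) = d n)
    (hd : ∀ n, HasWeakDeriv a (d n) (d' n)) (hd' : ∀ n, HasWeakDeriv a (d' n) (d'' n))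
    (h1 : IsBessel (neumannBasis ha) d')
    (h2 : IsBessel (neumannBasis ha) fun n => (waveNumber a n : ℂ)⁻¹ • d'' n) :
    IsSmoothing a T := by
  obtain ⟨D, hD⟩ := h1
  obtain ⟨Q, hQ⟩ := h2
  obtain ⟨S, hS⟩ := isBessel_sineMode ha
  simp only [neumannBasis_apply] at hD hQ hS
  have sumT (A : L2 a →L[ℂ] L2 a) (f : L2 a) :
      HasSum (fun n => inner ℂ (neumannMode a n) f • A (neumannMode a n)) (A f) := by
    simpa using (neumannBasis ha).hasSum_apply A f
  have hDf (f : L2 a) : HasWeakDeriv a (T f) (D f) :=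
    HasWeakDeriv.hasSum (fun n => by rw [hT, hD]; exact (hd n).smul _) (sumT T f) (sumT D f)
  refine ⟨⟨D, hDf⟩, ‖d'' 0‖ + ‖Q‖ * ‖ContinuousLinearMap.adjoint S‖, fun f f' hf => ?_⟩
  -- For `n ≠ 0`, the factor `kₙ` missing from `kₙ⁻¹ d''ₙ` is supplied by `kₙ ⟨χₙ, f⟩ = -⟨sₙ, f'⟩ =
  -- -⟨χₙ, S* f'⟩`. The term `n = 0`, where `k₀ = 0`, is added by hand.
  refine ⟨D f, inner ℂ (neumannMode a 0) f • d'' 0 - Q (ContinuousLinearMap.adjoint S f'),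
    hDf f, ?_, ?_⟩
  · refine HasWeakDeriv.hasSum (f := fun n => inner ℂ (neumannMode a n) f • D (neumannMode a n))
      (g := fun n => inner ℂ (neumannMode a n) f • d'' n)
      (fun n => by rw [hD]; exact (hd' n).smul _) (sumT D f) ?_
    have e1 := hasSum_ite_eq (0 : ℕ) (inner ℂ (neumannMode a 0) f • d'' 0)
    refine (e1.sub (sumT Q (ContinuousLinearMap.adjoint S f'))).congr_fun fun n => ?_
    rw [ContinuousLinearMap.adjoint_inner_right, hS, hQ,
      ← neg_eq_iff_eq_neg.2 (hf.waveNumber_mul_inner ha n)]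
    rcases eq_or_ne n 0 with rfl | hn
    · simp [waveNumber_zero]
    · have hk : (waveNumber a n : ℂ) ≠ 0 := by exact_mod_cast (waveNumber_pos ha hn).ne'
      rw [if_neg hn, zero_sub, neg_smul, neg_neg, smul_smul, mul_right_comm, mul_inv_cancel₀ hk,
        one_mul]
  · have b1 : ‖inner ℂ (neumannMode a 0) f‖ ≤ ‖f‖ := by
      have := norm_inner_le_norm (𝕜 := ℂ) (neumannMode a 0) f
      rwa [(orthonormal_neumannMode ha).1, one_mul] at this
    have b2 : ‖Q (ContinuousLinearMap.adjoint S f')‖ ≤ ‖Q‖ * ‖ContinuousLinearMap.adjoint S‖ * ‖f'‖ :=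
      (Q.le_opNorm _).trans (by
        rw [mul_assoc]
        gcongr
        exact ContinuousLinearMap.le_opNorm _ _)
    calc _ ≤ ‖inner ℂ (neumannMode a 0) f • d'' 0‖ + ‖Q (ContinuousLinearMap.adjoint S f')‖ :=
          norm_sub_le _ _
      _ ≤ ‖f‖ * ‖d'' 0‖ + ‖Q‖ * ‖ContinuousLinearMap.adjoint S‖ * ‖f'‖ := by
          rw [norm_smul]
          gcongr
      _ ≤ _ := by
          have p1 : 0 ≤ ‖d'' 0‖ * ‖f'‖ := by positivity
          have p2 : 0 ≤ ‖Q‖ * ‖ContinuousLinearMap.adjoint S‖ * ‖f‖ := by positivity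
          nlinarith

theorem exists_norm_inv_waveNumber_le (ha : 0 < a) : ∃ C, ∀ n, ‖(waveNumber a n : ℂ)⁻¹‖ ≤ C := by
  refine ⟨(waveNumber a 1)⁻¹, fun n => ?_⟩
  have h1 := waveNumber_pos ha one_ne_zero
  rcases eq_or_ne n 0 with rfl | hn
  · rw [waveNumber_zero, Complex.ofReal_zero, inv_zero, norm_zero]
    positivity
  · rw [norm_inv, norm_waveNumber ha]
    have : waveNumber a 1 ≤ waveNumber a n := by
      have : (1 : ℝ) ≤ n := by exact_mod_cast Nat.one_le_iff_ne_zero.2 hn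
      unfold waveNumber
      rw [Nat.cast_one]
      gcongr
    gcongr

/-- Decay of the Neumann coefficients gives two weak derivatives. -/
theorem exists_hasWeakDeriv_of_inner_neumannMode (ha : 0 < a) {h G : L2 a}
    (hG : ∀ n, (waveNumber a n : ℂ) ^ 2 * inner ℂ (neumannMode a n) h =
      inner ℂ (neumannMode a n) G) :
    ∃ h', HasWeakDeriv a h h' ∧ HasWeakDeriv a h' (-G) := by
  obtain ⟨C, hC⟩ := exists_norm_inv_waveNumber_le ha
  -- `S χₙ = kₙ⁻¹ sₙ`; at `n = 0` the default inverse `0` is harmless since `s₀ = 0`. The derivative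
  -- sought is `-S G`.
  obtain ⟨S, hS⟩ := (isBessel_sineMode ha).smul hC
  simp only [neumannBasis_apply] at hS
  have sumT (A : L2 a →L[ℂ] L2 a) (f : L2 a) :
      HasSum (fun n => inner ℂ (neumannMode a n) f • A (neumannMode a n)) (A f) := by
    simpa using (neumannBasis ha).hasSum_apply A f
  have hG' (n : ℕ) : inner ℂ (neumannMode a n) G * (waveNumber a n : ℂ)⁻¹ =
      waveNumber a n * inner ℂ (neumannMode a n) h := by
    rw [← hG]
    rcases eq_or_ne n 0 with rfl | hn
    · simp [waveNumber_zero]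
    · have hk : (waveNumber a n : ℂ) ≠ 0 := by exact_mod_cast (waveNumber_pos ha hn).ne'
      field_simp
  have s1 : HasSum (fun n => -((waveNumber a n * inner ℂ (neumannMode a n) h) • sineMode a n))
      (-S G) := by
    refine (sumT S G).neg.congr_fun fun n => ?_
    rw [hS, smul_smul, hG']
  refine ⟨-S G, HasWeakDeriv.hasSum (fun n => ?_) (sumT (ContinuousLinearMap.id ℂ _) h) s1,
    HasWeakDeriv.hasSum (fun n => ?_) s1 (sumT (ContinuousLinearMap.id ℂ _) G).neg⟩
  · convert (hasWeakDeriv_neumannMode ha n).smul (inner ℂ (neumannMode a n) h) using 1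
    · rfl
    · rw [smul_smul, mul_neg, neg_smul, mul_comm]
  · convert ((hasWeakDeriv_sineMode ha n).smul
      (waveNumber a n * inner ℂ (neumannMode a n) h)).neg using 1
    rw [smul_smul, ContinuousLinearMap.id_apply, ← hG]
    ring_nf

/-- The vector is the image of `χ₀` under the adjoint of the operator `χₙ ↦ conj (sₙ) χ₀`. -/
theorem exists_inner_neumannMode_eq (ha : 0 < a) {s : ℕ → ℂ} (hs : Summable fun n => ‖s n‖ ^ 2) :
    ∃ v : L2 a, ∀ n, inner ℂ (neumannMode a n) v = s n := by
  have hB : IsBessel (neumannBasis ha) fun n => conj (s n) • neumannMode a 0 := by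
    refine IsBessel.of_summable (hs.congr fun n => ?_)
    rw [norm_smul, RCLike.norm_conj, (orthonormal_neumannMode ha).1, mul_one]
  obtain ⟨A, hA⟩ := hB
  simp only [neumannBasis_apply] at hA
  refine ⟨ContinuousLinearMap.adjoint A (neumannMode a 0), fun n => ?_⟩
  rw [ContinuousLinearMap.adjoint_inner_right, hA, inner_smul_left, Complex.conj_conj,
    inner_neumannMode_self ha, mul_one]

theorem trace_toL2 (ha : 0 < a) {u v : C(ℝ, ℂ)} (h : ∀ x, HasDerivAt u (v x) x) :
    traceRight a (toL2 a u) (toL2 a v) = u a ∧ traceLeft a (toL2 a u) (toL2 a v) = u (-a) := by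
  have ha' : (a : ℂ) ≠ 0 := by exact_mod_cast ha.ne'
  have key (w : C(ℝ, ℂ)) (k : ℂ) (hw : ∀ x, HasDerivAt w k x) (hr : ∀ x, conj (w x) = w x)
      (hk : conj k = k) :
      inner ℂ (toL2 a (ContinuousMap.const ℝ k)) (toL2 a u) + inner ℂ (toL2 a w) (toL2 a v) =
        w a * u a - w (-a) * u (-a) := by
    rw [inner_toL2_toL2 ha, inner_toL2_toL2 ha, ← intervalIntegral.integral_add
      (Continuous.intervalIntegrable (by fun_prop) _ _)
      (Continuous.intervalIntegrable (by fun_prop) _ _)]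
    simp only [ContinuousMap.const_apply, hr, hk]
    exact intervalIntegral.integral_eq_sub_of_hasDerivAt (f := fun x => w x * u x)
      (fun x _ => (hw x).mul (h x)) (Continuous.intervalIntegrable (by fun_prop) _ _)
  have d1 (x : ℝ) : HasDerivAt (rampUp a) (1 / (2 * a)) x :=
    ((hasDerivAt_id x).ofReal_comp.add_const (a : ℂ)).div_const _
  have d2 (x : ℝ) : HasDerivAt (-rampDown a : C(ℝ, ℂ)) (1 / (2 * a)) x := by
    refine (((hasDerivAt_id x).ofReal_comp.const_sub (a : ℂ)).div_const _).neg.congr_deriv ?_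
    simp [neg_div]
  have hk : conj (1 / (2 * a) : ℂ) = 1 / (2 * a)  := by
    simp [Complex.conj_ofNat]
  have k1 := key (rampUp a) _ d1 (fun x => by simp [rampUp, Complex.conj_ofNat]) hk
  have k2 := key (-rampDown a) _ d2 (fun x => by simp [rampDown, Complex.conj_ofNat]) hk
  have hneg : toL2 a (-rampDown a) = -toL2 a (rampDown a) := rfl
  rw [hneg, inner_neg_left] at k2
  constructor
  · rw [traceRight, k1]
    simp only [rampUp, ContinuousMap.coe_mk]
    push_cast
    field_simp
    ring
  · rw [traceLeft, sub_eq_add_neg, k2]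
    simp only [rampDown, ContinuousMap.neg_apply, ContinuousMap.coe_mk]
    push_cast
    field_simp
    ring

theorem contDiff_neumannMap (a : ℝ) (n : ℕ) : ContDiff ℝ ∞ (neumannMap a n) := by
  have : ContDiff ℝ ∞ (neumannFun a n) := by
    unfold neumannFun
    split_ifs <;> fun_prop
  exact Complex.ofRealCLM.contDiff.comp this

theorem conj_neumannMap (a : ℝ) (n : ℕ) (x : ℝ) : conj (neumannMap a n x) = neumannMap a n x :=
  Complex.conj_ofReal _

/-- The Neumann coefficients of a function in `W^{2,2}(-a, a)` in terms of its boundary values. -/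
theorem waveNumber_sq_mul_inner (ha : 0 < a) {p p' p'' : C(ℝ, ℂ)}
    (h1 : ∀ x, HasDerivAt p (p' x) x) (h2 : ∀ x, HasDerivAt p' (p'' x) x) (n : ℕ) :
    (waveNumber a n : ℂ) ^ 2 * inner ℂ (neumannMode a n) (toL2 a p) =
      neumannMap a n a * p' a - neumannMap a n (-a) * p' (-a) -
        inner ℂ (neumannMode a n) (toL2 a p'') := by
  have e1 := (hasWeakDeriv_toL2 ha h1).waveNumber_mul_inner ha n
  have e2 := (hasWeakDeriv_toL2 ha h2).inner_toL2_add ha (w := neumannMap a n)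
    (w' := -(waveNumber a n : ℂ) • sineMap a n) (contDiff_neumannMap a n) (hasDerivAt_neumannMap a n)
  rw [(trace_toL2 ha h2).1, (trace_toL2 ha h2).2, toL2_smul, inner_smul_left, conj_neumannMap,
    conj_neumannMap, map_neg, Complex.conj_ofReal] at e2
  change -(waveNumber a n : ℂ) * inner ℂ (sineMode a n) _ + inner ℂ (neumannMode a n) _ = _ at e2
  linear_combination waveNumber a n * e1 + e2

/-- Analysis operators of families with controlled derivatives and boundary values are
smoothing. -/
theorem isSmoothing_adjoint (ha : 0 < a) {cp cm : ℂ} (hT : ∀ n, T (neumannMode a n) = d n)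
    (hkd : IsBessel (neumannBasis ha) fun n => (waveNumber a n : ℂ) • d n)
    {W W' : ℕ → C(ℝ, ℂ)} (hW : ∀ n, ContDiff ℝ ∞ (W n)) (hWd : ∀ n x, HasDerivAt (W n) (W' n x) x)
    (hWB : IsBessel (neumannBasis ha) fun n => toL2 a (W n))
    {r : ℕ → L2 a} (hr : IsBessel (neumannBasis ha) r)
    (hd : ∀ n, (waveNumber a n : ℂ) ^ 2 • d n = -toL2 a (W' n) + r n)
    {s t : ℕ → ℂ} (hs : Summable fun n => ‖s n‖ ^ 2) (ht : Summable fun n => ‖t n‖ ^ 2)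
    (hs' : ∀ n, conj (W n a) = -cp * (neumannMap a n a + s n))
    (ht' : ∀ n, conj (W n (-a)) = -cm * (neumannMap a n (-a) + t n)) :
    IsSmoothing a (ContinuousLinearMap.adjoint T) := by
  have ha' : (a : ℂ) ≠ 0 := by exact_mod_cast ha.ne'
  obtain ⟨S, hS⟩ := isBessel_sineMode ha
  obtain ⟨N, hN⟩ := hkd
  obtain ⟨D, hD⟩ := hWB
  obtain ⟨R, hR⟩ := hr
  obtain ⟨v, hv⟩ := exists_inner_neumannMode_eq ha hs
  obtain ⟨w, hw⟩ := exists_inner_neumannMode_eq ha ht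
  obtain ⟨Ct, hCt0, hCt⟩ := exists_trace_bound a
  simp only [neumannBasis_apply] at hS hN hD hR
  have sumT (A : L2 a →L[ℂ] L2 a) (f : L2 a) :
      HasSum (fun n => inner ℂ (neumannMode a n) f • A (neumannMode a n)) (A f) := by
    simpa using (neumannBasis ha).hasSum_apply A f
  constructor
  · refine ⟨-(S ∘L ContinuousLinearMap.adjoint N), fun f => ?_⟩
    refine HasWeakDeriv.hasSum (fun n => ?_)
      (sumT (ContinuousLinearMap.id ℂ _) (ContinuousLinearMap.adjoint T f))
      (sumT S (ContinuousLinearMap.adjoint N f)).neg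
    convert (hasWeakDeriv_neumannMode ha n).smul
      (inner ℂ (neumannMode a n) (ContinuousLinearMap.adjoint T f)) using 1
    · rfl
    rw [ContinuousLinearMap.adjoint_inner_right, ContinuousLinearMap.adjoint_inner_right, hN, hS,
      hT, inner_smul_left, Complex.conj_ofReal, smul_smul, mul_neg, neg_smul, mul_comm]
  -- Integration by parts of `⟨W'ₙ, f⟩` leaves the boundary terms `c₊ f(a) χₙ(a)` and `-c₋ f(-a)
  -- χₙ(-a)`, which are not square summable in `n`. By `waveNumber_sq_mul_inner`, multiples of two
  -- quadratics with slope one at one end and zero at the other have the same contribution, up to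
  -- coefficients of the constant `q`.
  · let q : C(ℝ, ℂ) := ContinuousMap.const ℝ (1 / (2 * a) : ℂ)
    let pUp : C(ℝ, ℂ) := ⟨fun x => (x + a) ^ 2 / (4 * a), by fun_prop⟩
    let pDown : C(ℝ, ℂ) := ⟨fun x => -((a - x) ^ 2 / (4 * a)), by fun_prop⟩
    have u1 (x : ℝ) : HasDerivAt pUp (rampUp a x) x := by
      refine ((((hasDerivAt_id x).ofReal_comp.add_const (a : ℂ)).pow 2).div_const
        (4 * a : ℂ)).congr_deriv ?_
      simp only [rampUp, ContinuousMap.coe_mk, id]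
      push_cast
      field_simp
      ring
    have u2 (x : ℝ) : HasDerivAt (rampUp a) (q x) x :=
      ((hasDerivAt_id x).ofReal_comp.add_const (a : ℂ)).div_const _
    have w1 (x : ℝ) : HasDerivAt pDown (rampDown a x) x := by
      refine ((((hasDerivAt_id x).ofReal_comp.const_sub (a : ℂ)).pow 2).div_const
        (4 * a : ℂ)).neg.congr_deriv ?_
      simp only [rampDown, ContinuousMap.coe_mk, id]
      push_cast
      field_simp
      ring
    have w2 (x : ℝ) : HasDerivAt (rampDown a) ((-q) x) x := by
      refine (((hasDerivAt_id x).ofReal_comp.const_sub (a : ℂ)).div_const _).congr_deriv ?_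
      simp [q, neg_div]
    have rUp : rampUp a a = 1 ∧ rampUp a (-a) = 0 := by
      constructor
      · simp only [rampUp, ContinuousMap.coe_mk]
        field_simp
        ring
      · simp [rampUp]
    have rDown : rampDown a a = 0 ∧ rampDown a (-a) = 1 := by
      constructor
      · simp [rampDown]
      · simp only [rampDown, ContinuousMap.coe_mk]
        push_cast
        field_simp
        ring
    refine ⟨‖cp‖ * Ct * ‖v‖ + ‖cm‖ * Ct * ‖w‖ + ‖ContinuousLinearMap.adjoint D‖ +
      ‖ContinuousLinearMap.adjoint R‖, fun f f' hf => ?_⟩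
    set tr := traceRight a f f' with htr
    set tl := traceLeft a f f' with htl
    -- `-G` is the second derivative of `T* f` minus the quadratics: `v` and `w` carry the square
    -- summable boundary errors, `D* f'` the integrated term, `R* f` the remainder.
    set G : L2 a := (cp * tr) • (v + toL2 a q) - (cm * tl) • (w + toL2 a q) +
      ContinuousLinearMap.adjoint D f' + ContinuousLinearMap.adjoint R f with hGdef
    have hG (n : ℕ) : (waveNumber a n : ℂ) ^ 2 * inner ℂ (neumannMode a n)
        (ContinuousLinearMap.adjoint T f - (cp * tr) • toL2 a pUp - (cm * tl) • toL2 a pDown) =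
        inner ℂ (neumannMode a n) G := by
      have e1 := waveNumber_sq_mul_inner ha u1 u2 n
      have e2 := waveNumber_sq_mul_inner ha w1 w2 n
      have hneg : toL2 a (-q) = -toL2 a q := rfl
      rw [rUp.1, rUp.2] at e1
      rw [rDown.1, rDown.2, hneg, inner_neg_right] at e2
      have e3 := hf.inner_toL2_add ha (hW n) (hWd n)
      rw [hs', ht', ← htr, ← htl] at e3
      have e4 := congrArg (fun g => inner ℂ g f) (hd n)
      simp only [inner_add_left, inner_neg_left, inner_smul_left, map_pow,
        Complex.conj_ofReal] at e4
      rw [hGdef]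
      simp only [inner_sub_right, inner_add_right, inner_smul_right,
        ContinuousLinearMap.adjoint_inner_right, hT, hD, hR, hv, hw]
      linear_combination e4 - e3 - cp * tr * e1 - cm * tl * e2
    obtain ⟨h', hh1, hh2⟩ := exists_hasWeakDeriv_of_inner_neumannMode ha hG
    have f1 := (hh1.add ((hasWeakDeriv_toL2 ha u1).smul (cp * tr))).add
      ((hasWeakDeriv_toL2 ha w1).smul (cm * tl))
    have f2 := (hh2.add ((hasWeakDeriv_toL2 ha u2).smul (cp * tr))).add
      ((hasWeakDeriv_toL2 ha w2).smul (cm * tl))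
    refine ⟨_, _, ?_, f2, ?_⟩
    · convert f1 using 1
      abel
    · have hneg : toL2 a (-q) = -toL2 a q := rfl
      have e : -G + (cp * tr) • toL2 a q + (cm * tl) • toL2 a (-q) =
          -((cp * tr) • v - (cm * tl) • w + ContinuousLinearMap.adjoint D f' +
            ContinuousLinearMap.adjoint R f) := by
        rw [hGdef, hneg, smul_add, smul_add, smul_neg]
        abel
      rw [e, norm_neg]
      have b1 := (hCt f f').1
      have b2 := (hCt f f').2
      rw [← htr] at b1
      rw [← htl] at b2
      have b3 : ‖(cp * tr) • v‖ ≤ ‖cp‖ * Ct * ‖v‖ * (‖f‖ + ‖f'‖) := by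
        rw [norm_smul, norm_mul]
        calc ‖cp‖ * ‖tr‖ * ‖v‖ ≤ ‖cp‖ * (Ct * (‖f‖ + ‖f'‖)) * ‖v‖ := by gcongr
          _ = _ := by ring
      have b4 : ‖(cm * tl) • w‖ ≤ ‖cm‖ * Ct * ‖w‖ * (‖f‖ + ‖f'‖) := by
        rw [norm_smul, norm_mul]
        calc ‖cm‖ * ‖tl‖ * ‖w‖ ≤ ‖cm‖ * (Ct * (‖f‖ + ‖f'‖)) * ‖w‖ := by gcongr
          _ = _ := by ring
      have b5 : ‖ContinuousLinearMap.adjoint D f'‖ ≤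
          ‖ContinuousLinearMap.adjoint D‖ * (‖f‖ + ‖f'‖) :=
        (ContinuousLinearMap.le_opNorm _ _).trans (by
          gcongr
          exact le_add_of_nonneg_left (norm_nonneg _))
      have b6 : ‖ContinuousLinearMap.adjoint R f‖ ≤
          ‖ContinuousLinearMap.adjoint R‖ * (‖f‖ + ‖f'‖) :=
        (ContinuousLinearMap.le_opNorm _ _).trans (by
          gcongr
          exact le_add_of_nonneg_right (norm_nonneg _))
      have c1 := norm_add_le ((cp * tr) • v - (cm * tl) • w + ContinuousLinearMap.adjoint D f')
        (ContinuousLinearMap.adjoint R f)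
      have c2 := norm_add_le ((cp * tr) • v - (cm * tl) • w) (ContinuousLinearMap.adjoint D f')
      have c3 := norm_sub_le ((cp * tr) • v) ((cm * tl) • w)
      linarith

end Smoothing

/-! ### The transformation, its inverse and their bounds. -/

noncomputable section Transform

variable {a : ℝ} {φ : ℕ → L2 a} {K : L2 a →L[ℂ] L2 a}

/-- The properties of the transformation `f ↦ ∑ ⟨φₙ, f⟩ χₙ` in terms of the operator `K` that maps
`χₙ` to `φₙ - χₙ`. -/
theorem exists_transform (ha : 0 < a) (hK : ∀ n, K (neumannMode a n) = φ n - neumannMode a n)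
    (hsum : Summable fun n => ‖φ n - neumannMode a n‖ ^ 2) (hS : IsSmoothing a K)
    (hS' : IsSmoothing a (ContinuousLinearMap.adjoint K)) (hinj : ∀ f, f + K f = 0 → f = 0) :
    ∃ (Ω : L2 a ≃L[ℂ] L2 a) (L M : L2 a →L[ℂ] L2 a),
      (∀ f : L2 a, HasSum (fun n => inner ℂ (φ n) f • neumannMode a n) (Ω f)) ∧
      (Ω : L2 a →L[ℂ] L2 a) = ContinuousLinearMap.id ℂ (L2 a) + L ∧
      (Ω.symm : L2 a →L[ℂ] L2 a) = ContinuousLinearMap.id ℂ (L2 a) + M ∧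
      IsHilbertSchmidt L ∧ IsHilbertSchmidt M ∧
      (∀ T ∈ ({(Ω : L2 a →L[ℂ] L2 a), ContinuousLinearMap.adjoint (Ω : L2 a →L[ℂ] L2 a),
          (Ω.symm : L2 a →L[ℂ] L2 a),
          ContinuousLinearMap.adjoint (Ω.symm : L2 a →L[ℂ] L2 a)} : Set (L2 a →L[ℂ] L2 a)),
        BoundedOnW12 a T ∧ BoundedOnW22 a T) ∧
      ∃ C : ℝ, ∀ f f' : L2 a, HasWeakDeriv a f f' →
        ∃ g' h' : L2 a,
          HasWeakDeriv a (ContinuousLinearMap.adjoint L f) g' ∧ HasWeakDeriv a (M f) h' ∧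
          ∀ δ : ℝ, 0 < δ → δ ≤ 1 →
            ‖g'‖ ^ 2 ≤ C * (δ * ‖f'‖ ^ 2 + (δ ^ 2)⁻¹ * ‖f‖ ^ 2) ∧
            ‖h'‖ ^ 2 ≤ C * (δ * ‖f'‖ ^ 2 + (δ ^ 2)⁻¹ * ‖f‖ ^ 2) := by
  have hsumK : Summable fun n => ‖K (neumannBasis ha n)‖ ^ 2 := by
    simpa only [neumannBasis_apply, hK] using hsum
  have hsumL := (neumannBasis ha).summable_adjoint hsumK
  obtain ⟨Θ, hΘ⟩ := (neumannBasis ha).bijective_id_add hsumK hinj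
  set L := ContinuousLinearMap.adjoint K with hL
  have hLK : ContinuousLinearMap.adjoint L = K := ContinuousLinearMap.adjoint_adjoint K
  -- `I + K*` is injective because `I + K` is onto: a kernel vector is orthogonal to the range of `I
  -- + K`.
  obtain ⟨Ω, hΩ⟩ := (neumannBasis ha).bijective_id_add hsumL fun f hf => by
    obtain ⟨g, hg⟩ := Θ.surjective f
    have h1 : g + K g = f := hg ▸ (DFunLike.congr_fun hΘ g).symm
    have h2 : inner ℂ (f + L f) g = inner ℂ f (g + K g) := by
      rw [inner_add_left, inner_add_right, hL, ContinuousLinearMap.adjoint_inner_left]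
    rw [hf, inner_zero_left, h1] at h2
    exact inner_self_eq_zero.1 h2.symm
  have hΩf (f : L2 a) : Ω f = f + L f := DFunLike.congr_fun hΩ f
  set B : L2 a →L[ℂ] L2 a := (Ω.symm : L2 a →L[ℂ] L2 a) with hB
  have hB1 (f : L2 a) : B f = f - L (B f) := by
    have := Ω.apply_symm_apply f
    rw [hΩf] at this
    exact eq_sub_of_add_eq this
  have hB2 (f : L2 a) : B f - f = -B (L f) := by
    have h1 : B (Ω f) = f := Ω.symm_apply_apply f
    rw [hΩf, map_add] at h1
    nth_rw 2 [← h1]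
    abel
  have hBL : B = ContinuousLinearMap.id ℂ (L2 a) + L ∘L (-B) := by
    ext1 f
    change B f = f + L (-(B f))
    rw [map_neg, ← sub_eq_add_neg]
    exact hB1 f
  have hΩadj : ContinuousLinearMap.adjoint (Ω : L2 a →L[ℂ] L2 a) =
      ContinuousLinearMap.id ℂ (L2 a) + K := by
    rw [hΩ, map_add, hLK, ContinuousLinearMap.adjoint_id]
  have hBK : ContinuousLinearMap.adjoint B =
      ContinuousLinearMap.id ℂ (L2 a) + K ∘L (-ContinuousLinearMap.adjoint B) := by
    have h1 : B ∘L (Ω : L2 a →L[ℂ] L2 a) = ContinuousLinearMap.id ℂ (L2 a) := by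
      ext1 f
      exact Ω.symm_apply_apply f
    have h2 := congrArg ContinuousLinearMap.adjoint h1
    rw [ContinuousLinearMap.adjoint_comp, hΩadj, ContinuousLinearMap.adjoint_id,
      ContinuousLinearMap.add_comp, ContinuousLinearMap.id_comp] at h2
    rw [ContinuousLinearMap.comp_neg, ← sub_eq_add_neg]
    exact eq_sub_of_add_eq h2
  -- `M = -B L = -L B`. The first form shows that `M` is Hilbert–Schmidt, the second that it gains a
  -- derivative.
  refine ⟨Ω, L, B - ContinuousLinearMap.id ℂ (L2 a), fun f => ?_, hΩ, by abel,
    (neumannBasis ha).isHilbertSchmidt hsumL, ?_, ?_, ?_⟩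
  · refine ((neumannBasis ha).hasSum_smul (Ω f)).congr_fun fun n => ?_
    rw [neumannBasis_apply, hΩf, inner_add_right, hL, ContinuousLinearMap.adjoint_inner_right, hK,
      inner_sub_left, add_sub_cancel]
  · refine (neumannBasis ha).isHilbertSchmidt ?_
    refine Summable.of_nonneg_of_le (fun _ => sq_nonneg _) (fun n => ?_)
      (hsumL.mul_left (‖B‖ ^ 2))
    rw [sub_apply, ContinuousLinearMap.id_apply, hB2, norm_neg]
    exact sq_norm_clm_le B _
  · rintro T (rfl | rfl | rfl | rfl)
    · rw [hΩ]
      exact hS'.bounded_id_add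
    · rw [hΩadj]
      exact hS.bounded_id_add
    · exact hS'.bounded_of_eq hBL
    · exact hS.bounded_of_eq hBK
  · obtain ⟨D, hD⟩ := hS.exists_deriv
    obtain ⟨D', hD'⟩ := hS'.exists_deriv
    -- Both derivatives are bounded by `‖f‖`, and `‖f‖² ≤ δ⁻² ‖f‖²` for `δ ≤ 1`.
    refine ⟨‖D‖ ^ 2 + ‖D' ∘L B‖ ^ 2, fun f f' _ => ⟨D f, -D' (B f), ?_, ?_, fun δ h0 h1 => ?_⟩⟩
    · rw [hLK]
      exact hD f
    · have h1 : (B - ContinuousLinearMap.id ℂ (L2 a)) f = -L (B f) := by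
        rw [sub_apply, ContinuousLinearMap.id_apply]
        nth_rw 1 [hB1 f]
        abel
      rw [h1]
      exact (hD' (B f)).neg
    · have h2 : ‖f‖ ^ 2 ≤ δ * ‖f'‖ ^ 2 + (δ ^ 2)⁻¹ * ‖f‖ ^ 2 := by
        have h3 : 1 ≤ (δ ^ 2)⁻¹ := (one_le_inv₀ (by positivity)).2 (pow_le_one₀ h0.le h1)
        have h4 : 0 ≤ δ * ‖f'‖ ^ 2 := by positivity
        nlinarith [sq_nonneg ‖f‖]
      constructor
      · refine (sq_norm_clm_le D f).trans ?_
        gcongr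
        exact le_add_of_nonneg_right (sq_nonneg _)
      · rw [norm_neg]
        refine (sq_norm_clm_le (D' ∘L B) f).trans ?_
        gcongr
        exact le_add_of_nonneg_left (sq_nonneg _)

variable {cp cm : ℂ} {α l : ℕ → ℂ} {C : ℝ}

theorem eventually_eq_adjointMap (hα : ∀ᶠ n in atTop, α n = 1 / (√a : ℂ)) :
    ∀ᶠ n in atTop, α n • robinMapConj a cm (l n ^ 2) = adjointMap a cm (l n ^ 2) := by
  filter_upwards [hα] with n hn
  rw [hn, adjointMap]

theorem summable_sq_norm_sub_neumannMode (ha : 0 < a)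
    (hl : ∀ᶠ n : ℕ in atTop, ‖l n - waveNumber a n‖ ≤ C / n)
    (hα : ∀ᶠ n in atTop, α n = 1 / (√a : ℂ)) :
    Summable fun n => ‖α n • toL2 a (robinMapConj a cm (l n ^ 2)) - neumannMode a n‖ ^ 2 := by
  obtain ⟨K, hK⟩ := eventually_norm_toL2_le ha
    (R := fun n => adjointMap a cm (l n ^ 2) - neumannMap a n) (adjointMap_sub_isBigO ha cm hl)
  refine summable_sq_of_le_div (C := K) ?_
  filter_upwards [hK, eventually_eq_adjointMap hα (cm := cm) (l := l)] with n hn h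
  rwa [abs_norm, ← toL2_smul, h, neumannMode_eq, ← toL2_sub]

/-- The operators mapping the Neumann eigenfunctions to the deviations of the eigenfunctions of the
adjoint operator are smoothing, together with their adjoints. -/
theorem isSmoothing_of_near (ha : 0 < a)
    (hl : ∀ᶠ n : ℕ in atTop, ‖l n - waveNumber a n‖ ≤ C / n)
    (hα : ∀ᶠ n in atTop, α n = 1 / (√a : ℂ)) (hz : ∀ n, robinCharFun a cp cm (l n ^ 2) = 0)
    (hK : ∀ n, K (neumannMode a n) =
      α n • toL2 a (robinMapConj a cm (l n ^ 2)) - neumannMode a n) :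
    IsSmoothing a K ∧ IsSmoothing a (ContinuousLinearMap.adjoint K) := by
  let u (n : ℕ) : C(ℝ, ℂ) := α n • robinMapConj a cm (l n ^ 2)
  let W (n : ℕ) : C(ℝ, ℂ) :=
    α n • robinMapConjDeriv a cm (l n ^ 2) + (waveNumber a n : ℂ) • sineMap a n
  let W' (n : ℕ) : C(ℝ, ℂ) := -conj (l n ^ 2) • u n + (waveNumber a n : ℂ) ^ 2 • neumannMap a n
  let d (n : ℕ) : L2 a := toL2 a (u n) - neumannMode a n
  let r (n : ℕ) : L2 a := ((waveNumber a n : ℂ) ^ 2 - conj (l n ^ 2)) • toL2 a (u n)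
  have hu : ∀ᶠ n in atTop, u n = adjointMap a cm (l n ^ 2) := eventually_eq_adjointMap hα
  have hud (n : ℕ) (x : ℝ) : HasDerivAt (u n) (α n * robinMapConjDeriv a cm (l n ^ 2) x) x :=
    (hasDerivAt_robinMapConj cm _ x).const_mul (α n)
  have hWd (n : ℕ) (x : ℝ) : HasDerivAt (W n) (W' n x) x := by
    refine (((hasDerivAt_robinMapConjDeriv cm (l n ^ 2) x).const_mul (α n)).add
      ((hasDerivAt_sineMap a n x).const_mul (waveNumber a n : ℂ))).congr_deriv ?_
    simp only [W', u, ContinuousMap.add_apply, ContinuousMap.smul_apply, smul_eq_mul]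
    ring
  have hdd (n : ℕ) : HasWeakDeriv a (d n) (toL2 a (W n)) := by
    have : d n = toL2 a (u n - neumannMap a n) := by rw [toL2_sub, ← neumannMode_eq]
    rw [this]
    refine hasWeakDeriv_toL2 ha fun x => ((hud n x).sub (hasDerivAt_neumannMap a n x)).congr_deriv ?_
    simp only [W, ContinuousMap.add_apply, ContinuousMap.smul_apply, smul_eq_mul]
    ring
  have hKd (n : ℕ) : K (neumannMode a n) = d n := hK n
  -- The eigenvalue equations trade the second derivative of `φₙ - χₙ` for `-kₙ² d n` plus `r n`,
  -- whose coefficient `kₙ² - conj λₙ` is bounded.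
  have hW'2 (n : ℕ) : toL2 a (W' n) = r n - (waveNumber a n : ℂ) ^ 2 • d n := by
    simp only [W', toL2_add, toL2_smul, r, d, neumannMode_eq]
    module
  have bkd : IsBessel (neumannBasis ha) fun n => (waveNumber a n : ℂ) • d n := by
    refine (isBessel_waveNumber_smul_adjointMap_sub ha cm hl).congr_eventually ?_
    filter_upwards [hu] with n hn
    simp only [d, hn]
  have bW : IsBessel (neumannBasis ha) fun n => toL2 a (W n) := by
    refine (isBessel_adjointMapDeriv_add ha cm hl).congr_eventually ?_
    filter_upwards [hα] with n hn
    simp only [W, hn, toL2_add, toL2_smul, adjointMapDeriv, sineMode]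
  have bu : IsBessel (neumannBasis ha) fun n => toL2 a (u n) := by
    refine Eq.subst (motive := IsBessel (neumannBasis ha)) (funext fun n => ?_)
      ((show IsBessel (neumannBasis ha) d from ⟨K, by simpa using hKd⟩).add
        (isBessel_neumannMode ha))
    exact sub_add_cancel _ _
  have br : IsBessel (neumannBasis ha) r := by
    obtain ⟨K, hK⟩ := eventually_norm_sq_sub_le hl
    refine bu.smul_eventually (C := K) (hK.mono fun n hn => ?_)
    rwa [norm_sub_rev]
  obtain ⟨K', hK'⟩ := exists_norm_inv_waveNumber_le ha
  refine ⟨isSmoothing_of_bessel ha hKd hdd (fun n => hasWeakDeriv_toL2 ha (hWd n)) bW ?_, ?_⟩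
  · refine ((br.smul hK').sub bkd).congr_eventually ?_
    filter_upwards [eventually_ne_atTop 0] with n hn
    have hk : (waveNumber a n : ℂ) ≠ 0 := by exact_mod_cast (waveNumber_pos ha hn).ne'
    rw [hW'2, smul_sub, smul_smul _ (_ ^ 2), sq, inv_mul_cancel_left₀ hk]
  · have hs : Summable fun n => ‖conj (u n a) - neumannMap a n a‖ ^ 2 := by
      obtain ⟨K, hK⟩ := (adjointMap_sub_isBigO ha cm hl).bound
      refine summable_sq_of_le_div (C := K) ?_
      filter_upwards [eventually_uniformFilter.1 hK, hu] with n hn h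
      have := hn a (right_mem_Icc.2 (by linarith))
      rw [abs_norm, h, ← conj_neumannMap a n a, ← map_sub, RCLike.norm_conj, div_eq_mul_inv]
      simpa using this
    -- The normalization makes `φₙ(-a) = χₙ(-a)` for all large `n`, so the constant `0` suffices.
    have ht : Summable fun n => ‖conj (α n) - neumannMap a n (-a)‖ ^ 2 := by
      refine summable_sq_of_le_div (C := 0) ?_
      filter_upwards [hα, eventually_ne_atTop 0] with n hn hn0
      simp [hn, neumannMap, ofRealMap, neumannFun, hn0]
    refine isSmoothing_adjoint ha (cp := cp) (cm := cm) hKd bkd (W := W) (W' := W') (fun n => ?_) hWd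
      bW br (fun n => ?_) hs ht (fun n => ?_) fun n => ?_
    · exact (contDiff_const.mul (contDiff_robinMapConjDeriv a cm _)).add
        (contDiff_const.mul (contDiff_sineMap a n))
    · rw [hW'2]
      abel
    -- At `a` the sine vanishes and the Robin condition replaces the derivative by `-c₊` times the
    -- value.
    · have h := hz n
      rw [robinCharFun_eq] at h
      simp only [W, u, ContinuousMap.add_apply, ContinuousMap.smul_apply, smul_eq_mul,
        sineMap_right ha, mul_zero, add_zero, map_mul, robinMapConj, robinMapConjDeriv,
        ContinuousMap.coe_mk, Complex.conj_conj]
      linear_combination conj (α n) * h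
    · simp only [W, ContinuousMap.add_apply, ContinuousMap.smul_apply, smul_eq_mul, sineMap_left,
        mul_zero, add_zero, map_mul, robinMapConjDeriv, ContinuousMap.coe_mk, Complex.conj_conj,
        robinMapDeriv_left]
      ring

end Transform

/-! ### Assembly of the spectral data. -/

theorem theorem3p6 (a : ℝ) (ha : 0 < a) (cp cm : ℂ)
    -- all eigenvalues of `H` are simple
    (hsimple : ∀ (μ : ℂ) (f : L2 a), IsEigenvector (robinOp a cp cm) μ f →
      IsSimpleEigenvalue (robinOp a cp cm) μ)
    -- an enumeration of the eigenvalues without repetition, eventually ordered by modulus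
    (lam : ℕ → ℂ) (hinj : Function.Injective lam)
    (hrange : ∀ μ : ℂ, (∃ n, lam n = μ) ↔ ∃ f : L2 a, IsEigenvector (robinOp a cp cm) μ f)
    (hord : ∀ᶠ n in atTop, ‖lam n‖ ≤ ‖lam (n + 1)‖)
    -- eigenfunctions of the adjoint operator
    (φ : ℕ → L2 a)
    (hφ : ∀ n, IsEigenvector (robinOp a cp cm).adjoint (conj (lam n)) (φ n))
    -- their normalization, which may differ for finitely many indices
    (hnorm : ∀ᶠ n in atTop, ∃ l : ℂ, l ^ 2 = lam n ∧
      φ n =ᵐ[volume.restrict (Ioo (-a) a)] adjointFun a cm l) :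
    ∃ (Ω : L2 a ≃L[ℂ] L2 a) (L M : L2 a →L[ℂ] L2 a),
      (∀ f : L2 a, HasSum (fun n => inner ℂ (φ n) f • neumannMode a n) (Ω f)) ∧
      (Ω : L2 a →L[ℂ] L2 a) = ContinuousLinearMap.id ℂ (L2 a) + L ∧
      (Ω.symm : L2 a →L[ℂ] L2 a) = ContinuousLinearMap.id ℂ (L2 a) + M ∧
      IsHilbertSchmidt L ∧ IsHilbertSchmidt M ∧
      (∀ T ∈ ({(Ω : L2 a →L[ℂ] L2 a), ContinuousLinearMap.adjoint (Ω : L2 a →L[ℂ] L2 a),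
          (Ω.symm : L2 a →L[ℂ] L2 a),
          ContinuousLinearMap.adjoint (Ω.symm : L2 a →L[ℂ] L2 a)} : Set (L2 a →L[ℂ] L2 a)),
        BoundedOnW12 a T ∧ BoundedOnW22 a T) ∧
      ∃ C : ℝ, ∀ f f' : L2 a, HasWeakDeriv a f f' →
        ∃ g' h' : L2 a,
          HasWeakDeriv a (ContinuousLinearMap.adjoint L f) g' ∧ HasWeakDeriv a (M f) h' ∧
          ∀ δ : ℝ, 0 < δ → δ ≤ 1 →
            ‖g'‖ ^ 2 ≤ C * (δ * ‖f'‖ ^ 2 + (δ ^ 2)⁻¹ * ‖f‖ ^ 2) ∧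
            ‖h'‖ ^ 2 ≤ C * (δ * ‖f'‖ ^ 2 + (δ ^ 2)⁻¹ * ‖f‖ ^ 2) := by
  have hz (n : ℕ) : robinCharFun a cp cm (lam n) = 0 := (hφ n).robinCharFun_eq_zero ha
  have hs {z : ℂ} (h : robinCharFun a cp cm z = 0) : IsSimpleEigenvalue (robinOp a cp cm) z :=
    hsimple z _ (isEigenvector_robinMap ha h)
  have hzero (z : ℂ) : robinCharFun a cp cm z = 0 ↔ ∃ n, lam n = z :=
    ⟨fun h => (hrange z).2 ⟨_, isEigenvector_robinMap ha h⟩, by rintro ⟨n, rfl⟩; exact hz n⟩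
  obtain ⟨C, hC⟩ := exists_sqrt_near_waveNumber ha hinj hord hzero fun z h =>
    deriv_robinCharFun_ne_zero ha h (hs h)
  -- One square root for every index, including the finitely many without asymptotics; it is the one
  -- near `kₙ` whenever such a root exists.
  have hex (n : ℕ) : ∃ l : ℂ, l ^ 2 = lam n ∧
      ((∃ m : ℂ, m ^ 2 = lam n ∧ ‖m - waveNumber a n‖ ≤ C / n) → ‖l - waveNumber a n‖ ≤ C / n) := by
    by_cases h : ∃ m : ℂ, m ^ 2 = lam n ∧ ‖m - waveNumber a n‖ ≤ C / n
    · obtain ⟨m, hm1, hm2⟩ := h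
      exact ⟨m, hm1, fun _ => hm2⟩
    · obtain ⟨m, hm⟩ := IsAlgClosed.exists_pow_nat_eq (lam n) two_pos
      exact ⟨m, hm, fun h' => absurd h' h⟩
  choose l hl2 hl1 using hex
  have hl : ∀ᶠ n : ℕ in atTop, ‖l n - waveNumber a n‖ ≤ C / n := hC.mono fun n => hl1 n
  obtain rfl : (fun n => l n ^ 2) = lam := funext hl2
  choose α hα0 hα using fun n => (hφ n).exists_eq_smul ha
  have hα1 : ∀ᶠ n in atTop, α n = 1 / (√a : ℂ) := by
    filter_upwards [hnorm, eventually_ne_zero_of_near ha hl] with n ⟨m, hm, hmφ⟩ hn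
    -- The root `m` of the normalization may be `-l n`, but the normalized eigenfunction depends on
    -- `m ^ 2` only.
    have hm0 : m ≠ 0 := fun h => pow_ne_zero 2 hn (by rw [← hm, h, zero_pow two_ne_zero])
    have h1 : φ n = toL2 a (adjointMap a cm (m ^ 2)) := by
      refine eq_toL2 (hmφ.trans (ae_of_all _ fun x => ?_))
      simp only [adjointFun, adjointMap, ContinuousMap.smul_apply, smul_eq_mul,
        robinMapConj_apply a cm hm0]
    rw [hα n, hm, adjointMap, toL2_smul] at h1
    exact smul_left_injective ℂ (toL2_robinMapConj_ne_zero ha cm _) h1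
  have hsum : Summable fun n => ‖φ n - neumannMode a n‖ ^ 2 := by
    simpa only [← hα] using summable_sq_norm_sub_neumannMode ha hl hα1 (cm := cm)
  obtain ⟨K, hK⟩ := IsBessel.of_summable (χ := neumannBasis ha) hsum
  simp only [neumannBasis_apply] at hK
  obtain ⟨hS, hS'⟩ := isSmoothing_of_near ha hl hα1 hz fun n => by rw [hK, hα n]
  refine exists_transform ha hK hsum hS hS' fun f hf => ?_
  -- This series is `(I + K) f`. Pairing it with the eigenfunction of `H` for index `m` leaves only
  -- the term `n = m`, whose pairing is nonzero, so the `m`-th coefficient of `f` vanishes.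
  have h1 : HasSum (fun n => inner ℂ (neumannMode a n) f • φ n) 0 := by
    have h2 := (neumannBasis ha).hasSum_apply (ContinuousLinearMap.id ℂ (L2 a) + K) f
    rw [add_apply, ContinuousLinearMap.id_apply, hf] at h2
    refine h2.congr_fun fun n => ?_
    rw [neumannBasis_apply, add_apply, ContinuousLinearMap.id_apply, hK,
      add_sub_cancel]
  refine (neumannBasis ha).repr.injective (lp.ext (funext fun m => ?_))
  rw [HilbertBasis.repr_apply_apply, neumannBasis_apply, map_zero]
  change _ = (0 : ℂ)
  have h2 := h1.mapL (innerSL ℂ (toL2 a (robinMap a cm (l m ^ 2))))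
  rw [map_zero] at h2
  have h3 := h2.unique (hasSum_single m fun n hn => ?_)
  · rw [innerSL_apply_apply, inner_smul_right] at h3
    refine (mul_eq_zero.1 h3.symm).resolve_right fun h => ?_
    rw [← inner_conj_symm, map_eq_zero, hα m, inner_smul_left, mul_eq_zero, map_eq_zero] at h
    exact h.elim (hα0 m) (inner_robinMapConj_self_ne_zero ha (hz m) (hs (hz m)))
  · have h3 : inner ℂ (φ n) (toL2 a (robinMap a cm (l m ^ 2))) = 0 :=
      (hφ n).inner_robinMap_of_ne ha (hz m) fun h => hn (hinj h).symm
    rw [innerSL_apply_apply, inner_smul_right, inner_eq_zero_symm.1 h3, mul_zero]
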